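/- All $C^*$-algebras are complex, and graded means $\mathbb Z/2\mathbb Z$-graded, the grading being a $*$-automorphism $\varepsilon$ with $\varepsilon^2=1$. A Real structure on a graded $C^*$-algebra is an antilinear $*$-automorphism of square $1$ that commutes with $\varepsilon$. A graded Hilbert space is a Hilbert space $\mathcal H=\mathcal H_0\oplus\mathcal H_1$ with an orthogonal decomposition into an even and an odd part; a Real structure on it is an antilinear involution $x\mapsto\bar x$ with $\langle\bar x,\bar y\rangle=\overline{\langle x,y\rangle}$ that preserves $\mathcal H_0$ and $\mathcal H_1$. All Hilbert spaces are separable. The algebra $\mathcal K(\mathcal H)$ of compact operators carries the diagonal/off-diagonal grading and the Real structure $\bar T(x)=\overline{T(\bar x)}$; $\mathcal S=C_0(\mathbb R)$ is graded by even and odd functions and has pointwise conjugation as Real structure; $\hat\otimes$ is the graded maximal tensor product. $\operatorname{Hom}(A,B)$ is the space of grading-preserving $*$-homomorphisms with the point-norm topology, based at $0$. For a graded $C^*$-algebra $A$ and a graded Hilbert space $H$ put $$\mathbb K(A,H)=\operatorname{Hom}(\mathcal S,A\hat\otimes\mathcal K(H)),\qquad K_i^{\mathrm{sp}}(A)=\pi_i\big(\mathbb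 K(A,\hat{\ell^2}),0\big)\quad(i\ge 0),$$ where $\hat{\ell^2}=\ell^2\oplus\ell^2$ with first summand even and second summand odd. Each even unitary $u:\hat{\ell^2}\oplus\hat{\ell^2}\to\hat{\ell^2}$ makes $\mathbb K(A,\hat{\ell^2})$ an $H$-space, with the sum of $\varphi$ and $\psi$ given by $\operatorname{diag}(\varphi,\psi)$ followed by conjugation by $u$; this induces the addition on $K_i^{\mathrm{sp}}(A)$, in particular on $K_0^{\mathrm{sp}}(A)$. **Theorem (stability).** Let $A$ be a graded $C^*$-algebra, $\mathcal H$ a graded Hilbert space, and $e_{11}\in\mathcal K(\mathcal H)$ the projection onto an even one-dimensional subspace of $\mathcal H$. Let $\Phi:A\to A\hat\otimes\mathcal K(\mathcal H)$ be the graded $*$-homomorphism $\Phi(a)=a\hat\otimes e_{11}$. 1. For every graded Hilbert space $H$ whose even and odd parts are both (countably) infinite-dimensional, the induced map $\mathbb K(\Phi):\mathbb K(A,H)\to\mathbb K(A\hat\otimes\mathcal K(\mathcal H),H)$ is a homotopy equivalence of pointed spaces. 2. For every $i\ge 0$ the induced map $K_i^{\mathrm{sp}}(\Phi):K_i^{\mathrm{sp}}(A)\to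 K_i^{\mathrm{sp}}(A\hat\otimes\mathcal K(\mathcal H))$ is bijective. It preserves the group structure of the homotopy groups for $i\ge 1$, and, for every $i\geq 0$ and every $u$ as above, the addition induced by the $H$-space structure. The same holds in the Real theory, in which $A$, $\mathcal H$ and $H$ carry Real structures, all homomorphisms and the unitaries $u$ preserve the Real structures, $\hat{\ell^2}$ has coordinatewise conjugation, and $e_{11}$ is Real (its range is invariant under conjugation). -/

import Mathlib

open scoped TensorProduct ZeroAtInfty Topology InnerProductSpace

noncomputable section

set_option linter.unusedSectionVars false
set_option linter.unusedSimpArgs false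

namespace SpectralK

/-! ### Completions of pre-C*-algebras -/

/-- A complex `*`-algebra with a submultiplicative seminorm that satisfies the C*-identity. -/
class PreCStarAlgebra (R : Type*) extends NonUnitalSeminormedRing R, StarRing R,
    NormedSpace ℂ R, IsScalarTower ℂ R R, SMulCommClass ℂ R R, StarModule ℂ R where
  norm_star_mul_self' : ∀ x : R, ‖star x * x‖ = ‖x‖ * ‖x‖

/-- The C*-algebra obtained from a pre-C*-algebra by separation and completion. -/
def CStarCompletion (R : Type*) [PreCStarAlgebra R] : Type _ := UniformSpace.Completion R

namespace CStarCompletion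

open UniformSpace

variable {R R' : Type*} [PreCStarAlgebra R] [PreCStarAlgebra R']

instance : NormedAddCommGroup (CStarCompletion R) :=
  inferInstanceAs (NormedAddCommGroup (Completion R))

instance : NormedSpace ℂ (CStarCompletion R) :=
  inferInstanceAs (NormedSpace ℂ (Completion R))

instance : CompleteSpace (CStarCompletion R) :=
  inferInstanceAs (CompleteSpace (Completion R))

instance : ContinuousConstSMul ℂ (CStarCompletion R) :=
  inferInstanceAs (ContinuousConstSMul ℂ (Completion R))

/-- The canonical map of a pre-C*-algebra to its completion. -/
def of (x : R) : CStarCompletion R := (x : Completion R)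

theorem norm_of (x : R) : ‖of x‖ = ‖x‖ := Completion.norm_coe x
theorem of_add (x y : R) : of (x + y) = of x + of y := Completion.coe_add x y
theorem of_zero : of (0 : R) = 0 := Completion.coe_zero
theorem of_smul (c : ℂ) (x : R) : of (c • x) = c • of x := Completion.coe_smul c x
theorem isDenseInducing_of : IsDenseInducing (of : R → CStarCompletion R) :=
  Completion.isDenseInducing_coe
theorem denseRange_of : DenseRange (of : R → CStarCompletion R) := isDenseInducing_of.dense
theorem continuous_of : Continuous (of : R → CStarCompletion R) := isDenseInducing_of.continuous

theorem norm_star_le (x : R) : ‖star x‖ ≤ ‖x‖ := by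
  have h := PreCStarAlgebra.norm_star_mul_self' (star x)
  rw [star_star] at h
  have h2 := norm_mul_le x (star x)
  rcases (norm_nonneg (star x)).eq_or_lt with h0 | h0
  · rw [← h0]; exact norm_nonneg x
  · nlinarith

theorem norm_star' (x : R) : ‖star x‖ = ‖x‖ :=
  le_antisymm (norm_star_le x) (by simpa using norm_star_le (star x))

instance : Mul (CStarCompletion R) :=
  ⟨Function.curry <| (isDenseInducing_of.prodMap isDenseInducing_of).extend
    (of ∘ Function.uncurry (· * ·))⟩

theorem of_mul (x y : R) : of (x * y) = of x * of y :=
  ((isDenseInducing_of.prodMap isDenseInducing_of).extend_eq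
    (continuous_of.comp continuous_mul) (x, y)).symm

instance : ContinuousMul (CStarCompletion R) where
  continuous_mul := by
    let m := (AddMonoidHom.mul : R →+ R →+ R).compr₂ (Completion.toCompl (α := R))
    have : Continuous fun p : R × R => m p.1 p.2 := (Completion.continuous_coe R).comp continuous_mul
    have di : IsDenseInducing (Completion.toCompl : R → Completion R) :=
      Completion.isDenseInducing_coe
    exact (di.extend_Z_bilin di this :)

theorem uniformContinuous_star' : UniformContinuous (star : R → R) :=
  (AddMonoidHomClass.isometry_of_norm (starAddEquiv : R ≃+ R) norm_star').uniformContinuous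

instance : Star (CStarCompletion R) := ⟨Completion.map (star : R → R)⟩

theorem of_star (x : R) : of (star x) = star (of x) :=
  (Completion.map_coe uniformContinuous_star' x).symm

instance : ContinuousStar (CStarCompletion R) where
  continuous_star := Completion.continuous_map

theorem ind {p : CStarCompletion R → Prop} (a : CStarCompletion R) (hp : IsClosed {a | p a})
    (h : ∀ x, p (of x)) : p a := Completion.induction_on a hp h

theorem ind₂ {p : CStarCompletion R → CStarCompletion R → Prop} (a b : CStarCompletion R)
    (hp : IsClosed {x : CStarCompletion R × CStarCompletion R | p x.1 x.2})
    (h : ∀ x y, p (of x) (of y)) : p a b := Completion.induction_on₂ a b hp h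

theorem ind₃ {p : CStarCompletion R → CStarCompletion R → CStarCompletion R → Prop}
    (a b c : CStarCompletion R)
    (hp : IsClosed {x : CStarCompletion R × CStarCompletion R × CStarCompletion R |
      p x.1 x.2.1 x.2.2})
    (h : ∀ x y z, p (of x) (of y) (of z)) : p a b c := Completion.induction_on₃ a b c hp h

theorem mul_assoc' (a b c : CStarCompletion R) : a * b * c = a * (b * c) := by
  induction a, b, c using ind₃ with
  | hp => exact isClosed_eq (by fun_prop) (by fun_prop)
  | h a b c => simp only [← of_mul, mul_assoc]

theorem mul_add' (a b c : CStarCompletion R) : a * (b + c) = a * b + a * c := by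
  induction a, b, c using ind₃ with
  | hp => exact isClosed_eq (by fun_prop) (by fun_prop)
  | h a b c => simp only [← of_mul, ← of_add, mul_add]

theorem add_mul' (a b c : CStarCompletion R) : (a + b) * c = a * c + b * c := by
  induction a, b, c using ind₃ with
  | hp => exact isClosed_eq (by fun_prop) (by fun_prop)
  | h a b c => simp only [← of_mul, ← of_add, add_mul]

theorem zero_mul' (a : CStarCompletion R) : 0 * a = 0 := by
  have h := add_mul' 0 0 a
  rw [add_zero] at h
  exact left_eq_add.mp h

theorem mul_zero' (a : CStarCompletion R) : a * 0 = 0 := by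
  have h := mul_add' a 0 0
  rw [add_zero] at h
  exact left_eq_add.mp h

theorem norm_mul_le' (a b : CStarCompletion R) : ‖a * b‖ ≤ ‖a‖ * ‖b‖ := by
  induction a, b using ind₂ with
  | hp => exact isClosed_le (by fun_prop) (by fun_prop)
  | h a b => simpa only [← of_mul, norm_of] using norm_mul_le a b

theorem star_star' (a : CStarCompletion R) : star (star a) = a := by
  induction a using ind with
  | hp => exact isClosed_eq (by fun_prop) (by fun_prop)
  | h a => simp only [← of_star, star_star]

theorem star_mul' (a b : CStarCompletion R) : star (a * b) = star b * star a := by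
  induction a, b using ind₂ with
  | hp => exact isClosed_eq (by fun_prop) (by fun_prop)
  | h a b => simp only [← of_star, ← of_mul, star_mul]

theorem star_add' (a b : CStarCompletion R) : star (a + b) = star a + star b := by
  induction a, b using ind₂ with
  | hp => exact isClosed_eq (by fun_prop) (by fun_prop)
  | h a b => simp only [← of_star, ← of_add, star_add]

theorem star_smul' (c : ℂ) (a : CStarCompletion R) : star (c • a) = star c • star a := by
  induction a using ind with
  | hp =>
    refine isClosed_eq ?_ ?_
    · exact (continuous_star.comp (continuous_const_smul c))
    · exact (continuous_star.const_smul (star c))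
  | h a => simp only [← of_star, ← of_smul, star_smul]

theorem smul_mul' (c : ℂ) (a b : CStarCompletion R) : c • a * b = c • (a * b) := by
  induction a, b using ind₂ with
  | hp =>
    refine isClosed_eq ?_ ?_
    · exact ((continuous_fst.const_smul c).mul continuous_snd)
    · exact ((continuous_fst.mul continuous_snd).const_smul c)
  | h a b => simp only [← of_smul, ← of_mul, smul_mul_assoc]

theorem mul_smul' (c : ℂ) (a b : CStarCompletion R) : a * c • b = c • (a * b) := by
  induction a, b using ind₂ with
  | hp =>
    refine isClosed_eq ?_ ?_
    · exact (continuous_fst.mul (continuous_snd.const_smul c))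
    · exact ((continuous_fst.mul continuous_snd).const_smul c)
  | h a b => simp only [← of_smul, ← of_mul, mul_smul_comm]

theorem cstar' (a : CStarCompletion R) : ‖a‖ * ‖a‖ ≤ ‖star a * a‖ := by
  induction a using ind with
  | hp => exact isClosed_le (by fun_prop) (by fun_prop)
  | h a => rw [← of_star, ← of_mul, norm_of, norm_of, PreCStarAlgebra.norm_star_mul_self']

instance : NonUnitalNormedRing (CStarCompletion R) :=
  { (inferInstance : NormedAddCommGroup (CStarCompletion R)),
    (inferInstance : Mul (CStarCompletion R)) with
    zero_mul := zero_mul'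
    mul_zero := mul_zero'
    mul_assoc := mul_assoc'
    left_distrib := mul_add'
    right_distrib := add_mul'
    norm_mul_le := norm_mul_le' }

instance : StarRing (CStarCompletion R) where
  star_involutive := star_star'
  star_mul := star_mul'
  star_add := star_add'

instance : NonUnitalCStarAlgebra (CStarCompletion R) where
  __ := (inferInstance : NormedSpace ℂ (CStarCompletion R))
  complete := CompleteSpace.complete
  norm_mul_self_le := cstar'
  smul_assoc := smul_mul'
  smul_comm c a b := (mul_smul' c a b).symm
  star_smul := star_smul'

def mapFun (f : R → R') : CStarCompletion R → CStarCompletion R' :=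
  (Completion.map f : Completion R → Completion R')

theorem mapFun_of {F : Type*} [FunLike F R R'] [AddMonoidHomClass F R R'] (f : F)
    (hf : ∀ x, ‖f x‖ ≤ ‖x‖) (x : R) : mapFun f (of x) = of (f x) :=
  Completion.map_coe (AddMonoidHomClass.lipschitz_of_bound f 1
    (by simpa using hf)).uniformContinuous x

theorem continuous_mapFun (f : R → R') : Continuous (mapFun f) :=
  Completion.continuous_map (f := f)

/-- The extension to completions of a contractive `*`-homomorphism of pre-C*-algebras. -/
def map (f : R →⋆ₙₐ[ℂ] R') (hf : ∀ x, ‖f x‖ ≤ ‖x‖) :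
    CStarCompletion R →⋆ₙₐ[ℂ] CStarCompletion R' where
  toFun := (UniformSpace.Completion.map f : Completion R → Completion R')
  map_smul' c a := by
    change mapFun f (c • a) = c • mapFun f a
    have := continuous_mapFun f
    induction a using ind with
    | hp =>
      refine isClosed_eq ?_ ?_
      · exact (this.comp (continuous_const_smul c))
      · exact (this.const_smul c)
    | h a => simp only [← of_smul, mapFun_of f hf, map_smul]
  map_zero' := by
    change mapFun f 0 = 0
    rw [← of_zero, mapFun_of f hf, map_zero, of_zero]
  map_add' a b := by
    change mapFun f (a + b) = mapFun f a + mapFun f b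
    have := continuous_mapFun f
    induction a, b using ind₂ with
    | hp => exact isClosed_eq (by fun_prop) (by fun_prop)
    | h a b => simp only [← of_add, mapFun_of f hf, map_add]
  map_mul' a b := by
    change mapFun f (a * b) = mapFun f a * mapFun f b
    have := continuous_mapFun f
    induction a, b using ind₂ with
    | hp =>
      refine isClosed_eq ?_ ?_
      · exact (this.comp continuous_mul)
      · exact ((this.comp continuous_fst).mul (this.comp continuous_snd))
    | h a b => simp only [← of_mul, mapFun_of f hf, map_mul]
  map_star' a := by
    change mapFun f (star a) = star (mapFun f a)
    have := continuous_mapFun f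
    induction a using ind with
    | hp => exact isClosed_eq (by fun_prop) (by fun_prop)
    | h a => simp only [← of_star, mapFun_of f hf, map_star]

theorem map_of (f : R →⋆ₙₐ[ℂ] R') (hf : ∀ x, ‖f x‖ ≤ ‖x‖) (x : R) :
    map f hf (of x) = of (f x) := mapFun_of f hf x

theorem continuous_map (f : R →⋆ₙₐ[ℂ] R') (hf : ∀ x, ‖f x‖ ≤ ‖x‖) : Continuous (map f hf) :=
  continuous_mapFun f

/-- The extension to the completion of a contractive additive map. -/
def mapAdd (f : R →+ R) : CStarCompletion R → CStarCompletion R :=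
  (UniformSpace.Completion.map f : Completion R → Completion R)

theorem mapAdd_of (f : R →+ R) (hf : ∀ x, ‖f x‖ ≤ ‖x‖) (x : R) :
    mapAdd f (of x) = of (f x) := mapFun_of f hf x

theorem continuous_mapAdd (f : R →+ R) : Continuous (mapAdd f) := continuous_mapFun f

end CStarCompletion

/-! ### Graded and Real C*-algebras -/

/-- A `ℤ/2`-grading on a C*-algebra: a `*`-automorphism whose square is the identity. -/
class GradedCStarAlgebra (A : Type*) [NonUnitalCStarAlgebra A] where
  grading : A →⋆ₙₐ[ℂ] A
  grading_grading : ∀ a, grading (grading a) = a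

/-- The two versions of the theory: for graded complex C*-algebras, and for graded Real
C*-algebras. -/
inductive Flavor
  | complex
  | real

/-- In the Real theory, a Real structure on a graded C*-algebra: an antilinear `*`-automorphism
whose square is the identity and that commutes with the grading. In the complex theory there is
no further structure. -/
class RealStructure (t : Flavor) (A : Type*) [NonUnitalCStarAlgebra A]
    [GradedCStarAlgebra A] where
  bar : t = .real → A → A
  bar_add : ∀ h a b, bar h (a + b) = bar h a + bar h b
  bar_smul : ∀ h (c : ℂ) a, bar h (c • a) = star c • bar h a
  bar_mul : ∀ h a b, bar h (a * b) = bar h a * bar h b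
  bar_star : ∀ h a, bar h (star a) = star (bar h a)
  bar_bar : ∀ h a, bar h (bar h a) = a
  bar_grading : ∀ h a, bar h (GradedCStarAlgebra.grading a) =
    GradedCStarAlgebra.grading (bar h a)

open GradedCStarAlgebra RealStructure

/-- `bar` as an additive map. -/
def barAddHom {t : Flavor} (ht : t = .real) (A : Type*) [NonUnitalCStarAlgebra A]
    [GradedCStarAlgebra A] [RealStructure t A] : A →+ A :=
  AddMonoidHom.mk' (bar ht) (bar_add ht)

theorem norm_bar {t : Flavor} (ht : t = .real) {A : Type*} [NonUnitalCStarAlgebra A]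
    [GradedCStarAlgebra A] [RealStructure t A] (a : A) : ‖bar ht a‖ = ‖a‖ := by
  let σ : A →⋆ₙₐ[ℂ] Aᵐᵒᵖ :=
    { toFun := fun a => MulOpposite.op (star (bar ht a))
      map_smul' := fun c a => by
        simp [bar_smul]
      map_zero' := by
        have : bar ht (0 : A) = 0 := (barAddHom ht A).map_zero
        simp [this]
      map_add' := fun a b => by simp [bar_add]
      map_mul' := fun a b => by simp [bar_mul]
      map_star' := fun a => by simp [bar_star, ← MulOpposite.op_star] }
  have h : ∀ a : A, ‖bar ht a‖ ≤ ‖a‖ := fun a => by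
    have := NonUnitalStarAlgHom.norm_apply_le σ a
    have h2 : ‖σ a‖ = ‖bar ht a‖ := by
      change ‖MulOpposite.op (star (bar ht a))‖ = _
      rw [MulOpposite.norm_op, norm_star]
    rwa [h2] at this
  refine le_antisymm (h a) ?_
  simpa [bar_bar] using h (bar ht a)

section Parts

variable {B : Type*} [NonUnitalCStarAlgebra B] [GradedCStarAlgebra B]

/-- The projection onto the even part. -/
def evenPart : B →ₗ[ℂ] B where
  toFun b := (1 / 2 : ℂ) • (b + grading b)
  map_add' x y := by simp only [map_add, ← smul_add]; congr 1; abel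
  map_smul' c x := by simp only [map_smul, ← smul_add, RingHom.id_apply, smul_comm c]

/-- The projection onto the odd part. -/
def oddPart : B →ₗ[ℂ] B where
  toFun b := (1 / 2 : ℂ) • (b - grading b)
  map_add' x y := by simp only [map_add, ← smul_add]; congr 1; abel
  map_smul' c x := by simp only [map_smul, ← smul_sub, RingHom.id_apply, smul_comm c]

theorem evenPart_apply (b : B) : evenPart b = (1 / 2 : ℂ) • (b + grading b) := rfl
theorem oddPart_apply (b : B) : oddPart b = (1 / 2 : ℂ) • (b - grading b) := rfl

theorem evenPart_add_oddPart (b : B) : evenPart b + oddPart b = b := by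
  rw [evenPart_apply, oddPart_apply, ← smul_add, add_add_sub_cancel, ← two_smul ℂ b, smul_smul]
  norm_num

theorem grading_evenPart (b : B) : grading (evenPart b) = evenPart b := by
  simp only [evenPart_apply, map_smul, map_add, grading_grading, add_comm]

theorem grading_oddPart (b : B) : grading (oddPart b) = -oddPart b := by
  simp only [oddPart_apply, map_smul, map_sub, grading_grading, ← smul_neg, neg_sub]

theorem evenPart_eq {b : B} (h : grading b = b) : evenPart b = b := by
  rw [evenPart_apply, h, ← two_smul ℂ b, smul_smul]; norm_num

theorem evenPart_eq_zero {b : B} (h : grading b = -b) : evenPart b = 0 := by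
  rw [evenPart_apply, h]; simp

theorem oddPart_eq_zero {b : B} (h : grading b = b) : oddPart b = 0 := by
  rw [oddPart_apply, h]; simp

theorem oddPart_eq {b : B} (h : grading b = -b) : oddPart b = b := by
  rw [oddPart_apply, h, sub_neg_eq_add, ← two_smul ℂ b, smul_smul]; norm_num

end Parts

/-! ### The graded algebraic tensor product -/

section Alg

variable (A B : Type*) [NonUnitalCStarAlgebra A] [GradedCStarAlgebra A]
  [NonUnitalCStarAlgebra B] [GradedCStarAlgebra B]

/-- The algebraic tensor product of two graded C*-algebras; it is equipped below with the graded
product `(a ⊗ b)(c ⊗ d) = (-1)^(∂b ∂c) ac ⊗ bd` and the involution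
`(a ⊗ b)* = (-1)^(∂a ∂b) a* ⊗ b*`. -/
def AlgTensor : Type _ := A ⊗[ℂ] B

namespace AlgTensor

instance : AddCommGroup (AlgTensor A B) := inferInstanceAs (AddCommGroup (A ⊗[ℂ] B))
instance : Module ℂ (AlgTensor A B) := inferInstanceAs (Module ℂ (A ⊗[ℂ] B))

variable {A B}

/-- Elementary tensors. -/
def tmul (a : A) (b : B) : AlgTensor A B := a ⊗ₜ[ℂ] b

theorem tmul_add (a : A) (b b' : B) : tmul a (b + b') = tmul a b + tmul a b' :=
  TensorProduct.tmul_add a b b'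
theorem add_tmul (a a' : A) (b : B) : tmul (a + a') b = tmul a b + tmul a' b :=
  TensorProduct.add_tmul a a' b
theorem smul_tmul (c : ℂ) (a : A) (b : B) : tmul (c • a) b = c • tmul a b := rfl
theorem tmul_smul (c : ℂ) (a : A) (b : B) : tmul a (c • b) = c • tmul a b :=
  TensorProduct.tmul_smul c a b
theorem tmul_zero (a : A) : tmul a (0 : B) = 0 := TensorProduct.tmul_zero B a
theorem zero_tmul (b : B) : tmul (0 : A) b = 0 := TensorProduct.zero_tmul A b
theorem neg_tmul (a : A) (b : B) : tmul (-a) b = -tmul a b := TensorProduct.neg_tmul a b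
theorem tmul_neg (a : A) (b : B) : tmul a (-b) = -tmul a b := TensorProduct.tmul_neg a b

theorem ind {p : AlgTensor A B → Prop} (x : AlgTensor A B) (zero : p 0)
    (tmul : ∀ a b, p (tmul a b)) (add : ∀ x y, p x → p y → p (x + y)) : p x :=
  TensorProduct.induction_on x zero tmul add

/-- Every element is a sum of elementary tensors of homogeneous elements. -/
theorem hind {p : AlgTensor A B → Prop} (x : AlgTensor A B) (zero : p 0)
    (tmul : ∀ (a : A) (b : B), (grading a = a ∨ grading a = -a) →
      (grading b = b ∨ grading b = -b) → p (tmul a b))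
    (add : ∀ x y, p x → p y → p (x + y)) : p x := by
  induction x using ind with
  | zero => exact zero
  | add x y hx hy => exact add x y hx hy
  | tmul a b =>
    rw [← evenPart_add_oddPart a, ← evenPart_add_oddPart b, tmul_add, add_tmul, add_tmul]
    refine add _ _ (add _ _ ?_ ?_) (add _ _ ?_ ?_) <;> apply tmul <;>
      simp [grading_evenPart, grading_oddPart]

/-- Linear maps out of the algebraic tensor product. -/
def lift {M : Type*} [AddCommGroup M] [Module ℂ M] (f : A →ₗ[ℂ] B →ₗ[ℂ] M) :
    AlgTensor A B →ₗ[ℂ] M := TensorProduct.lift f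

theorem lift_tmul {M : Type*} [AddCommGroup M] [Module ℂ M] (f : A →ₗ[ℂ] B →ₗ[ℂ] M)
    (a : A) (b : B) : lift f (tmul a b) = f a b := TensorProduct.lift.tmul a b

/-- Left multiplication by `a ⊗ b`. -/
def mulAux (a : A) (b : B) : AlgTensor A B →ₗ[ℂ] AlgTensor A B :=
  lift (LinearMap.mk₂ ℂ
    (fun c d => tmul (a * c) (evenPart b * d) + tmul (a * grading c) (oddPart b * d))
    (fun c c' d => by simp only [mul_add, map_add, add_tmul]; abel)
    (fun r c d => by simp only [mul_smul_comm, map_smul, smul_tmul, smul_add])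
    (fun c d d' => by simp only [mul_add, tmul_add]; abel)
    (fun r c d => by simp only [mul_smul_comm, tmul_smul, smul_add]))

theorem mulAux_tmul (a : A) (b : B) (c : A) (d : B) : mulAux a b (tmul c d) =
    tmul (a * c) (evenPart b * d) + tmul (a * grading c) (oddPart b * d) := lift_tmul _ _ _

theorem ext {M : Type*} [AddCommGroup M] [Module ℂ M] {f g : AlgTensor A B →ₗ[ℂ] M}
    (h : ∀ a b, f (tmul a b) = g (tmul a b)) : f = g := TensorProduct.ext' h

/-- The graded multiplication as a bilinear map. -/
def mulL : AlgTensor A B →ₗ[ℂ] AlgTensor A B →ₗ[ℂ] AlgTensor A B :=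
  lift (LinearMap.mk₂ ℂ mulAux
    (fun a a' b => ext fun c d => by
      simp only [mulAux_tmul, LinearMap.add_apply, add_mul, add_tmul]; abel)
    (fun r a b => ext fun c d => by
      simp only [mulAux_tmul, LinearMap.smul_apply, smul_mul_assoc, smul_tmul, smul_add])
    (fun a b b' => ext fun c d => by
      simp only [mulAux_tmul, LinearMap.add_apply, map_add, add_mul, tmul_add]; abel)
    (fun r a b => ext fun c d => by
      simp only [mulAux_tmul, LinearMap.smul_apply, map_smul, smul_mul_assoc, tmul_smul,
        smul_add]))

instance : Mul (AlgTensor A B) := ⟨fun x y => mulL x y⟩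

theorem tmul_mul_tmul (a : A) (b : B) (c : A) (d : B) : tmul a b * tmul c d =
    tmul (a * c) (evenPart b * d) + tmul (a * grading c) (oddPart b * d) := by
  change mulL (tmul a b) (tmul c d) = _
  rw [mulL, lift_tmul, LinearMap.mk₂_apply, mulAux_tmul]

/-- If `b` or `c` is even, there is no sign in the product. -/
theorem tmul_mul_tmul_of_even_left (a : A) {b : B} (hb : grading b = b) (c : A) (d : B) :
    tmul a b * tmul c d = tmul (a * c) (b * d) := by
  rw [tmul_mul_tmul, evenPart_eq hb, oddPart_eq_zero hb, zero_mul, tmul_zero, add_zero]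

theorem tmul_mul_tmul_of_odd_left (a : A) {b : B} (hb : grading b = -b) (c : A) (d : B) :
    tmul a b * tmul c d = tmul (a * grading c) (b * d) := by
  rw [tmul_mul_tmul, evenPart_eq_zero hb, oddPart_eq hb, zero_mul, tmul_zero, zero_add]

theorem mul_add' (x y z : AlgTensor A B) : x * (y + z) = x * y + x * z := map_add (mulL x) y z
theorem add_mul' (x y z : AlgTensor A B) : (x + y) * z = x * z + y * z := by
  change mulL (x + y) z = mulL x z + mulL y z
  rw [map_add, LinearMap.add_apply]
theorem zero_mul' (x : AlgTensor A B) : 0 * x = 0 := by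
  change mulL 0 x = 0
  rw [map_zero, LinearMap.zero_apply]
theorem mul_zero' (x : AlgTensor A B) : x * 0 = 0 := map_zero (mulL x)
theorem smul_mul' (c : ℂ) (x y : AlgTensor A B) : (c • x) * y = c • (x * y) := by
  change mulL (c • x) y = c • mulL x y
  rw [map_smul, LinearMap.smul_apply]
theorem mul_smul' (c : ℂ) (x y : AlgTensor A B) : x * (c • y) = c • (x * y) :=
  map_smul (mulL x) c y

theorem grading_mul_odd_odd {b b' : B} (h : grading b = -b) (h' : grading b' = -b') :
    grading (b * b') = b * b' := by rw [map_mul, h, h', neg_mul_neg]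
theorem grading_mul_even_even {b b' : B} (h : grading b = b) (h' : grading b' = b') :
    grading (b * b') = b * b' := by rw [map_mul, h, h']
theorem grading_mul_odd_even {b b' : B} (h : grading b = -b) (h' : grading b' = b') :
    grading (b * b') = -(b * b') := by rw [map_mul, h, h', neg_mul]
theorem grading_mul_even_odd {b b' : B} (h : grading b = b) (h' : grading b' = -b') :
    grading (b * b') = -(b * b') := by rw [map_mul, h, h', mul_neg]

theorem mul_assoc' (x y z : AlgTensor A B) : x * y * z = x * (y * z) := by
  induction x using hind with
  | zero => simp only [zero_mul']
  | add x x' hx hx' => simp only [add_mul', hx, hx']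
  | tmul a b _ hb =>
    induction y using hind with
    | zero => simp only [zero_mul', mul_zero']
    | add x x' hx hx' => simp only [add_mul', mul_add', hx, hx']
    | tmul c d _ hd =>
      induction z using ind with
      | zero => simp only [mul_zero']
      | add x x' hx hx' => simp only [mul_add', hx, hx']
      | tmul e f =>
        rcases hb with hb | hb <;> rcases hd with hd | hd
        · simp only [tmul_mul_tmul_of_even_left _ hb, tmul_mul_tmul_of_even_left _ hd,
            tmul_mul_tmul_of_even_left _ (grading_mul_even_even hb hd), mul_assoc]
        · simp only [tmul_mul_tmul_of_even_left _ hb, tmul_mul_tmul_of_odd_left _ hd,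
            tmul_mul_tmul_of_odd_left _ (grading_mul_even_odd hb hd), mul_assoc]
        · simp only [tmul_mul_tmul_of_odd_left _ hb, tmul_mul_tmul_of_even_left _ hd,
            tmul_mul_tmul_of_odd_left _ (grading_mul_odd_even hb hd), mul_assoc, map_mul]
        · simp only [tmul_mul_tmul_of_odd_left _ hb, tmul_mul_tmul_of_odd_left _ hd,
            tmul_mul_tmul_of_even_left _ (grading_mul_odd_odd hb hd), mul_assoc, map_mul,
            grading_grading]

instance : NonUnitalRing (AlgTensor A B) where
  left_distrib := mul_add'
  right_distrib := add_mul'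
  zero_mul := zero_mul'
  mul_zero := mul_zero'
  mul_assoc := mul_assoc'

instance : IsScalarTower ℂ (AlgTensor A B) (AlgTensor A B) := ⟨smul_mul'⟩
instance : SMulCommClass ℂ (AlgTensor A B) (AlgTensor A B) :=
  ⟨fun c x y => (mul_smul' c x y).symm⟩

/-- The Koszul sign `a ⊗ b ↦ (-1)^(∂a ∂b) a ⊗ b`. -/
def koszul : AlgTensor A B →ₗ[ℂ] AlgTensor A B :=
  lift (LinearMap.mk₂ ℂ (fun a b => tmul a (evenPart b) + tmul (grading a) (oddPart b))
    (fun a a' b => by simp only [map_add, add_tmul]; abel)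
    (fun r a b => by simp only [map_smul, smul_tmul, smul_add])
    (fun a b b' => by simp only [map_add, tmul_add]; abel)
    (fun r a b => by simp only [map_smul, tmul_smul, smul_add]))

/-- The ungraded involution `a ⊗ b ↦ a* ⊗ b*`. -/
def star₀ : AlgTensor A B →+ AlgTensor A B :=
  ((starAddEquiv : A ⊗[ℂ] B ≃+ A ⊗[ℂ] B) : A ⊗[ℂ] B →+ A ⊗[ℂ] B)

theorem star₀_tmul (a : A) (b : B) : star₀ (tmul a b) = tmul (star a) (star b) := rfl

theorem star₀_smul (c : ℂ) (x : AlgTensor A B) : star₀ (c • x) = star c • star₀ x :=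
  star_smul (A := A ⊗[ℂ] B) c x

instance : Star (AlgTensor A B) := ⟨fun x => star₀ (koszul x)⟩

theorem star_tmul (a : A) (b : B) : star (tmul a b) =
    tmul (star a) (star (evenPart b)) + tmul (star (grading a)) (star (oddPart b)) := by
  change star₀ (koszul (tmul a b)) = _
  rw [koszul, lift_tmul, LinearMap.mk₂_apply, map_add, star₀_tmul, star₀_tmul]

theorem star_tmul_of_even_right (a : A) {b : B} (hb : grading b = b) :
    star (tmul a b) = tmul (star a) (star b) := by
  rw [star_tmul, evenPart_eq hb, oddPart_eq_zero hb, star_zero, tmul_zero, add_zero]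

theorem star_tmul_of_odd_right (a : A) {b : B} (hb : grading b = -b) :
    star (tmul a b) = tmul (star (grading a)) (star b) := by
  rw [star_tmul, evenPart_eq_zero hb, oddPart_eq hb, star_zero, tmul_zero, zero_add]

theorem star_add' (x y : AlgTensor A B) : star (x + y) = star x + star y := by
  change star₀ (koszul (x + y)) = star₀ (koszul x) + star₀ (koszul y)
  rw [map_add, map_add]

theorem star_smul' (c : ℂ) (x : AlgTensor A B) : star (c • x) = star c • star x := by
  change star₀ (koszul (c • x)) = star c • star₀ (koszul x)
  rw [map_smul, star₀_smul]

theorem star_zero' : star (0 : AlgTensor A B) = 0 := by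
  change star₀ (koszul 0) = 0
  rw [map_zero, map_zero]

theorem grading_star_even {b : B} (hb : grading b = b) : grading (star b) = star b := by
  rw [map_star, hb]
theorem grading_star_odd {b : B} (hb : grading b = -b) : grading (star b) = -star b := by
  rw [map_star, hb, star_neg]

theorem star_star' (x : AlgTensor A B) : star (star x) = x := by
  induction x using hind with
  | zero => simp only [star_zero']
  | add x y hx hy => simp only [star_add', hx, hy]
  | tmul a b _ hb =>
    rcases hb with hb | hb
    · simp only [star_tmul_of_even_right _ hb, star_tmul_of_even_right _ (grading_star_even hb),
        star_star]
    · simp only [star_tmul_of_odd_right _ hb, star_tmul_of_odd_right _ (grading_star_odd hb),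
        star_star, map_star, grading_grading]

theorem star_mul' (x y : AlgTensor A B) : star (x * y) = star y * star x := by
  induction x using hind with
  | zero => simp only [star_zero', zero_mul, mul_zero]
  | add x x' hx hx' => simp only [add_mul, mul_add, star_add', hx, hx']
  | tmul a b _ hb =>
    induction y using hind with
    | zero => simp only [star_zero', zero_mul, mul_zero]
    | add x x' hx hx' => simp only [add_mul, mul_add, star_add', hx, hx']
    | tmul c d _ hd =>
      rcases hb with hb | hb <;> rcases hd with hd | hd
      · simp only [tmul_mul_tmul_of_even_left _ hb, star_tmul_of_even_right _ hb,
          star_tmul_of_even_right _ hd, star_tmul_of_even_right _ (grading_mul_even_even hb hd),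
          tmul_mul_tmul_of_even_left _ (grading_star_even hd), star_mul]
      · simp only [tmul_mul_tmul_of_even_left _ hb, star_tmul_of_even_right _ hb,
          star_tmul_of_odd_right _ hd, star_tmul_of_odd_right _ (grading_mul_even_odd hb hd),
          tmul_mul_tmul_of_odd_left _ (grading_star_odd hd), star_mul, map_mul, map_star]
      · simp only [tmul_mul_tmul_of_odd_left _ hb, star_tmul_of_odd_right _ hb,
          star_tmul_of_even_right _ hd, star_tmul_of_odd_right _ (grading_mul_odd_even hb hd),
          tmul_mul_tmul_of_even_left _ (grading_star_even hd), star_mul, map_mul, map_star,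
          grading_grading]
      · simp only [tmul_mul_tmul_of_odd_left _ hb, star_tmul_of_odd_right _ hb,
          star_tmul_of_odd_right _ hd, star_tmul_of_even_right _ (grading_mul_odd_odd hb hd),
          tmul_mul_tmul_of_odd_left _ (grading_star_odd hd), star_mul, map_mul, map_star,
          grading_grading]

instance : StarRing (AlgTensor A B) where
  star_involutive := star_star'
  star_mul := star_mul'
  star_add := star_add'

instance : StarModule ℂ (AlgTensor A B) := ⟨star_smul'⟩

end AlgTensor

end Alg

/-! ### The graded maximal tensor product -/

section Max

variable {A B : Type*} [NonUnitalCStarAlgebra A] [GradedCStarAlgebra A]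
  [NonUnitalCStarAlgebra B] [GradedCStarAlgebra B]

/-- A C*-seminorm on the graded algebraic tensor product with `‖a ⊗ b‖ ≤ ‖a‖ ‖b‖`. The last
condition is no restriction (every C*-seminorm satisfies it, as `a` and `b` act as commuting, in
the graded sense, multipliers on the associated completion); it is recorded because it makes the
boundedness of the supremum below evident. -/
structure TensorCStarSeminorm (A B : Type*) [NonUnitalCStarAlgebra A] [GradedCStarAlgebra A]
    [NonUnitalCStarAlgebra B] [GradedCStarAlgebra B] where
  toFun : AlgTensor A B → ℝ
  add_le : ∀ x y, toFun (x + y) ≤ toFun x + toFun y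
  smul_eq : ∀ (c : ℂ) x, toFun (c • x) = ‖c‖ * toFun x
  mul_le : ∀ x y, toFun (x * y) ≤ toFun x * toFun y
  star_mul_self : ∀ x, toFun (star x * x) = toFun x * toFun x
  tmul_le : ∀ a b, toFun (AlgTensor.tmul a b) ≤ ‖a‖ * ‖b‖

namespace TensorCStarSeminorm

instance : CoeFun (TensorCStarSeminorm A B) fun _ => AlgTensor A B → ℝ := ⟨toFun⟩

instance : Inhabited (TensorCStarSeminorm A B) :=
  ⟨⟨fun _ => 0, by simp, by simp, by simp, by simp, fun a b => by positivity⟩⟩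

theorem map_zero (p : TensorCStarSeminorm A B) : p 0 = 0 := by
  simpa using p.smul_eq 0 0

theorem nonneg (p : TensorCStarSeminorm A B) (x : AlgTensor A B) : 0 ≤ p x := by
  have h := p.add_le x ((-1 : ℂ) • x)
  rw [p.smul_eq, neg_one_smul, add_neg_cancel, p.map_zero] at h
  simp at h
  linarith

theorem bddAbove (x : AlgTensor A B) :
    BddAbove (Set.range fun p : TensorCStarSeminorm A B => p x) := by
  induction x using AlgTensor.ind with
  | zero => exact ⟨0, by rintro _ ⟨p, rfl⟩; exact p.map_zero.le⟩
  | tmul a b => exact ⟨‖a‖ * ‖b‖, by rintro _ ⟨p, rfl⟩; exact p.tmul_le a b⟩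
  | add x y hx hy =>
    obtain ⟨c, hc⟩ := hx
    obtain ⟨d, hd⟩ := hy
    refine ⟨c + d, ?_⟩
    rintro _ ⟨p, rfl⟩
    exact (p.add_le x y).trans (add_le_add (hc ⟨p, rfl⟩) (hd ⟨p, rfl⟩))

end TensorCStarSeminorm

/-- The maximal C*-seminorm on the graded algebraic tensor product. -/
def maxNorm (x : AlgTensor A B) : ℝ := ⨆ p : TensorCStarSeminorm A B, p x

theorem le_maxNorm (p : TensorCStarSeminorm A B) (x : AlgTensor A B) : p x ≤ maxNorm x :=
  le_ciSup (TensorCStarSeminorm.bddAbove x) p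

theorem maxNorm_le {x : AlgTensor A B} {c : ℝ} (h : ∀ p : TensorCStarSeminorm A B, p x ≤ c) :
    maxNorm x ≤ c := ciSup_le h

theorem maxNorm_nonneg (x : AlgTensor A B) : 0 ≤ maxNorm x :=
  (default : TensorCStarSeminorm A B).nonneg x |>.trans (le_maxNorm _ x)

theorem maxNorm_mul_le (x y : AlgTensor A B) : maxNorm (x * y) ≤ maxNorm x * maxNorm y :=
  maxNorm_le fun p => (p.mul_le x y).trans
    (mul_le_mul (le_maxNorm p x) (le_maxNorm p y) (p.nonneg y) (maxNorm_nonneg x))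

theorem maxNorm_star_mul_self (x : AlgTensor A B) :
    maxNorm (star x * x) = maxNorm x * maxNorm x := by
  refine le_antisymm (maxNorm_le fun p => ?_) ?_
  · rw [p.star_mul_self]
    exact mul_le_mul (le_maxNorm p x) (le_maxNorm p x) (p.nonneg x) (maxNorm_nonneg x)
  · rw [← sq, ← Real.le_sqrt (maxNorm_nonneg x) (maxNorm_nonneg _)]
    refine maxNorm_le fun p => Real.le_sqrt_of_sq_le ?_
    rw [sq, ← p.star_mul_self]
    exact le_maxNorm p _

theorem maxNorm_tmul_le (a : A) (b : B) : maxNorm (AlgTensor.tmul a b) ≤ ‖a‖ * ‖b‖ :=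
  maxNorm_le fun p => p.tmul_le a b

theorem maxNorm_add_le (x y : AlgTensor A B) : maxNorm (x + y) ≤ maxNorm x + maxNorm y :=
  maxNorm_le fun p => (p.add_le x y).trans (add_le_add (le_maxNorm p x) (le_maxNorm p y))

theorem maxNorm_smul_le (c : ℂ) (x : AlgTensor A B) : maxNorm (c • x) ≤ ‖c‖ * maxNorm x :=
  maxNorm_le fun p => (p.smul_eq c x).le.trans
    (mul_le_mul_of_nonneg_left (le_maxNorm p x) (norm_nonneg c))

/-- The maximal norm as a seminorm. -/
def maxSeminorm (A B : Type*) [NonUnitalCStarAlgebra A] [GradedCStarAlgebra A]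
    [NonUnitalCStarAlgebra B] [GradedCStarAlgebra B] : AddGroupSeminorm (AlgTensor A B) where
  toFun := maxNorm
  map_zero' := le_antisymm (maxNorm_le fun p => p.map_zero.le) (maxNorm_nonneg 0)
  add_le' := maxNorm_add_le
  neg' x := by
    have h : ∀ x : AlgTensor A B, maxNorm (-x) ≤ maxNorm x := fun x => by
      simpa using maxNorm_smul_le (-1) x
    exact le_antisymm (h x) (by simpa using h (-x))

instance : PreCStarAlgebra (AlgTensor A B) :=
  { (maxSeminorm A B).toSeminormedAddCommGroup,
    (inferInstance : NonUnitalRing (AlgTensor A B)),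
    (inferInstance : StarRing (AlgTensor A B)),
    (inferInstance : Module ℂ (AlgTensor A B)),
    (inferInstance : IsScalarTower ℂ (AlgTensor A B) (AlgTensor A B)),
    (inferInstance : SMulCommClass ℂ (AlgTensor A B) (AlgTensor A B)),
    (inferInstance : StarModule ℂ (AlgTensor A B)) with
    norm_mul_le := maxNorm_mul_le
    norm_smul_le := maxNorm_smul_le
    norm_star_mul_self' := maxNorm_star_mul_self }

theorem norm_algTensor (x : AlgTensor A B) : ‖x‖ = maxNorm x := rfl

/-- The graded maximal tensor product of two graded C*-algebras. -/
abbrev MaxTensor (A B : Type*) [NonUnitalCStarAlgebra A] [GradedCStarAlgebra A]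
    [NonUnitalCStarAlgebra B] [GradedCStarAlgebra B] : Type _ := CStarCompletion (AlgTensor A B)

/-- Elementary tensors in the graded maximal tensor product. -/
def tmul (a : A) (b : B) : MaxTensor A B := CStarCompletion.of (AlgTensor.tmul a b)

/-- Two continuous additive maps on the maximal tensor product agree if they agree on
elementary tensors. -/
theorem MaxTensor.eq_of_tmul {M : Type*} [AddCommMonoid M] [TopologicalSpace M] [T2Space M]
    {f g : MaxTensor A B → M} (hf : Continuous f) (hg : Continuous g)
    (hf0 : f 0 = 0) (hg0 : g 0 = 0)
    (hfa : ∀ x y, f (x + y) = f x + f y) (hga : ∀ x y, g (x + y) = g x + g y)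
    (h : ∀ a b, f (tmul a b) = g (tmul a b)) (x : MaxTensor A B) : f x = g x := by
  induction x using CStarCompletion.ind with
  | hp => exact isClosed_eq hf hg
  | h x =>
    induction x using AlgTensor.ind with
    | zero => rw [CStarCompletion.of_zero, hf0, hg0]
    | tmul a b => exact h a b
    | add x y hx hy => rw [CStarCompletion.of_add, hfa, hga, hx, hy]

end Max

section Functoriality

variable {A A' B B' : Type*} [NonUnitalCStarAlgebra A] [GradedCStarAlgebra A]
  [NonUnitalCStarAlgebra A'] [GradedCStarAlgebra A']
  [NonUnitalCStarAlgebra B] [GradedCStarAlgebra B]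
  [NonUnitalCStarAlgebra B'] [GradedCStarAlgebra B']

/-- The tensor product of two grading-preserving `*`-homomorphisms on the algebraic level. -/
def AlgTensor.map (φ : A →⋆ₙₐ[ℂ] A') (ψ : B →⋆ₙₐ[ℂ] B')
    (hφ : ∀ a, φ (grading a) = grading (φ a)) (hψ : ∀ b, ψ (grading b) = grading (ψ b)) :
    AlgTensor A B →⋆ₙₐ[ℂ] AlgTensor A' B' :=
  let L : AlgTensor A B →ₗ[ℂ] AlgTensor A' B' :=
    AlgTensor.lift (LinearMap.mk₂ ℂ (fun a b => AlgTensor.tmul (φ a) (ψ b))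
      (fun a a' b => by rw [map_add, AlgTensor.add_tmul])
      (fun r a b => by rw [map_smul, AlgTensor.smul_tmul])
      (fun a b b' => by rw [map_add, AlgTensor.tmul_add])
      (fun r a b => by rw [map_smul, AlgTensor.tmul_smul]))
  have hL : ∀ a b, L (AlgTensor.tmul a b) = AlgTensor.tmul (φ a) (ψ b) := fun a b =>
    AlgTensor.lift_tmul _ _ _
  have he : ∀ b, ψ (evenPart b) = evenPart (ψ b) := fun b => by
    rw [evenPart_apply, evenPart_apply, map_smul, map_add, hψ]
  have ho : ∀ b, ψ (oddPart b) = oddPart (ψ b) := fun b => by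
    rw [oddPart_apply, oddPart_apply, map_smul, map_sub, hψ]
  { L with
    map_zero' := map_zero L
    map_mul' := fun x y => by
      change L (x * y) = L x * L y
      induction x using AlgTensor.ind with
      | zero => simp only [zero_mul, map_zero]
      | add x x' hx hx' => simp only [add_mul, map_add, hx, hx']
      | tmul a b =>
        induction y using AlgTensor.ind with
        | zero => simp only [mul_zero, map_zero]
        | add x x' hx hx' => simp only [mul_add, map_add, hx, hx']
        | tmul c d => simp only [AlgTensor.tmul_mul_tmul, map_add, hL, map_mul, hφ, he, ho]
    map_star' := fun x => by
      change L (star x) = star (L x)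
      induction x using AlgTensor.ind with
      | zero => simp only [star_zero, map_zero]
      | add x x' hx hx' => simp only [star_add, map_add, hx, hx']
      | tmul a b => simp only [AlgTensor.star_tmul, map_add, hL, map_star, hφ, he, ho] }

theorem AlgTensor.map_tmul (φ : A →⋆ₙₐ[ℂ] A') (ψ : B →⋆ₙₐ[ℂ] B')
    (hφ : ∀ a, φ (grading a) = grading (φ a)) (hψ : ∀ b, ψ (grading b) = grading (ψ b))
    (a : A) (b : B) :
    AlgTensor.map φ ψ hφ hψ (AlgTensor.tmul a b) = AlgTensor.tmul (φ a) (ψ b) := rfl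

theorem AlgTensor.norm_map_le (φ : A →⋆ₙₐ[ℂ] A') (ψ : B →⋆ₙₐ[ℂ] B')
    (hφ : ∀ a, φ (grading a) = grading (φ a)) (hψ : ∀ b, ψ (grading b) = grading (ψ b))
    (x : AlgTensor A B) : ‖AlgTensor.map φ ψ hφ hψ x‖ ≤ ‖x‖ := by
  refine maxNorm_le fun p => ?_
  exact le_maxNorm (A := A) (B := B)
    { toFun := fun x => p (AlgTensor.map φ ψ hφ hψ x)
      add_le := fun x y => by rw [map_add]; exact p.add_le _ _
      smul_eq := fun c x => by rw [map_smul]; exact p.smul_eq _ _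
      mul_le := fun x y => by rw [map_mul]; exact p.mul_le _ _
      star_mul_self := fun x => by rw [map_mul, map_star]; exact p.star_mul_self _
      tmul_le := fun a b => by
        rw [AlgTensor.map_tmul]
        exact (p.tmul_le _ _).trans (mul_le_mul (NonUnitalStarAlgHom.norm_apply_le φ a)
          (NonUnitalStarAlgHom.norm_apply_le ψ b) (norm_nonneg _) (norm_nonneg _)) } x

/-- The tensor product `φ ⊗̂ ψ` of two grading-preserving `*`-homomorphisms. -/
def MaxTensor.map (φ : A →⋆ₙₐ[ℂ] A') (ψ : B →⋆ₙₐ[ℂ] B')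
    (hφ : ∀ a, φ (grading a) = grading (φ a)) (hψ : ∀ b, ψ (grading b) = grading (ψ b)) :
    MaxTensor A B →⋆ₙₐ[ℂ] MaxTensor A' B' :=
  CStarCompletion.map (AlgTensor.map φ ψ hφ hψ) (AlgTensor.norm_map_le φ ψ hφ hψ)

theorem MaxTensor.map_tmul (φ : A →⋆ₙₐ[ℂ] A') (ψ : B →⋆ₙₐ[ℂ] B')
    (hφ : ∀ a, φ (grading a) = grading (φ a)) (hψ : ∀ b, ψ (grading b) = grading (ψ b))
    (a : A) (b : B) : MaxTensor.map φ ψ hφ hψ (tmul a b) = tmul (φ a) (ψ b) := by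
  rw [MaxTensor.map, tmul, CStarCompletion.map_of, AlgTensor.map_tmul, tmul]

theorem MaxTensor.continuous_map (φ : A →⋆ₙₐ[ℂ] A') (ψ : B →⋆ₙₐ[ℂ] B')
    (hφ : ∀ a, φ (grading a) = grading (φ a)) (hψ : ∀ b, ψ (grading b) = grading (ψ b)) :
    Continuous (MaxTensor.map φ ψ hφ hψ) := CStarCompletion.continuous_map _ _

/-- The grading `ε_A ⊗̂ ε_B` of the graded maximal tensor product. -/
instance : GradedCStarAlgebra (MaxTensor A B) where
  grading := MaxTensor.map grading grading (fun _ => rfl) (fun _ => rfl)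
  grading_grading x := by
    have hc := MaxTensor.continuous_map (A := A) (B := B) grading grading
      (fun _ => rfl) (fun _ => rfl)
    refine MaxTensor.eq_of_tmul (f := fun x => MaxTensor.map grading grading (fun _ => rfl)
      (fun _ => rfl) (MaxTensor.map grading grading (fun _ => rfl) (fun _ => rfl) x))
      (g := fun x => x) (hc.comp hc) continuous_id (by simp only [map_zero]) rfl
      (fun x y => by simp only [map_add]) (fun _ _ => rfl) (fun a b => ?_) x
    simp only [MaxTensor.map_tmul, grading_grading]

theorem MaxTensor.grading_tmul (a : A) (b : B) :
    grading (tmul a b) = tmul (grading a) (grading b) := MaxTensor.map_tmul _ _ _ _ a b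

section Real

variable {t : Flavor} [RealStructure t A] [RealStructure t B]

theorem bar_zero (ht : t = .real) : bar ht (0 : A) = 0 := (barAddHom ht A).map_zero

theorem bar_evenPart (ht : t = .real) (a : A) : bar ht (evenPart a) = evenPart (bar ht a) := by
  simp [evenPart_apply, bar_smul, bar_add, bar_grading]

theorem bar_oddPart (ht : t = .real) (a : A) : bar ht (oddPart a) = oddPart (bar ht a) := by
  have h : bar ht (-grading a) = -bar ht (grading a) := (barAddHom ht A).map_neg _
  rw [oddPart_apply, oddPart_apply, bar_smul, sub_eq_add_neg, bar_add, h, bar_grading,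
    ← sub_eq_add_neg]
  simp

/-- The tensor product of the Real structures on the algebraic level. -/
def AlgTensor.bar (ht : t = .real) : AlgTensor A B →+ AlgTensor A B :=
  TensorProduct.liftAddHom
    (AddMonoidHom.mk' (fun a => AddMonoidHom.mk'
        (fun b => AlgTensor.tmul (RealStructure.bar ht a) (RealStructure.bar ht b))
        (fun b b' => by rw [bar_add, AlgTensor.tmul_add]))
      (fun a a' => by
        ext b
        change AlgTensor.tmul (RealStructure.bar ht (a + a')) (RealStructure.bar ht b) =
          AlgTensor.tmul (RealStructure.bar ht a) (RealStructure.bar ht b) +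
            AlgTensor.tmul (RealStructure.bar ht a') (RealStructure.bar ht b)
        rw [bar_add, AlgTensor.add_tmul]))
    (fun r a b => by
      change AlgTensor.tmul (RealStructure.bar ht (r • a)) _ =
        AlgTensor.tmul _ (RealStructure.bar ht (r • b))
      rw [bar_smul, bar_smul, AlgTensor.smul_tmul, AlgTensor.tmul_smul])

theorem AlgTensor.bar_tmul (ht : t = .real) (a : A) (b : B) : AlgTensor.bar ht (tmul a b) =
    tmul (RealStructure.bar ht a) (RealStructure.bar ht b) := rfl

theorem AlgTensor.bar_smul (ht : t = .real) (c : ℂ) (x : AlgTensor A B) :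
    AlgTensor.bar ht (c • x) = star c • AlgTensor.bar ht x := by
  induction x using AlgTensor.ind with
  | zero => simp only [smul_zero, map_zero]
  | add x y hx hy => simp only [smul_add, map_add, hx, hy]
  | tmul a b =>
    rw [← AlgTensor.smul_tmul, bar_tmul, bar_tmul, RealStructure.bar_smul, AlgTensor.smul_tmul]

theorem AlgTensor.bar_mul (ht : t = .real) (x y : AlgTensor A B) :
    AlgTensor.bar ht (x * y) = AlgTensor.bar ht x * AlgTensor.bar ht y := by
  induction x using AlgTensor.ind with
  | zero => simp only [zero_mul, map_zero]
  | add x x' hx hx' => simp only [add_mul, map_add, hx, hx']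
  | tmul a b =>
    induction y using AlgTensor.ind with
    | zero => simp only [mul_zero, map_zero]
    | add x x' hx hx' => simp only [mul_add, map_add, hx, hx']
    | tmul c d =>
      simp only [AlgTensor.tmul_mul_tmul, map_add, bar_tmul, RealStructure.bar_mul,
        bar_grading, bar_evenPart, bar_oddPart]

theorem AlgTensor.bar_star (ht : t = .real) (x : AlgTensor A B) :
    AlgTensor.bar ht (star x) = star (AlgTensor.bar ht x) := by
  induction x using AlgTensor.ind with
  | zero => simp only [star_zero, map_zero]
  | add x x' hx hx' => simp only [star_add, map_add, hx, hx']
  | tmul a b =>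
    simp only [AlgTensor.star_tmul, map_add, bar_tmul, RealStructure.bar_star, bar_grading,
      bar_evenPart, bar_oddPart]

theorem AlgTensor.norm_bar_le (ht : t = .real) (x : AlgTensor A B) :
    ‖AlgTensor.bar ht x‖ ≤ ‖x‖ := by
  refine maxNorm_le fun p => ?_
  exact le_maxNorm (A := A) (B := B)
    { toFun := fun x => p (AlgTensor.bar ht x)
      add_le := fun x y => by rw [map_add]; exact p.add_le _ _
      smul_eq := fun c x => by rw [AlgTensor.bar_smul, p.smul_eq, norm_star]
      mul_le := fun x y => by rw [AlgTensor.bar_mul]; exact p.mul_le _ _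
      star_mul_self := fun x => by
        rw [AlgTensor.bar_mul, AlgTensor.bar_star]; exact p.star_mul_self _
      tmul_le := fun a b => by
        rw [AlgTensor.bar_tmul]
        refine (p.tmul_le _ _).trans ?_
        rw [norm_bar, norm_bar] } x

/-- The tensor product of the Real structures on the maximal tensor product. -/
def MaxTensor.bar (ht : t = .real) : MaxTensor A B → MaxTensor A B :=
  CStarCompletion.mapAdd (AlgTensor.bar ht)

theorem MaxTensor.bar_of (ht : t = .real) (x : AlgTensor A B) :
    MaxTensor.bar ht (CStarCompletion.of x) = CStarCompletion.of (AlgTensor.bar ht x) :=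
  CStarCompletion.mapAdd_of _ (AlgTensor.norm_bar_le ht) x

theorem MaxTensor.bar_tmul (ht : t = .real) (a : A) (b : B) : MaxTensor.bar ht (tmul a b) =
    tmul (RealStructure.bar ht a) (RealStructure.bar ht b) := MaxTensor.bar_of ht _

theorem MaxTensor.continuous_bar (ht : t = .real) :
    Continuous (MaxTensor.bar (A := A) (B := B) ht) := CStarCompletion.continuous_mapAdd _

theorem MaxTensor.bar_zero (ht : t = .real) : MaxTensor.bar ht (0 : MaxTensor A B) = 0 := by
  rw [← CStarCompletion.of_zero, MaxTensor.bar_of, map_zero]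

theorem MaxTensor.bar_add (ht : t = .real) (x y : MaxTensor A B) :
    MaxTensor.bar ht (x + y) = MaxTensor.bar ht x + MaxTensor.bar ht y := by
  have := MaxTensor.continuous_bar (A := A) (B := B) ht
  induction x, y using CStarCompletion.ind₂ with
  | hp =>
    refine isClosed_eq ?_ ?_
    · exact this.comp continuous_add
    · exact (this.comp continuous_fst).add (this.comp continuous_snd)
  | h x y => rw [← CStarCompletion.of_add, bar_of, bar_of, bar_of, map_add, CStarCompletion.of_add]

/-- The tensor product of two Real structures. -/
instance : RealStructure t (MaxTensor A B) where
  bar := MaxTensor.bar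
  bar_add := MaxTensor.bar_add
  bar_smul ht c x := by
    have := MaxTensor.continuous_bar (A := A) (B := B) ht
    induction x using CStarCompletion.ind with
    | hp =>
      refine isClosed_eq ?_ ?_
      · exact this.comp (continuous_const_smul c)
      · exact this.const_smul (star c)
    | h x => rw [← CStarCompletion.of_smul, MaxTensor.bar_of, MaxTensor.bar_of,
        AlgTensor.bar_smul, CStarCompletion.of_smul]
  bar_mul ht x y := by
    have := MaxTensor.continuous_bar (A := A) (B := B) ht
    induction x, y using CStarCompletion.ind₂ with
    | hp =>
      refine isClosed_eq ?_ ?_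
      · exact this.comp continuous_mul
      · exact (this.comp continuous_fst).mul (this.comp continuous_snd)
    | h x y => rw [← CStarCompletion.of_mul, MaxTensor.bar_of, MaxTensor.bar_of,
        MaxTensor.bar_of, AlgTensor.bar_mul, CStarCompletion.of_mul]
  bar_star ht x := by
    have := MaxTensor.continuous_bar (A := A) (B := B) ht
    induction x using CStarCompletion.ind with
    | hp =>
      refine isClosed_eq ?_ ?_
      · exact this.comp continuous_star
      · exact this.star
    | h x => rw [← CStarCompletion.of_star, MaxTensor.bar_of, MaxTensor.bar_of,
        AlgTensor.bar_star, CStarCompletion.of_star]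
  bar_bar ht x := by
    have hc := MaxTensor.continuous_bar (A := A) (B := B) ht
    exact MaxTensor.eq_of_tmul (f := fun x => MaxTensor.bar ht (MaxTensor.bar ht x))
      (g := fun x => x) (hc.comp hc) continuous_id (by simp only [MaxTensor.bar_zero]) rfl
      (fun x y => by simp only [MaxTensor.bar_add]) (fun _ _ => rfl)
      (fun a b => by simp only [MaxTensor.bar_tmul, bar_bar]) x
  bar_grading ht x := by
    have hc := MaxTensor.continuous_bar (A := A) (B := B) ht
    have hg : Continuous (grading : MaxTensor A B → MaxTensor A B) :=
      MaxTensor.continuous_map _ _ _ _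
    exact MaxTensor.eq_of_tmul (f := fun x => MaxTensor.bar ht (grading x))
      (g := fun x => grading (MaxTensor.bar ht x)) (hc.comp hg) (hg.comp hc)
      (by simp only [map_zero, MaxTensor.bar_zero]) (by simp only [map_zero, MaxTensor.bar_zero])
      (fun x y => by simp only [map_add, MaxTensor.bar_add])
      (fun x y => by simp only [map_add, MaxTensor.bar_add])
      (fun a b => by
        simp only [MaxTensor.bar_tmul, MaxTensor.grading_tmul, bar_grading]) x

end Real

end Functoriality

/-! ### Compact operators on graded Hilbert spaces -/

section Hilbert

open ContinuousLinearMap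

/-- A `ℤ/2`-grading on a Hilbert space, given by the self-adjoint unitary that is `1` on the even
part and `-1` on the odd part. -/
class GradedHilbertSpace (H : Type*) [NormedAddCommGroup H] [InnerProductSpace ℂ H]
    [CompleteSpace H] where
  parity : H →L[ℂ] H
  parity_parity : ∀ x, parity (parity x) = x
  inner_parity : ∀ x y, ⟪parity x, parity y⟫_ℂ = ⟪x, y⟫_ℂ

open GradedHilbertSpace

/-- In the Real theory, a Real structure on a graded Hilbert space: an antilinear involution that
is compatible with the inner product and with the grading. In the complex theory there is no
further structure. -/
class RealHilbertStructure (t : Flavor) (H : Type*) [NormedAddCommGroup H]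
    [InnerProductSpace ℂ H] [CompleteSpace H] [GradedHilbertSpace H] where
  hbar : t = .real → H →L⋆[ℂ] H
  hbar_hbar : ∀ h x, hbar h (hbar h x) = x
  inner_hbar : ∀ h x y, ⟪hbar h x, hbar h y⟫_ℂ = star ⟪x, y⟫_ℂ
  hbar_parity : ∀ h x, hbar h (parity x) = parity (hbar h x)

open RealHilbertStructure

/-- The even part of a graded Hilbert space. -/
def evenSubspace (H : Type*) [NormedAddCommGroup H] [InnerProductSpace ℂ H] [CompleteSpace H]
    [GradedHilbertSpace H] : Submodule ℂ H where
  carrier := {x | parity x = x}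
  zero_mem' := map_zero _
  add_mem' {x y} hx hy := by
    change parity (x + y) = x + y
    rw [map_add, hx, hy]
  smul_mem' c x hx := by
    change parity (c • x) = c • x
    rw [map_smul, hx]

/-- The odd part of a graded Hilbert space. -/
def oddSubspace (H : Type*) [NormedAddCommGroup H] [InnerProductSpace ℂ H] [CompleteSpace H]
    [GradedHilbertSpace H] : Submodule ℂ H where
  carrier := {x | parity x = -x}
  zero_mem' := by simp
  add_mem' {x y} hx hy := by
    change parity (x + y) = -(x + y)
    rw [map_add, hx, hy, neg_add]
  smul_mem' c x hx := by
    change parity (c • x) = -(c • x)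
    rw [map_smul, hx, smul_neg]

section

variable {H H' : Type*} [NormedAddCommGroup H] [InnerProductSpace ℂ H] [CompleteSpace H]
  [NormedAddCommGroup H'] [InnerProductSpace ℂ H'] [CompleteSpace H']

/-- The adjoint of a compact operator on a Hilbert space is compact. -/
theorem isCompactOperator_adjoint {T : H →L[ℂ] H} (hT : IsCompactOperator T) :
    IsCompactOperator (adjoint T) := by
  have h1 : IsCompactOperator (T ∘L adjoint T) := hT.comp_clm (adjoint T)
  refine (isCompactOperator_iff_isCompact_closure_image_closedBall
    ((adjoint T : H →L[ℂ] H) : H →ₗ[ℂ] H) one_pos).2 ?_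
  have h2 : TotallyBounded ((T ∘L adjoint T) '' Metric.closedBall 0 1) :=
    (h1.isCompact_closure_image_closedBall (𝕜₁ := ℂ)
      (f := ((T ∘L adjoint T : H →L[ℂ] H) : H →ₗ[ℂ] H)) 1).totallyBounded.subset subset_closure
  refine (TotallyBounded.closure ?_).isCompact_of_isClosed isClosed_closure
  rw [Metric.totallyBounded_iff]
  intro ε hε
  obtain ⟨s, hs, hfin, hcov⟩ := Metric.finite_approx_of_totallyBounded h2 (ε ^ 2 / 2)
    (by positivity)
  choose! g hg using fun y (hy : y ∈ s) => hs hy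
  refine ⟨(fun y => adjoint T (g y)) '' s, hfin.image _, ?_⟩
  rintro _ ⟨x, hx, rfl⟩
  obtain ⟨y, hy, hxy⟩ := Set.mem_iUnion₂.1 (hcov ⟨x, hx, rfl⟩)
  refine Set.mem_iUnion₂.2 ⟨adjoint T (g y), ⟨y, hy, rfl⟩, ?_⟩
  rw [mem_ball_iff_norm] at hxy ⊢
  rw [← (hg y hy).2, ← map_sub] at hxy
  change ‖adjoint T x - adjoint T (g y)‖ < ε
  rw [← map_sub]
  have hx1 : ‖x - g y‖ ≤ 2 := by
    have e1 := mem_closedBall_zero_iff.1 hx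
    have e2 := mem_closedBall_zero_iff.1 (hg y hy).1
    linarith [norm_sub_le x (g y)]
  have h3 : ‖adjoint T (x - g y)‖ ^ 2 ≤ ‖(T ∘L adjoint T) (x - g y)‖ * ‖x - g y‖ := by
    rw [← inner_self_eq_norm_sq (𝕜 := ℂ), adjoint_inner_right]
    exact (RCLike.re_le_norm _).trans (norm_inner_le_norm _ _)
  have h4 : ‖adjoint T (x - g y)‖ ^ 2 < ε ^ 2 := by
    nlinarith [norm_nonneg (x - g y), norm_nonneg ((T ∘L adjoint T) (x - g y))]
  exact lt_of_pow_lt_pow_left₀ 2 hε.le h4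

/-- The compact operators on a Hilbert space. -/
def compactOps (H : Type*) [NormedAddCommGroup H] [InnerProductSpace ℂ H] [CompleteSpace H] :
    NonUnitalStarSubalgebra ℂ (H →L[ℂ] H) where
  carrier := {T | IsCompactOperator T}
  zero_mem' := isCompactOperator_zero
  add_mem' hS hT := hS.add hT
  smul_mem' c _ hT := hT.smul c
  mul_mem' {_ T} hS _ := hS.comp_clm T
  star_mem' hT := isCompactOperator_adjoint hT

instance : IsClosed (compactOps H : Set (H →L[ℂ] H)) := isClosed_setOfPred_isCompactOperator

/-- The C*-algebra `𝒦(H)` of compact operators. -/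
abbrev CompactOp (H : Type*) [NormedAddCommGroup H] [InnerProductSpace ℂ H] [CompleteSpace H] :
    Type _ := compactOps H

/-- Conjugation by an isometry `V`, as a `*`-homomorphism `T ↦ V T V*`. -/
def Ad (V : H →L[ℂ] H') (hV : adjoint V ∘L V = 1) : CompactOp H →⋆ₙₐ[ℂ] CompactOp H' where
  toFun T := ⟨V ∘L T.1 ∘L adjoint V,
    (T.2.comp_clm (adjoint V)).clm_comp V⟩
  map_smul' c T := by ext x; simp
  map_zero' := by ext x; simp
  map_add' S T := by ext x; simp
  map_mul' S T := by
    ext x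
    have h : ∀ y, adjoint V (V y) = y := fun y => DFunLike.congr_fun hV y
    simp [h]
  map_star' T := by
    apply Subtype.ext
    change V ∘L adjoint T.1 ∘L adjoint V = adjoint (V ∘L T.1 ∘L adjoint V)
    rw [adjoint_comp, adjoint_comp, adjoint_adjoint, ContinuousLinearMap.comp_assoc]

theorem Ad_apply (V : H →L[ℂ] H') (hV : adjoint V ∘L V = 1) (T : CompactOp H) (x : H') :
    (Ad V hV T).1 x = V (T.1 (adjoint V x)) := rfl

variable [GradedHilbertSpace H] [GradedHilbertSpace H']

theorem adjoint_parity : adjoint (parity : H →L[ℂ] H) = parity := by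
  ext x
  refine ext_inner_right ℂ fun y => ?_
  rw [adjoint_inner_left, ← inner_parity, parity_parity]

theorem parity_isometry : adjoint (parity : H →L[ℂ] H) ∘L parity = 1 := by
  ext x
  rw [adjoint_parity]
  exact parity_parity x

/-- The grading of `𝒦(H)` for which the even operators are the diagonal ones and the odd
operators are the off-diagonal ones. -/
instance : GradedCStarAlgebra (CompactOp H) where
  grading := Ad parity parity_isometry
  grading_grading T := by
    ext x
    simp only [Ad_apply, adjoint_parity, parity_parity]

theorem CompactOp.grading_apply (T : CompactOp H) (x : H) :
    (grading T).1 x = parity (T.1 (parity x)) := by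
  change parity (T.1 (adjoint parity x)) = _
  rw [adjoint_parity]

variable {t : Flavor} [RealHilbertStructure t H] [RealHilbertStructure t H']

/-- The operator `x ↦ conj (T (conj x))`. -/
def barOp (h : t = .real) (T : H →L[ℂ] H) : H →L[ℂ] H :=
  (hbar h : H →L⋆[ℂ] H).comp (T.comp (hbar h : H →L⋆[ℂ] H))

theorem barOp_apply (h : t = .real) (T : H →L[ℂ] H) (x : H) :
    barOp h T x = hbar h (T (hbar h x)) := rfl

/-- The Real structure of `𝒦(H)`, with `(bar T) x` the conjugate of `T` applied to the conjugate
of `x`. -/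
instance : RealStructure t (CompactOp H) where
  bar h T := ⟨barOp h T.1, (T.2.comp_clm (hbar h)).clm_comp (hbar h)⟩
  bar_add h S T := by ext x; simp [barOp_apply]
  bar_smul h c T := by ext x; simp [barOp_apply]
  bar_mul h S T := by ext x; simp [barOp_apply, hbar_hbar]
  bar_star h T := by
    apply Subtype.ext
    change barOp h (adjoint T.1) = adjoint (barOp h T.1)
    rw [eq_adjoint_iff]
    intro x y
    rw [barOp_apply, barOp_apply]
    conv_lhs => rw [← hbar_hbar h y, inner_hbar, adjoint_inner_left]
    conv_rhs => rw [← hbar_hbar h x, inner_hbar]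
  bar_bar h T := by ext x; simp [barOp_apply, hbar_hbar]
  bar_grading h T := by
    ext x
    simp only [CompactOp.grading_apply, barOp_apply, hbar_parity]

theorem CompactOp.bar_apply (h : t = .real) (T : CompactOp H) (x : H) :
    (bar h T).1 x = hbar h (T.1 (hbar h x)) := rfl

/-- A projection in `𝒦(H)` onto an even one-dimensional subspace (one that is invariant under
conjugation, in the Real theory). -/
structure IsEvenRankOneProjection (t : Flavor) [RealHilbertStructure t H]
    (e : CompactOp H) : Prop where
  isStarProjection : IsStarProjection e
  finrank_range : Module.finrank ℂ (e.1 : H →ₗ[ℂ] H).range = 1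
  range_le : (e.1 : H →ₗ[ℂ] H).range ≤ evenSubspace H
  real : ∀ h : t = .real, bar h e = e

end

end Hilbert

/-! ### The graded Real C*-algebra `𝒮 = C₀(ℝ)` -/

section S

/-- `C₀(ℝ)`, graded by even and odd functions, with pointwise conjugation as Real structure. -/
abbrev SAlg : Type := C₀(ℝ, ℂ)

/-- The reflection `f(x) ↦ f(-x)`. -/
def reflect (f : SAlg) : SAlg := f.comp (Homeomorph.neg ℝ).toCocompactMap

theorem reflect_apply (f : SAlg) (x : ℝ) : reflect f x = f (-x) := rfl

instance : GradedCStarAlgebra SAlg where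
  grading :=
    { toFun := reflect
      map_smul' := fun c f => by ext x; rfl
      map_zero' := by ext x; rfl
      map_add' := fun f g => by ext x; rfl
      map_mul' := fun f g => by ext x; rfl
      map_star' := fun f => by ext x; rfl }
  grading_grading f := by
    ext x
    change f (- -x) = f x
    rw [neg_neg]

instance {t : Flavor} : RealStructure t SAlg where
  bar _ f := star f
  bar_add _ f g := star_add f g
  bar_smul _ c f := star_smul c f
  bar_mul _ f g := by ext x; simp
  bar_star _ _ := rfl
  bar_bar _ f := star_star f
  bar_grading _ _ := rfl

end S

/-! ### Spaces of homomorphisms -/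

section Hom

variable (t : Flavor) (A B C D : Type*)
  [NonUnitalCStarAlgebra A] [GradedCStarAlgebra A] [RealStructure t A]
  [NonUnitalCStarAlgebra B] [GradedCStarAlgebra B] [RealStructure t B]
  [NonUnitalCStarAlgebra C] [GradedCStarAlgebra C] [RealStructure t C]
  [NonUnitalCStarAlgebra D] [GradedCStarAlgebra D] [RealStructure t D]

/-- The `*`-homomorphisms that preserve the grading (and the Real structure, in the Real
theory). -/
structure GradedHom extends A →⋆ₙₐ[ℂ] B where
  map_grading : ∀ a, toFun (grading a) = grading (toFun a)
  map_bar : ∀ (h : t = .real) a, toFun (bar h a) = bar h (toFun a)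

namespace GradedHom

variable {t A B C D}

instance : FunLike (GradedHom t A B) A B where
  coe φ := φ.toNonUnitalStarAlgHom
  coe_injective φ ψ h := by
    cases φ; cases ψ
    congr 1
    exact DFunLike.coe_injective h

instance : NonUnitalAlgHomClass (GradedHom t A B) ℂ A B where
  map_smulₛₗ φ := map_smul φ.toNonUnitalStarAlgHom
  map_add φ := map_add φ.toNonUnitalStarAlgHom
  map_zero φ := map_zero φ.toNonUnitalStarAlgHom
  map_mul φ := map_mul φ.toNonUnitalStarAlgHom

instance : StarHomClass (GradedHom t A B) A B where
  map_star φ := map_star φ.toNonUnitalStarAlgHom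

theorem apply_grading (φ : GradedHom t A B) (a : A) : φ (grading a) = grading (φ a) :=
  φ.map_grading a

theorem apply_bar (φ : GradedHom t A B) (h : t = .real) (a : A) : φ (bar h a) = bar h (φ a) :=
  φ.map_bar h a

theorem continuous (φ : GradedHom t A B) : Continuous φ :=
  (AddMonoidHomClass.lipschitz_of_bound φ 1
    (by simpa using NonUnitalStarAlgHom.norm_apply_le φ)).continuous

/-- The point-norm topology. -/
instance : TopologicalSpace (GradedHom t A B) :=
  TopologicalSpace.induced (fun φ a => φ a) Pi.topologicalSpace

theorem continuous_eval (a : A) : Continuous fun φ : GradedHom t A B => φ a :=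
  (continuous_apply a).comp continuous_induced_dom

theorem continuous_iff {X : Type*} [TopologicalSpace X] {f : X → GradedHom t A B} :
    Continuous f ↔ ∀ a, Continuous fun x => f x a :=
  continuous_induced_rng.trans continuous_pi_iff

/-- The zero homomorphism, which is the base point of the space of homomorphisms. -/
instance : Zero (GradedHom t A B) where
  zero :=
    { (0 : A →⋆ₙₐ[ℂ] B) with
      map_grading := fun _ => (map_zero (grading : B →⋆ₙₐ[ℂ] B)).symm
      map_bar := fun h _ => (bar_zero h).symm }

theorem zero_apply (a : A) : (0 : GradedHom t A B) a = 0 := rfl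

/-- Composition. -/
def comp (ψ : GradedHom t B C) (φ : GradedHom t A B) : GradedHom t A C where
  toNonUnitalStarAlgHom := ψ.toNonUnitalStarAlgHom.comp φ.toNonUnitalStarAlgHom
  map_grading a := by
    change ψ (φ (grading a)) = grading (ψ (φ a))
    rw [apply_grading, apply_grading]
  map_bar h a := by
    change ψ (φ (bar h a)) = bar h (ψ (φ a))
    rw [apply_bar, apply_bar]

theorem comp_apply (ψ : GradedHom t B C) (φ : GradedHom t A B) (a : A) :
    ψ.comp φ a = ψ (φ a) := rfl

variable (A) in
/-- The identity. -/
def id (t : Flavor) [RealStructure t A] : GradedHom t A A where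
  toNonUnitalStarAlgHom := NonUnitalStarAlgHom.id ℂ A
  map_grading _ := rfl
  map_bar _ _ := rfl

/-- The continuous map `Hom(C, A) → Hom(C, B)` induced by a homomorphism `A → B`. -/
def postcomp (ψ : GradedHom t A B) : C(GradedHom t C A, GradedHom t C B) where
  toFun φ := ψ.comp φ
  continuous_toFun := continuous_iff.2 fun c => ψ.continuous.comp (continuous_eval c)

theorem postcomp_zero (ψ : GradedHom t A B) : postcomp (C := C) ψ 0 = 0 :=
  DFunLike.ext _ _ fun _ => map_zero ψ

/-- The tensor product of two homomorphisms. -/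
def tensor (φ : GradedHom t A B) (ψ : GradedHom t C D) :
    GradedHom t (MaxTensor A C) (MaxTensor B D) where
  toNonUnitalStarAlgHom := MaxTensor.map φ.toNonUnitalStarAlgHom ψ.toNonUnitalStarAlgHom
    φ.map_grading ψ.map_grading
  map_grading x := by
    have hm := MaxTensor.continuous_map φ.toNonUnitalStarAlgHom ψ.toNonUnitalStarAlgHom
      φ.map_grading ψ.map_grading
    have hg : Continuous (grading : MaxTensor A C → MaxTensor A C) :=
      MaxTensor.continuous_map _ _ _ _
    have hg' : Continuous (grading : MaxTensor B D → MaxTensor B D) :=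
      MaxTensor.continuous_map _ _ _ _
    refine MaxTensor.eq_of_tmul (hm.comp hg) (hg'.comp hm) ?_ ?_ ?_ ?_ ?_ x
    · simp only [Function.comp_apply, map_zero]
    · simp only [Function.comp_apply, map_zero]
    · intro x y; simp only [Function.comp_apply, map_add]
    · intro x y; simp only [Function.comp_apply, map_add]
    · intro a c
      simp only [Function.comp_apply, MaxTensor.grading_tmul, MaxTensor.map_tmul]
      exact congrArg₂ _ (φ.map_grading a) (ψ.map_grading c)
  map_bar h x := by
    have hm := MaxTensor.continuous_map φ.toNonUnitalStarAlgHom ψ.toNonUnitalStarAlgHom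
      φ.map_grading ψ.map_grading
    have hg : Continuous (bar h : MaxTensor A C → MaxTensor A C) := MaxTensor.continuous_bar h
    have hg' : Continuous (bar h : MaxTensor B D → MaxTensor B D) := MaxTensor.continuous_bar h
    refine MaxTensor.eq_of_tmul (hm.comp hg) (hg'.comp hm) ?_ ?_ ?_ ?_ ?_ x
    · simp only [Function.comp_apply, map_zero, bar_zero]
    · simp only [Function.comp_apply, map_zero, bar_zero]
    · intro x y; simp only [Function.comp_apply, map_add, bar_add]
    · intro x y; simp only [Function.comp_apply, map_add, bar_add]
    · intro a c
      have h1 : bar h (tmul a c) = tmul (bar h a) (bar h c) := MaxTensor.bar_tmul h a c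
      have h2 : ∀ b d, bar h (tmul b d : MaxTensor B D) = tmul (bar h b) (bar h d) :=
        MaxTensor.bar_tmul h
      simp only [Function.comp_apply, h1, MaxTensor.map_tmul, h2]
      exact congrArg₂ _ (φ.map_bar h a) (ψ.map_bar h c)

theorem tensor_tmul (φ : GradedHom t A B) (ψ : GradedHom t C D) (a : A) (c : C) :
    tensor φ ψ (tmul a c) = tmul (φ a) (ψ c) := MaxTensor.map_tmul _ _ _ _ a c

end GradedHom

end Hom

/-! ### The spectral K-theory space -/

section KSpace

open GradedHilbertSpace RealHilbertStructure

variable (t : Flavor) (A B : Type*)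
  [NonUnitalCStarAlgebra A] [GradedCStarAlgebra A] [RealStructure t A]
  [NonUnitalCStarAlgebra B] [GradedCStarAlgebra B] [RealStructure t B]
  (H : Type*) [NormedAddCommGroup H] [InnerProductSpace ℂ H] [CompleteSpace H]
  [GradedHilbertSpace H] [RealHilbertStructure t H]

/-- The spectral K-theory space `𝕂(A, H) = Hom(𝒮, A ⊗̂ 𝒦(H))`, with the point-norm topology; its
base point is the zero homomorphism. -/
abbrev KSpace : Type _ := GradedHom t SAlg (MaxTensor A (CompactOp H))

variable {t A B}

/-- The continuous map `𝕂(A, H) → 𝕂(B, H)` induced by a homomorphism `A → B`. -/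
def KSpace.map (φ : GradedHom t A B) : C(KSpace t A H, KSpace t B H) :=
  GradedHom.postcomp (φ.tensor (GradedHom.id (CompactOp H) t))

theorem KSpace.map_zero (φ : GradedHom t A B) : KSpace.map H φ 0 = 0 :=
  GradedHom.postcomp_zero _

variable {H}

theorem IsEvenRankOneProjection.grading_eq {e : CompactOp H}
    (he : IsEvenRankOneProjection t e) : grading e = e := by
  have h1 : ∀ x, parity (e.1 x) = e.1 x := fun x => he.range_le ⟨x, rfl⟩
  have h2 : ContinuousLinearMap.adjoint e.1 = e.1 :=
    congrArg Subtype.val he.isStarProjection.isSelfAdjoint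
  ext x
  rw [CompactOp.grading_apply, h1]
  refine ext_inner_right ℂ fun y => ?_
  conv_lhs => rw [← h2, ContinuousLinearMap.adjoint_inner_left, ← h1 y, inner_parity]
  rw [← ContinuousLinearMap.adjoint_inner_left, h2]

variable (A) in
/-- The corner embedding `a ↦ a ⊗̂ e` of `A` into `A ⊗̂ 𝒦(H)`. -/
def corner (e : CompactOp H) (he : IsEvenRankOneProjection t e) :
    GradedHom t A (MaxTensor A (CompactOp H)) where
  toFun a := tmul a e
  map_smul' c a := by
    change tmul (c • a) e = c • tmul a e
    rw [tmul, AlgTensor.smul_tmul, CStarCompletion.of_smul, tmul]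
  map_zero' := by rw [tmul, AlgTensor.zero_tmul, CStarCompletion.of_zero]
  map_add' a b := by rw [tmul, AlgTensor.add_tmul, CStarCompletion.of_add, tmul, tmul]
  map_mul' a b := by
    rw [tmul, tmul, tmul, ← CStarCompletion.of_mul,
      AlgTensor.tmul_mul_tmul_of_even_left _ he.grading_eq, he.isStarProjection.isIdempotentElem]
  map_star' a := by
    rw [tmul, tmul, ← CStarCompletion.of_star,
      AlgTensor.star_tmul_of_even_right _ he.grading_eq, he.isStarProjection.isSelfAdjoint]
  map_grading a := by
    change tmul (grading a) e = grading (tmul a e)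
    rw [MaxTensor.grading_tmul, he.grading_eq]
  map_bar h a := by
    change tmul (bar h a) e = MaxTensor.bar h (tmul a e)
    rw [MaxTensor.bar_tmul, he.real]

theorem corner_apply (e : CompactOp H) (he : IsEvenRankOneProjection t e) (a : A) :
    corner A e he a = tmul a e := rfl

end KSpace

/-! ### Homotopy -/

section Homotopy

open ContinuousMap

variable {X Y Z : Type*} [TopologicalSpace X] [TopologicalSpace Y] [TopologicalSpace Z]

/-- A continuous map is a pointed homotopy equivalence (in particular, a homotopy equivalence): it
has a homotopy inverse, where all maps and homotopies preserve the base points. -/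
def IsPointedHomotopyEquiv (f : C(X, Y)) (x : X) (y : Y) : Prop :=
  f x = y ∧ ∃ g : C(Y, X), g y = x ∧
    (g.comp f).HomotopicRel (ContinuousMap.id X) {x} ∧
    (f.comp g).HomotopicRel (ContinuousMap.id Y) {y}

/-- The map induced on homotopy groups by a pointed map. -/
def homotopyGroupMap (N : Type*) (f : C(X, Y)) {x : X} {y : Y} (hf : f x = y) :
    HomotopyGroup N X x → HomotopyGroup N Y y :=
  Quotient.map (fun p : GenLoop N X x => (⟨f.comp p.1, fun s hs => by
      rw [ContinuousMap.comp_apply, p.2 s hs, hf]⟩ : GenLoop N Y y))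
    (fun _ _ h => HomotopicRel.comp_continuousMap h f)

/-- The map of homotopy groups `π_N(X) × π_N(Y) → π_N(Z)` induced by a pointed map
`X × Y → Z`. -/
def homotopyGroupMap₂ (N : Type*) (m : C(X × Y, Z)) {x : X} {y : Y} {z : Z} (hm : m (x, y) = z) :
    HomotopyGroup N X x → HomotopyGroup N Y y → HomotopyGroup N Z z :=
  Quotient.map₂ (fun (p : GenLoop N X x) (q : GenLoop N Y y) =>
      (⟨m.comp (p.1.prodMk q.1), fun s hs => by
        rw [ContinuousMap.comp_apply, ContinuousMap.prod_eval, p.2 s hs, q.2 s hs, hm]⟩ :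
        GenLoop N Z z))
    (fun _ _ hp _ _ hq => by
      obtain ⟨F⟩ := hp
      obtain ⟨G⟩ := hq
      exact HomotopicRel.comp_continuousMap ⟨HomotopyRel.prod F G⟩ m)

end Homotopy

/-! ### The H-space structure -/

section Sum

open GradedHilbertSpace RealHilbertStructure

variable (t : Flavor) (A : Type*)
  [NonUnitalCStarAlgebra A] [GradedCStarAlgebra A] [RealStructure t A]
  (H : Type*) [NormedAddCommGroup H] [InnerProductSpace ℂ H] [CompleteSpace H]
  [GradedHilbertSpace H] [RealHilbertStructure t H]

/-- An even (and Real, in the Real theory) unitary `H ⊕ H → H`. -/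
structure EvenUnitary extends WithLp 2 (H × H) ≃ₗᵢ[ℂ] H where
  map_parity : ∀ x y : H, toFun (WithLp.toLp 2 (parity x, parity y)) =
    parity (toFun (WithLp.toLp 2 (x, y)))
  map_hbar : ∀ (h : t = .real) (x y : H), toFun (WithLp.toLp 2 (hbar h x, hbar h y)) =
    hbar h (toFun (WithLp.toLp 2 (x, y)))

variable {t A H}

namespace EvenUnitary

/-- The restriction of a unitary `H ⊕ H → H` to the first summand. -/
def fst (u : EvenUnitary t H) : H →L[ℂ] H :=
  (u.toLinearIsometryEquiv : WithLp 2 (H × H) →L[ℂ] H) ∘L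
    (WithLp.prodContinuousLinearEquiv 2 ℂ H H).symm ∘L ContinuousLinearMap.inl ℂ H H

/-- The restriction of a unitary `H ⊕ H → H` to the second summand. -/
def snd (u : EvenUnitary t H) : H →L[ℂ] H :=
  (u.toLinearIsometryEquiv : WithLp 2 (H × H) →L[ℂ] H) ∘L
    (WithLp.prodContinuousLinearEquiv 2 ℂ H H).symm ∘L ContinuousLinearMap.inr ℂ H H

theorem fst_apply (u : EvenUnitary t H) (x : H) :
    u.fst x = u.toLinearIsometryEquiv (WithLp.toLp 2 (x, 0)) := rfl

theorem snd_apply (u : EvenUnitary t H) (x : H) :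
    u.snd x = u.toLinearIsometryEquiv (WithLp.toLp 2 (0, x)) := rfl

theorem inner_fst_fst (u : EvenUnitary t H) (x y : H) : ⟪u.fst x, u.fst y⟫_ℂ = ⟪x, y⟫_ℂ := by
  rw [fst_apply, fst_apply, LinearIsometryEquiv.inner_map_map, WithLp.prod_inner_apply]
  simp

theorem inner_snd_snd (u : EvenUnitary t H) (x y : H) : ⟪u.snd x, u.snd y⟫_ℂ = ⟪x, y⟫_ℂ := by
  rw [snd_apply, snd_apply, LinearIsometryEquiv.inner_map_map, WithLp.prod_inner_apply]
  simp

theorem inner_fst_snd (u : EvenUnitary t H) (x y : H) : ⟪u.fst x, u.snd y⟫_ℂ = 0 := by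
  rw [fst_apply, snd_apply, LinearIsometryEquiv.inner_map_map, WithLp.prod_inner_apply]
  simp

theorem inner_snd_fst (u : EvenUnitary t H) (x y : H) : ⟪u.snd x, u.fst y⟫_ℂ = 0 := by
  rw [fst_apply, snd_apply, LinearIsometryEquiv.inner_map_map, WithLp.prod_inner_apply]
  simp

theorem fst_parity (u : EvenUnitary t H) (x : H) : u.fst (parity x) = parity (u.fst x) := by
  simpa [fst_apply, snd_apply] using u.map_parity x 0

theorem snd_parity (u : EvenUnitary t H) (x : H) : u.snd (parity x) = parity (u.snd x) := by
  simpa [fst_apply, snd_apply] using u.map_parity 0 x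

theorem fst_hbar (u : EvenUnitary t H) (h : t = .real) (x : H) :
    u.fst (hbar h x) = hbar h (u.fst x) := by
  simpa [fst_apply, snd_apply] using u.map_hbar h x 0

theorem snd_hbar (u : EvenUnitary t H) (h : t = .real) (x : H) :
    u.snd (hbar h x) = hbar h (u.snd x) := by
  simpa [fst_apply, snd_apply] using u.map_hbar h 0 x

end EvenUnitary

open ContinuousLinearMap in
/-- Conjugation by an even isometry `V`, as a graded homomorphism `𝒦(H) → 𝒦(H)`. -/
def gradedAd (V : H →L[ℂ] H) (hV : ∀ x y, ⟪V x, V y⟫_ℂ = ⟪x, y⟫_ℂ)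
    (hp : ∀ x, V (parity x) = parity (V x))
    (hb : ∀ (h : t = .real) x, V (hbar h x) = hbar h (V x)) :
    GradedHom t (CompactOp H) (CompactOp H) where
  toNonUnitalStarAlgHom := Ad V (by
    ext x
    refine ext_inner_right ℂ fun y => ?_
    rw [ContinuousLinearMap.comp_apply, adjoint_inner_left, hV]
    rfl)
  map_grading T := by
    have h1 : ∀ x, adjoint V (parity x) = parity (adjoint V x) := fun x => by
      refine ext_inner_right ℂ fun y => ?_
      rw [adjoint_inner_left, ← inner_parity, parity_parity, ← hp, ← adjoint_inner_left,
        ← inner_parity, parity_parity]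
    ext x
    change V ((grading T).1 (adjoint V x)) = (grading (Ad V _ T)).1 x
    rw [CompactOp.grading_apply, CompactOp.grading_apply, Ad_apply, h1, hp]
  map_bar h T := by
    have h1 : ∀ x, adjoint V (hbar h x) = hbar h (adjoint V x) := fun x => by
      refine ext_inner_right ℂ fun y => ?_
      rw [adjoint_inner_left, ← hbar_hbar h (V y), inner_hbar, ← hb, ← adjoint_inner_left,
        ← inner_hbar h, hbar_hbar]
    ext x
    change V ((bar h T).1 (adjoint V x)) = (bar h (Ad V _ T)).1 x
    rw [CompactOp.bar_apply, CompactOp.bar_apply, Ad_apply, h1, hb]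

theorem gradedAd_apply (V : H →L[ℂ] H) (hV : ∀ x y, ⟪V x, V y⟫_ℂ = ⟪x, y⟫_ℂ)
    (hp : ∀ x, V (parity x) = parity (V x))
    (hb : ∀ (h : t = .real) x, V (hbar h x) = hbar h (V x)) (T : CompactOp H) (x : H) :
    (gradedAd V hV hp hb T).1 x = V (T.1 (ContinuousLinearMap.adjoint V x)) := rfl

/-- `1 ⊗̂ Ad(u ι₁)`, where `ι₁` is the inclusion of the first summand of `H ⊕ H`. -/
def EvenUnitary.push₁ (u : EvenUnitary t H) :
    GradedHom t (MaxTensor A (CompactOp H)) (MaxTensor A (CompactOp H)) :=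
  (GradedHom.id A t).tensor (gradedAd u.fst u.inner_fst_fst u.fst_parity u.fst_hbar)

/-- `1 ⊗̂ Ad(u ι₂)`, where `ι₂` is the inclusion of the second summand of `H ⊕ H`. -/
def EvenUnitary.push₂ (u : EvenUnitary t H) :
    GradedHom t (MaxTensor A (CompactOp H)) (MaxTensor A (CompactOp H)) :=
  (GradedHom.id A t).tensor (gradedAd u.snd u.inner_snd_snd u.snd_parity u.snd_hbar)

theorem tmul_mul_tmul_eq_zero {φ ψ : GradedHom t (CompactOp H) (CompactOp H)}
    (h : ∀ S T, φ S * ψ T = 0) (x y : MaxTensor A (CompactOp H)) :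
    (GradedHom.id A t).tensor φ x * (GradedHom.id A t).tensor ψ y = 0 := by
  have he : ∀ T, evenPart (φ T) = φ (evenPart T) := fun T => by
    rw [evenPart_apply, evenPart_apply, map_smul, map_add, φ.apply_grading]
  have ho : ∀ T, oddPart (φ T) = φ (oddPart T) := fun T => by
    rw [oddPart_apply, oddPart_apply, map_smul, map_sub, φ.apply_grading]
  have hφ := ((GradedHom.id A t).tensor φ).continuous
  have hψ := ((GradedHom.id A t).tensor ψ).continuous
  refine MaxTensor.eq_of_tmul (g := fun _ => (0 : MaxTensor A (CompactOp H)))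
    (f := fun x => (GradedHom.id A t).tensor φ x * (GradedHom.id A t).tensor ψ y)
    (hφ.mul continuous_const) continuous_const (by simp) rfl
    (fun x x' => by rw [map_add, add_mul]) (fun _ _ => (add_zero _).symm) (fun a S => ?_) x
  refine MaxTensor.eq_of_tmul (g := fun _ => (0 : MaxTensor A (CompactOp H)))
    (f := fun y => (GradedHom.id A t).tensor φ (tmul a S) * (GradedHom.id A t).tensor ψ y)
    (continuous_const.mul hψ) continuous_const (by simp) rfl
    (fun x x' => by rw [map_add, mul_add]) (fun _ _ => (add_zero _).symm) (fun b T => ?_) y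
  simp only [GradedHom.tensor_tmul]
  rw [tmul, tmul, ← CStarCompletion.of_mul, AlgTensor.tmul_mul_tmul, he, ho, h, h,
    AlgTensor.tmul_zero, AlgTensor.tmul_zero, add_zero, CStarCompletion.of_zero]

theorem EvenUnitary.push₁_mul_push₂ (u : EvenUnitary t H) (x y : MaxTensor A (CompactOp H)) :
    u.push₁ x * u.push₂ y = 0 := by
  refine tmul_mul_tmul_eq_zero (fun S T => ?_) x y
  ext z
  change u.fst (S.1 (ContinuousLinearMap.adjoint u.fst (u.snd _))) = 0
  have : ∀ w, ContinuousLinearMap.adjoint u.fst (u.snd w) = 0 := fun w =>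
    ext_inner_right ℂ fun v => by
      rw [ContinuousLinearMap.adjoint_inner_left, u.inner_snd_fst, inner_zero_left]
  rw [this, map_zero, map_zero]

theorem EvenUnitary.push₂_mul_push₁ (u : EvenUnitary t H) (x y : MaxTensor A (CompactOp H)) :
    u.push₂ x * u.push₁ y = 0 := by
  refine tmul_mul_tmul_eq_zero (fun S T => ?_) x y
  ext z
  change u.snd (S.1 (ContinuousLinearMap.adjoint u.snd (u.fst _))) = 0
  have : ∀ w, ContinuousLinearMap.adjoint u.snd (u.fst w) = 0 := fun w =>
    ext_inner_right ℂ fun v => by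
      rw [ContinuousLinearMap.adjoint_inner_left, u.inner_fst_snd, inner_zero_left]
  rw [this, map_zero, map_zero]

/-- The sum of `φ` and `ψ` in `𝕂(A, H)`: the block-diagonal homomorphism `f ↦ diag(φ(f), ψ(f))`
in `Hom(𝒮, A ⊗̂ 𝒦(H ⊕ H))`, transported to `𝕂(A, H)` by the unitary `u : H ⊕ H → H`. -/
def KSpace.add (u : EvenUnitary t H) (φ ψ : KSpace t A H) : KSpace t A H where
  toFun f := u.push₁ (φ f) + u.push₂ (ψ f)
  map_smul' c f := by simp only [map_smul, smul_add, MonoidHom.id_apply]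
  map_zero' := by simp only [_root_.map_zero, add_zero]
  map_add' f g := by simp only [map_add]; abel
  map_mul' f g := by
    simp only [map_mul, add_mul, mul_add, u.push₁_mul_push₂, u.push₂_mul_push₁, add_zero,
      zero_add]
  map_star' f := by simp only [map_star, star_add]
  map_grading f := by
    change u.push₁ (φ (grading f)) + u.push₂ (ψ (grading f)) =
      grading (u.push₁ (φ f) + u.push₂ (ψ f))
    simp only [GradedHom.apply_grading, map_add]
  map_bar h f := by
    change u.push₁ (φ (bar h f)) + u.push₂ (ψ (bar h f)) =
      bar h (u.push₁ (φ f) + u.push₂ (ψ f))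
    simp only [GradedHom.apply_bar, bar_add]

theorem KSpace.add_apply (u : EvenUnitary t H) (φ ψ : KSpace t A H) (f : SAlg) :
    KSpace.add u φ ψ f = u.push₁ (φ f) + u.push₂ (ψ f) := rfl

variable (A) in
/-- The H-space structure `𝕂(A, H) × 𝕂(A, H) → 𝕂(A, H)` given by a unitary `H ⊕ H → H`. -/
def hSpaceAdd (u : EvenUnitary t H) : C(KSpace t A H × KSpace t A H, KSpace t A H) where
  toFun p := KSpace.add u p.1 p.2
  continuous_toFun := GradedHom.continuous_iff.2 fun f =>
    (u.push₁.continuous.comp ((GradedHom.continuous_eval f).comp continuous_fst)).add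
      (u.push₂.continuous.comp ((GradedHom.continuous_eval f).comp continuous_snd))

theorem hSpaceAdd_zero (u : EvenUnitary t H) : hSpaceAdd A u (0, 0) = 0 := by
  refine DFunLike.ext _ _ fun f => ?_
  change u.push₁ (0 : MaxTensor A (CompactOp H)) + u.push₂ (0 : MaxTensor A (CompactOp H)) = 0
  rw [map_zero, map_zero, add_zero]

end Sum

/-! ### Spectral K-theory groups -/

section KGroups

open GradedHilbertSpace RealHilbertStructure
open scoped lp

/-- The graded Hilbert space `ℓ² ⊕ ℓ²`. -/
def HatL2 : Type := WithLp 2 (ℓ²(ℕ, ℂ) × ℓ²(ℕ, ℂ))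

instance : NormedAddCommGroup HatL2 :=
  inferInstanceAs (NormedAddCommGroup (WithLp 2 (ℓ²(ℕ, ℂ) × ℓ²(ℕ, ℂ))))
instance : InnerProductSpace ℂ HatL2 :=
  inferInstanceAs (InnerProductSpace ℂ (WithLp 2 (ℓ²(ℕ, ℂ) × ℓ²(ℕ, ℂ))))
instance : CompleteSpace HatL2 :=
  inferInstanceAs (CompleteSpace (WithLp 2 (ℓ²(ℕ, ℂ) × ℓ²(ℕ, ℂ))))

/-- The element `(x, y)` of `ℓ² ⊕ ℓ²`. -/
def HatL2.mk (x y : ℓ²(ℕ, ℂ)) : HatL2 := WithLp.toLp 2 (x, y)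
/-- The even component. -/
def HatL2.fst (z : HatL2) : ℓ²(ℕ, ℂ) := WithLp.fst z
/-- The odd component. -/
def HatL2.snd (z : HatL2) : ℓ²(ℕ, ℂ) := WithLp.snd z

theorem HatL2.inner_def (z w : HatL2) :
    ⟪z, w⟫_ℂ = ⟪z.fst, w.fst⟫_ℂ + ⟪z.snd, w.snd⟫_ℂ := WithLp.prod_inner_apply z w

theorem HatL2.norm_sq (z : HatL2) : ‖z‖ ^ 2 = ‖z.fst‖ ^ 2 + ‖z.snd‖ ^ 2 :=
  WithLp.prod_norm_sq_eq_of_L2 z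

/-- The first summand is even and the second summand is odd. -/
instance : GradedHilbertSpace HatL2 where
  parity := LinearMap.mkContinuous
    { toFun := fun z : HatL2 => HatL2.mk z.fst (-z.snd)
      map_add' := fun z w => by
        change HatL2.mk (z.fst + w.fst) (-(z.snd + w.snd)) = HatL2.mk (_ + _) (_ + _)
        rw [neg_add]; rfl
      map_smul' := fun c z => by
        change HatL2.mk (c • z.fst) (-(c • z.snd)) = HatL2.mk (c • z.fst) (c • (-z.snd))
        rw [smul_neg] } 1 (fun z => by
      rw [one_mul]
      refine le_of_sq_le_sq ?_ (norm_nonneg _)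
      rw [HatL2.norm_sq, HatL2.norm_sq]
      change ‖z.fst‖ ^ 2 + ‖-z.snd‖ ^ 2 ≤ _
      rw [norm_neg])
  parity_parity z := by
    change HatL2.mk z.fst (- -z.snd) = z
    rw [neg_neg]; rfl
  inner_parity z w := by
    rw [HatL2.inner_def, HatL2.inner_def]
    change ⟪z.fst, w.fst⟫_ℂ + ⟪-z.snd, -w.snd⟫_ℂ = _
    rw [inner_neg_neg]

theorem inner_star_star (x y : ℓ²(ℕ, ℂ)) : ⟪star x, star y⟫_ℂ = star ⟪x, y⟫_ℂ := by
  rw [lp.inner_eq_tsum, lp.inner_eq_tsum]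
  change _ = (starRingEnd ℂ) _
  rw [Complex.conj_tsum]
  refine tsum_congr fun i => ?_
  simp

/-- Coordinatewise complex conjugation. -/
instance {t : Flavor} : RealHilbertStructure t HatL2 where
  hbar _ := LinearMap.mkContinuous
    { toFun := fun z : HatL2 => HatL2.mk (star z.fst) (star z.snd)
      map_add' := fun z w => by
        change HatL2.mk (star (z.fst + w.fst)) (star (z.snd + w.snd)) = HatL2.mk (_ + _) (_ + _)
        rw [star_add, star_add]; rfl
      map_smul' := fun c z => by
        change HatL2.mk (star (c • z.fst)) (star (c • z.snd)) =
          HatL2.mk (star c • star z.fst) (star c • star z.snd)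
        rw [star_smul, star_smul] } 1 (fun z => by
      rw [one_mul]
      refine le_of_sq_le_sq ?_ (norm_nonneg _)
      rw [HatL2.norm_sq, HatL2.norm_sq]
      change ‖star z.fst‖ ^ 2 + ‖star z.snd‖ ^ 2 ≤ _
      rw [norm_star, norm_star])
  hbar_hbar _ z := by
    change HatL2.mk (star (star z.fst)) (star (star z.snd)) = z
    rw [star_star, star_star]; rfl
  inner_hbar _ z w := by
    rw [HatL2.inner_def, HatL2.inner_def]
    change ⟪star z.fst, star w.fst⟫_ℂ + ⟪star z.snd, star w.snd⟫_ℂ = _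
    rw [inner_star_star, inner_star_star, star_add]
  hbar_parity _ z := by
    change HatL2.mk (star z.fst) (star (-z.snd)) = HatL2.mk (star z.fst) (-star z.snd)
    rw [star_neg]

variable (t : Flavor) (A B : Type*)
  [NonUnitalCStarAlgebra A] [GradedCStarAlgebra A] [RealStructure t A]
  [NonUnitalCStarAlgebra B] [GradedCStarAlgebra B] [RealStructure t B]

/-- The spectral K-theory groups `K_i(A) = π_i(𝕂(A, ℓ² ⊕ ℓ²), 0)`. -/
abbrev SpectralKGroup (i : ℕ) : Type _ :=
  HomotopyGroup (Fin i) (KSpace t A HatL2) 0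

variable {t A B}

/-- The map on spectral K-theory groups induced by a homomorphism. -/
def SpectralKGroup.map (i : ℕ) (φ : GradedHom t A B) :
    SpectralKGroup t A i → SpectralKGroup t B i :=
  homotopyGroupMap (Fin i) (KSpace.map HatL2 φ) (KSpace.map_zero HatL2 φ)

/-- The addition on spectral K-theory groups that comes from the H-space structure. -/
def SpectralKGroup.add (u : EvenUnitary t HatL2) (i : ℕ) (x y : SpectralKGroup t A i) :
    SpectralKGroup t A i :=
  homotopyGroupMap₂ (Fin i) (hSpaceAdd A u) (hSpaceAdd_zero u) x y

end KGroups

end SpectralK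

end

open SpectralK

open scoped TensorProduct ZeroAtInfty Topology InnerProductSpace

noncomputable section

set_option linter.unusedSectionVars false
set_option linter.unusedSimpArgs false

namespace SpectralK

open Filter GradedCStarAlgebra RealStructure

/-! ### Approximate units and self-adjoint powers -/

section ApproximateUnit

variable (A : Type*) [NonUnitalCStarAlgebra A] [GradedCStarAlgebra A]

/-! The theorem rests on the isomorphism `𝒦(𝓗) ⊗̂ 𝒦(H) ≅ 𝒦(𝓗 ⊗ H) ≅ 𝒦(H)`. The Hilbert space `𝓗 ⊗ H`
is separable and has infinite-dimensional even and odd parts, whichever parities occur in `𝓗`, so an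
even (and Real) unitary identifies it with `H`. Tensoring with `A` gives an isomorphism from `(A ⊗̂
𝒦(𝓗)) ⊗̂ 𝒦(H)` to `A ⊗̂ 𝒦(H)`, called `TensorIso.absorb`. If `e` projects onto the line of an even
Real unit vector `v`, then `Φ ⊗̂ 1` followed by this isomorphism is `1 ⊗̂ Ad V`, where `V y = v ⊗ y`
is an even Real isometry of `H`. Once `Ad V` is joined to the identity by a point-norm continuous
path of graded homomorphisms, `𝕂(Φ)` is inverted up to pointed homotopy by postcomposition with
`absorb` (`IsPointedHomotopyEquiv.of_comp`).

The path comes from `EvenIsometry.joined_ad_id`. Compact operators are limits of sums of rank one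
operators, so strong continuity of a path of isometries suffices. Isometries with orthogonal ranges
are joined by the rotation `cos V + sin W`. Two shifts `S`, `S'` of an adapted basis with orthogonal
ranges are each joined to the identity by infinitely many plane rotations performed in succession
(`exists_shift`). Hence `V ∼ S V ∼ S' ∼ 1`.

The analytic work concerns the maximal tensor product. A `*`-homomorphism on the algebraic tensor
product that is bounded on elementary tensors by any constant is contractive there
(`AlgTensor.norm_apply_tmul_le`), so it extends to the completion. The associator requires
continuity in a factor that is already completed; it is obtained from the C*-seminorm
`NestedHom.sup`. The map `𝒦(G) ⊗̂ 𝒦(H) → 𝒦(L)` is injective (`TensorIso.hom_injective`) because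
multiplying by rank one tensors on both sides compresses every element to a scalar multiple of one
rank one tensor, where the representation preserves the norm.

The statements about groups are formal: pointed homotopy equivalences induce bijections of homotopy
groups, and `Φ` acts on the factor `A` while the H-space sum acts on `𝒦(H)`, so the two commute
(`KSpace.map_add`). -/

theorem continuous_grading : Continuous (grading : A → A) :=
  (AddMonoidHomClass.lipschitz_of_bound (grading : A →⋆ₙₐ[ℂ] A) 1
    (by simpa using NonUnitalStarAlgHom.norm_apply_le (grading : A →⋆ₙₐ[ℂ] A))).continuous

variable {A}

theorem norm_evenPart_le (a : A) : ‖evenPart a‖ ≤ ‖a‖ := by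
  have h := NonUnitalStarAlgHom.norm_apply_le (grading : A →⋆ₙₐ[ℂ] A) a
  rw [evenPart_apply, norm_smul]
  have h2 := norm_add_le a (grading a)
  norm_num
  linarith

theorem norm_oddPart_le (a : A) : ‖oddPart a‖ ≤ ‖a‖ := by
  have h := NonUnitalStarAlgHom.norm_apply_le (grading : A →⋆ₙₐ[ℂ] A) a
  rw [oddPart_apply, norm_smul]
  have h2 := norm_sub_le a (grading a)
  norm_num
  linarith

variable (A)

/-- Every graded C*-algebra has an approximate unit that consists of even contractions. -/
theorem exists_even_approximateUnit : ∃ l : Filter A, l.NeBot ∧ (∀ᶠ u in l, ‖u‖ ≤ 1) ∧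
    (∀ᶠ u in l, grading u = u) ∧ (∀ a, Tendsto (fun u => a * u) l (𝓝 a)) ∧
    ∀ a, Tendsto (fun u => u * a) l (𝓝 a) := by
  let _ := CStarAlgebra.spectralOrder A
  have := CStarAlgebra.spectralOrderedRing A
  have hl := CStarAlgebra.increasingApproximateUnit A
  have hg := continuous_grading A
  -- The even parts `(u + ε(u)) / 2` still form an approximate unit, because `a ε(u) = ε(ε(a) u)`
  -- tends to `ε(ε(a)) = a`.
  refine ⟨map evenPart (CStarAlgebra.approximateUnit A), inferInstance, ?_, ?_, fun a => ?_,
    fun a => ?_⟩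
  · exact hl.eventually_norm.mono fun u hu => (norm_evenPart_le u).trans hu
  · exact eventually_map.2 (Eventually.of_forall fun u => grading_evenPart u)
  · rw [tendsto_map'_iff]
    have h1 := hl.tendsto_mul_left a
    have h2 := (hg.tendsto _).comp (hl.tendsto_mul_left (grading a))
    have h3 := (h1.add h2).const_smul (1 / 2 : ℂ)
    rw [grading_grading, ← two_smul ℂ a, smul_smul] at h3
    norm_num at h3
    refine h3.congr fun u => ?_
    simp [evenPart_apply, mul_add, grading_grading, mul_smul_comm]
  · rw [tendsto_map'_iff]
    have h1 := hl.tendsto_mul_right a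
    have h2 := (hg.tendsto _).comp (hl.tendsto_mul_right (grading a))
    have h3 := (h1.add h2).const_smul (1 / 2 : ℂ)
    rw [grading_grading, ← two_smul ℂ a, smul_smul] at h3
    norm_num at h3
    refine h3.congr fun u => ?_
    simp [evenPart_apply, add_mul, grading_grading, smul_mul_assoc]

end ApproximateUnit

/-- Taking `2^n`-th roots and letting `n → ∞` removes the constant `K`. Only powers of two occur
because the bounds come from repeated squaring. -/
theorem le_of_forall_pow_two_pow_le {x c K : ℝ} (hc : 0 ≤ c)
    (h : ∀ n : ℕ, x ^ 2 ^ n ≤ K * c ^ 2 ^ n) : x ≤ c := by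
  by_contra! hx
  rcases hc.eq_or_lt with rfl | hc
  · have := h 0
    simp at this
    linarith
  · have h1 : Tendsto (fun n : ℕ => (x / c) ^ 2 ^ n) atTop atTop :=
      (tendsto_pow_atTop_atTop_of_one_lt ((one_lt_div hc).2 hx)).comp
        (tendsto_pow_atTop_atTop_of_one_lt (one_lt_two : (1 : ℕ) < 2))
    obtain ⟨n, hn⟩ := (h1.eventually_gt_atTop K).exists
    rw [div_pow, lt_div_iff₀ (by positivity)] at hn
    exact absurd (h n) (not_le.2 hn)

section Iterate

variable {E : Type*} [NonUnitalCStarAlgebra E]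

theorem isSelfAdjoint_mul_self {R : Type*} [Mul R] [StarMul R] {x : R} (h : IsSelfAdjoint x) :
    IsSelfAdjoint (x * x) := by
  rw [IsSelfAdjoint, star_mul, h.star_eq]

/-- The C*-identity reads `‖x²‖ = ‖x‖²` for self-adjoint `x`, and squares stay self-adjoint. -/
theorem norm_iterate_mul_self {x : E} (h : IsSelfAdjoint x) (n : ℕ) :
    ‖(fun y => y * y)^[n] x‖ = ‖x‖ ^ 2 ^ n := by
  induction n generalizing x with
  | zero => simp
  | succ n ih =>
    rw [Function.iterate_succ_apply, ih (isSelfAdjoint_mul_self h), pow_succ', pow_mul]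
    congr 1
    have := CStarRing.norm_star_mul_self (x := x)
    rw [h.star_eq] at this
    rw [this, sq]

end Iterate

/-! ### Homomorphisms out of the maximal tensor product -/

section Lift

variable {A B E : Type*} [NonUnitalCStarAlgebra A] [GradedCStarAlgebra A]
  [NonUnitalCStarAlgebra B] [GradedCStarAlgebra B] [NonUnitalCStarAlgebra E]

namespace AlgTensor

/-- The Koszul sign depends on `∂b ∂c` alone, so homogeneity of either middle factor determines it.
These are the variants for homogeneous `c`. -/
theorem tmul_mul_tmul_of_even_right (a : A) (b : B) {c : A} (hc : grading c = c) (d : B) :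
    tmul a b * tmul c d = tmul (a * c) (b * d) := by
  rw [tmul_mul_tmul, hc, ← tmul_add, ← add_mul, evenPart_add_oddPart]

theorem evenPart_sub_oddPart (b : B) : evenPart b - oddPart b = grading b := by
  rw [evenPart_apply, oddPart_apply, ← smul_sub, add_sub_sub_cancel, ← two_smul ℂ (grading b),
    smul_smul]
  norm_num

theorem tmul_mul_tmul_of_odd_right (a : A) (b : B) {c : A} (hc : grading c = -c) (d : B) :
    tmul a b * tmul c d = tmul (a * c) (grading b * d) := by
  rw [tmul_mul_tmul, hc, mul_neg, neg_tmul, ← tmul_neg, ← tmul_add, ← neg_mul, ← add_mul,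
    ← sub_eq_add_neg, evenPart_sub_oddPart]

theorem star_tmul_of_even_left {a : A} (ha : grading a = a) (b : B) :
    star (tmul a b) = tmul (star a) (star b) := by
  rw [star_tmul, ha, ← tmul_add, ← star_add, evenPart_add_oddPart]

theorem star_tmul_of_odd_left {a : A} (ha : grading a = -a) (b : B) :
    star (tmul a b) = tmul (star a) (star (grading b)) := by
  rw [star_tmul, ha, star_neg, neg_tmul, ← tmul_neg, ← tmul_add, ← star_neg, ← star_add,
    ← sub_eq_add_neg, evenPart_sub_oddPart]

/-- With one factor even no signs arise: `ψ(a ⊗ b)` is self-adjoint and its iterated squares are the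
images of `a^(2^n) ⊗ b^(2^n)`. The bound with constant `K` for all `n` then forces the bound with
constant `1`. -/
theorem norm_apply_tmul_le_of_isSelfAdjoint (ψ : AlgTensor A B →⋆ₙₐ[ℂ] E) {K : ℝ}
    (hψ : ∀ a b, ‖ψ (tmul a b)‖ ≤ K * ‖a‖ * ‖b‖) {a : A} {b : B} (ha : IsSelfAdjoint a)
    (hb : IsSelfAdjoint b) (h : grading a = a ∨ grading b = b) :
    ‖ψ (tmul a b)‖ ≤ ‖a‖ * ‖b‖ := by
  have hsa : IsSelfAdjoint (ψ (tmul a b)) := by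
    rw [IsSelfAdjoint, ← map_star]
    rcases h with h | h
    · rw [star_tmul_of_even_left h, ha.star_eq, hb.star_eq]
    · rw [star_tmul_of_even_right _ h, ha.star_eq, hb.star_eq]
  have hit : ∀ n, (fun y => y * y)^[n] (ψ (tmul a b)) =
      ψ (tmul ((fun y => y * y)^[n] a) ((fun y => y * y)^[n] b)) := fun n => by
    clear ha hb hsa
    induction n generalizing a b with
    | zero => rfl
    | succ n ih =>
      rw [Function.iterate_succ_apply, Function.iterate_succ_apply, Function.iterate_succ_apply,
        ← map_mul]
      rcases h with h | h
      · rw [tmul_mul_tmul_of_even_right _ _ h, ih (Or.inl (by rw [map_mul, h]))]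
      · rw [tmul_mul_tmul_of_even_left _ h, ih (Or.inr (by rw [map_mul, h]))]
  refine le_of_forall_pow_two_pow_le (K := K) (by positivity) fun n => ?_
  rw [← norm_iterate_mul_self hsa, hit, mul_pow, ← norm_iterate_mul_self ha,
    ← norm_iterate_mul_self hb, ← mul_assoc]
  exact hψ _ _

/-- The C*-identity reduces this to `a*a ⊗ b*b`, whose factors are self-adjoint and one of which is
still even. -/
theorem norm_apply_tmul_le_of_even (ψ : AlgTensor A B →⋆ₙₐ[ℂ] E) {K : ℝ}
    (hψ : ∀ a b, ‖ψ (tmul a b)‖ ≤ K * ‖a‖ * ‖b‖) {a : A} {b : B}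
    (h : grading a = a ∨ grading b = b) : ‖ψ (tmul a b)‖ ≤ ‖a‖ * ‖b‖ := by
  refine le_of_sq_le_sq ?_ (by positivity)
  rw [mul_pow, sq, sq, sq, ← CStarRing.norm_star_mul_self, ← CStarRing.norm_star_mul_self,
    ← CStarRing.norm_star_mul_self, ← map_star, ← map_mul]
  have hm : star (tmul a b) * tmul a b = tmul (star a * a) (star b * b) := by
    rcases h with h | h
    · rw [star_tmul_of_even_left h, tmul_mul_tmul_of_even_right _ _ h]
    · rw [star_tmul_of_even_right _ h, tmul_mul_tmul_of_even_left _ (grading_star_even h)]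
  rw [hm]
  refine norm_apply_tmul_le_of_isSelfAdjoint ψ hψ (IsSelfAdjoint.star_mul_self a)
    (IsSelfAdjoint.star_mul_self b) ?_
  rcases h with h | h
  · exact Or.inl (by rw [map_mul, map_star, h])
  · exact Or.inr (by rw [map_mul, map_star, h])

/-- A bounded `*`-homomorphism on the algebraic tensor product is contractive on elementary
tensors. -/
theorem norm_apply_tmul_le (ψ : AlgTensor A B →⋆ₙₐ[ℂ] E) {K : ℝ}
    (hψ : ∀ a b, ‖ψ (tmul a b)‖ ≤ K * ‖a‖ * ‖b‖) (a : A) (b : B) :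
    ‖ψ (tmul a b)‖ ≤ ‖a‖ * ‖b‖ := by
  obtain ⟨l, _, hn, he, h, -⟩ := exists_even_approximateUnit A
  obtain ⟨l', _, hn', he', -, h'⟩ := exists_even_approximateUnit B
  -- Here `K` makes `ψ(a ⊗ b)` jointly continuous in `a` and `b`, so that limits along approximate
  -- units may be taken.
  let β : A →L[ℂ] B →L[ℂ] E := LinearMap.mkContinuous₂ (LinearMap.mk₂ ℂ (fun a b => ψ (tmul a b))
    (fun a a' b => by rw [add_tmul, map_add]) (fun c a b => by rw [smul_tmul, map_smul])
    (fun a b b' => by rw [tmul_add, map_add]) (fun c a b => by rw [tmul_smul, map_smul])) K hψ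
  have hβ : Continuous fun p : A × B => β p.1 p.2 := by fun_prop
  -- For even `u` and `u'` one has `au ⊗ u'b = (a ⊗ u')(u ⊗ b)`. Each factor on the right has an
  -- even entry, so the bound for that case applies to both.
  have hlim : Tendsto (fun p : A × B => ψ (tmul (a * p.1) (p.2 * b))) (l ×ˢ l')
      (𝓝 (ψ (tmul a b))) :=
    (hβ.tendsto (a, b)).comp (((h a).comp tendsto_fst).prodMk_nhds ((h' b).comp tendsto_snd))
  refine le_of_tendsto hlim.norm ?_
  filter_upwards [tendsto_fst.eventually hn, tendsto_fst.eventually he,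
    tendsto_snd.eventually hn', tendsto_snd.eventually he'] with p h1 h2 h3 h4
  rw [← tmul_mul_tmul_of_even_left _ h4, map_mul]
  have e1 := norm_apply_tmul_le_of_even ψ hψ (a := a) (Or.inr h4)
  have e2 := norm_apply_tmul_le_of_even ψ hψ (b := b) (Or.inl h2)
  calc ‖ψ (tmul a p.2) * ψ (tmul p.1 b)‖ ≤ (‖a‖ * ‖p.2‖) * (‖p.1‖ * ‖b‖) :=
        (norm_mul_le _ _).trans (mul_le_mul e1 e2 (norm_nonneg _) (by positivity))
    _ ≤ (‖a‖ * 1) * (1 * ‖b‖) := by gcongr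
    _ = ‖a‖ * ‖b‖ := by ring

/-- The pulled-back norm is one of the seminorms in the supremum `maxNorm`; contractivity on
elementary tensors is what admits it there. -/
theorem norm_apply_le (ψ : AlgTensor A B →⋆ₙₐ[ℂ] E) {K : ℝ}
    (hψ : ∀ a b, ‖ψ (tmul a b)‖ ≤ K * ‖a‖ * ‖b‖) (x : AlgTensor A B) : ‖ψ x‖ ≤ ‖x‖ :=
  le_maxNorm (A := A) (B := B)
    { toFun := fun x => ‖ψ x‖
      add_le := fun x y => by rw [map_add]; exact norm_add_le _ _
      smul_eq := fun c x => by rw [map_smul, norm_smul]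
      mul_le := fun x y => by rw [map_mul]; exact norm_mul_le _ _
      star_mul_self := fun x => by rw [map_mul, map_star, CStarRing.norm_star_mul_self]
      tmul_le := norm_apply_tmul_le ψ hψ } x

end AlgTensor

/-- The canonical linear map of a pre-C*-algebra to its completion. -/
def CStarCompletion.ofₗ (R : Type*) [PreCStarAlgebra R] : R →ₗ[ℂ] CStarCompletion R where
  toFun := CStarCompletion.of
  map_add' := CStarCompletion.of_add
  map_smul' := CStarCompletion.of_smul

/-- The extension of a contractive `*`-homomorphism to the completion. -/
def CStarCompletion.lift {R : Type*} [PreCStarAlgebra R] (f : R →⋆ₙₐ[ℂ] E)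
    (hf : ∀ x, ‖f x‖ ≤ ‖x‖) : CStarCompletion R →⋆ₙₐ[ℂ] E :=
  let g : CStarCompletion R →L[ℂ] E :=
    ((f : R →ₙₐ[ℂ] E) : R →ₗ[ℂ] E).extendOfNorm (CStarCompletion.ofₗ R)
  have hg : ∀ x, g (of x) = f x := fun x =>
    LinearMap.extendOfNorm_eq (e := CStarCompletion.ofₗ R) (f := ((f : R →ₙₐ[ℂ] E) : R →ₗ[ℂ] E))
      denseRange_of ⟨1, fun x => by rw [one_mul]; exact (hf x).trans_eq (norm_of x).symm⟩ x
  { g with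
    map_zero' := map_zero g
    map_mul' := fun x y => by
      change g (x * y) = g x * g y
      induction x, y using ind₂ with
      | hp => exact isClosed_eq (by fun_prop) (by fun_prop)
      | h x y => rw [← of_mul, hg, hg, hg, map_mul]
    map_star' := fun x => by
      change g (star x) = star (g x)
      induction x using ind with
      | hp => exact isClosed_eq (by fun_prop) (by fun_prop)
      | h x => rw [← of_star, hg, hg, map_star] }

theorem CStarCompletion.lift_of {R : Type*} [PreCStarAlgebra R] (f : R →⋆ₙₐ[ℂ] E)
    (hf : ∀ x, ‖f x‖ ≤ ‖x‖) (x : R) : CStarCompletion.lift f hf (of x) = f x :=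
  LinearMap.extendOfNorm_eq (e := CStarCompletion.ofₗ R) (f := ((f : R →ₙₐ[ℂ] E) : R →ₗ[ℂ] E))
    denseRange_of ⟨1, fun x => by rw [one_mul]; exact (hf x).trans_eq (norm_of x).symm⟩ x

/-- The extension of a bounded `*`-homomorphism to the maximal tensor product. -/
def MaxTensor.lift (ψ : AlgTensor A B →⋆ₙₐ[ℂ] E) {K : ℝ}
    (hψ : ∀ a b, ‖ψ (AlgTensor.tmul a b)‖ ≤ K * ‖a‖ * ‖b‖) : MaxTensor A B →⋆ₙₐ[ℂ] E :=
  CStarCompletion.lift ψ (AlgTensor.norm_apply_le ψ hψ)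

theorem MaxTensor.lift_tmul (ψ : AlgTensor A B →⋆ₙₐ[ℂ] E) {K : ℝ}
    (hψ : ∀ a b, ‖ψ (AlgTensor.tmul a b)‖ ≤ K * ‖a‖ * ‖b‖) (a : A) (b : B) :
    MaxTensor.lift ψ hψ (tmul a b) = ψ (AlgTensor.tmul a b) := CStarCompletion.lift_of _ _ _

theorem norm_tmul_le (a : A) (b : B) : ‖(tmul a b : MaxTensor A B)‖ ≤ ‖a‖ * ‖b‖ := by
  rw [tmul, CStarCompletion.norm_of]
  exact maxNorm_tmul_le a b

end Lift

/-! ### Associativity of the maximal tensor product -/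

section Nested

variable (A B C E : Type*) [NonUnitalCStarAlgebra A] [GradedCStarAlgebra A]
  [NonUnitalCStarAlgebra B] [GradedCStarAlgebra B] [NonUnitalCStarAlgebra C]
  [GradedCStarAlgebra C] [NonUnitalCStarAlgebra E]

/-- The grading on the algebraic tensor product. -/
def AlgTensor.gr : AlgTensor A B →⋆ₙₐ[ℂ] AlgTensor A B :=
  AlgTensor.map grading grading (fun _ => rfl) (fun _ => rfl)

variable {A B} in
theorem AlgTensor.gr_tmul (a : A) (b : B) :
    AlgTensor.gr A B (tmul a b) = tmul (grading a) (grading b) := rfl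

variable {A B} in
theorem AlgTensor.norm_gr_le (x : AlgTensor A B) : ‖AlgTensor.gr A B x‖ ≤ ‖x‖ :=
  AlgTensor.norm_map_le grading grading (fun _ => rfl) (fun _ => rfl) x

variable {A B} in
theorem MaxTensor.grading_of (x : AlgTensor A B) :
    grading (CStarCompletion.of x) = CStarCompletion.of (AlgTensor.gr A B x) :=
  CStarCompletion.map_of (AlgTensor.gr A B) AlgTensor.norm_gr_le x

/-- A `*`-homomorphism on the algebraic tensor product of the `*`-algebra `A ⊗ B` with `C`, given
as a bilinear map. -/
structure NestedHom where
  toFun : C →ₗ[ℂ] AlgTensor A B →ₗ[ℂ] E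
  mul_even : ∀ c c' z z', grading c = c → toFun c z * toFun c' z' = toFun (c * c') (z * z')
  mul_odd : ∀ c c' z z', grading c = -c →
    toFun c z * toFun c' z' = toFun (c * c') (z * AlgTensor.gr A B z')
  star_even : ∀ c z, grading c = c → star (toFun c z) = toFun (star c) (star z)
  star_odd : ∀ c z, grading c = -c →
    star (toFun c z) = toFun (star c) (star (AlgTensor.gr A B z))
  norm_le : ∀ c a b, ‖toFun c (AlgTensor.tmul a b)‖ ≤ ‖a‖ * ‖b‖ * ‖c‖

variable {A B C E}

namespace NestedHom

variable (Λ : NestedHom A B C E)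

/-- The constant depends on a decomposition of `z` into elementary tensors, so it says nothing about
continuity in `z`. It serves to make `Λ` continuous in `c` and the supremum `sup` finite. -/
theorem exists_bound (z : AlgTensor A B) : ∃ K, 0 ≤ K ∧ ∀ c, ‖Λ.toFun c z‖ ≤ K * ‖c‖ := by
  induction z using AlgTensor.ind with
  | zero => exact ⟨0, le_rfl, fun c => by simp⟩
  | tmul a b => exact ⟨‖a‖ * ‖b‖, by positivity, fun c => Λ.norm_le c a b⟩
  | add x y hx hy =>
    obtain ⟨K, hK, h⟩ := hx
    obtain ⟨K', hK', h'⟩ := hy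
    refine ⟨K + K', by positivity, fun c => ?_⟩
    rw [map_add, add_mul]
    exact (norm_add_le _ _).trans (add_le_add (h c) (h' c))

theorem continuous_left (z : AlgTensor A B) : Continuous fun c => Λ.toFun c z := by
  obtain ⟨K, -, h⟩ := Λ.exists_bound z
  exact (LinearMap.mkContinuous (Λ.toFun.flip z) K h).continuous

theorem bddAbove (z : AlgTensor A B) :
    BddAbove (Set.range fun c : {c : C // grading c = c ∧ ‖c‖ ≤ 1} => ‖Λ.toFun c z‖) := by
  obtain ⟨K, hK, h⟩ := Λ.exists_bound z
  refine ⟨K, ?_⟩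
  rintro _ ⟨c, rfl⟩
  exact (h c).trans (mul_le_of_le_one_right hK c.2.2)

/-- The supremum over the even contractions `c` of the seminorms `z ↦ ‖Λ(z ⊗ c)‖`. -/
def sup (z : AlgTensor A B) : ℝ := ⨆ c : {c : C // grading c = c ∧ ‖c‖ ≤ 1}, ‖Λ.toFun c z‖

instance : Nonempty {c : C // grading c = c ∧ ‖c‖ ≤ 1} := ⟨⟨0, by simp⟩⟩

theorem le_sup {c : C} (hc : grading c = c) (hc' : ‖c‖ ≤ 1) (z : AlgTensor A B) :
    ‖Λ.toFun c z‖ ≤ Λ.sup z := le_ciSup (Λ.bddAbove z) ⟨c, hc, hc'⟩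

theorem sup_le {z : AlgTensor A B} {K : ℝ}
    (h : ∀ c : C, grading c = c → ‖c‖ ≤ 1 → ‖Λ.toFun c z‖ ≤ K) : Λ.sup z ≤ K :=
  ciSup_le fun c => h c c.2.1 c.2.2

theorem sup_nonneg (z : AlgTensor A B) : 0 ≤ Λ.sup z :=
  (norm_nonneg _).trans (Λ.le_sup (map_zero _) (by simp) z)

/-- If `u` runs through an even approximate unit, `Λ(c, zz')` is the limit of `Λ(cu, zz') = Λ(c, z)
Λ(u, z')`. -/
theorem sup_mul_le (z z' : AlgTensor A B) : Λ.sup (z * z') ≤ Λ.sup z * Λ.sup z' := by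
  refine Λ.sup_le fun c hc hc' => ?_
  obtain ⟨l, _, hn, he, h, -⟩ := exists_even_approximateUnit C
  refine le_of_tendsto (((Λ.continuous_left (z * z')).tendsto c).comp (h c)).norm ?_
  filter_upwards [hn, he] with u h1 h2
  rw [Function.comp_apply, ← Λ.mul_even _ _ _ _ hc]
  exact (norm_mul_le _ _).trans
    (mul_le_mul (Λ.le_sup hc hc' z) (Λ.le_sup h2 h1 z') (norm_nonneg _) (Λ.sup_nonneg z))

theorem sup_star_le (z : AlgTensor A B) : Λ.sup (star z) ≤ Λ.sup z := by
  refine Λ.sup_le fun c hc hc' => ?_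
  have hs : grading (star c) = star c := by rw [map_star, hc]
  have := Λ.star_even (star c) z hs
  rw [star_star] at this
  rw [← this, norm_star]
  exact Λ.le_sup hs (by rwa [norm_star]) z

/-- For an even contraction `c`, `‖Λ(c, z)‖² = ‖Λ(c*c, z*z)‖`, and `c*c` is again an even
contraction. Restricting the supremum to even `c` keeps the signs out. -/
theorem sup_star_mul_self (z : AlgTensor A B) : Λ.sup (star z * z) = Λ.sup z * Λ.sup z := by
  refine le_antisymm ((Λ.sup_mul_le _ _).trans
    (mul_le_mul_of_nonneg_right (Λ.sup_star_le z) (Λ.sup_nonneg z))) ?_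
  rw [← sq, ← Real.le_sqrt (Λ.sup_nonneg _) (Λ.sup_nonneg _)]
  refine Λ.sup_le fun c hc hc' => Real.le_sqrt_of_sq_le ?_
  have hs : grading (star c) = star c := by rw [map_star, hc]
  rw [sq, ← CStarRing.norm_star_mul_self, Λ.star_even _ _ hc, Λ.mul_even _ _ _ _ hs]
  refine Λ.le_sup (by rw [map_mul, hs, hc]) ?_ _
  rw [CStarRing.norm_star_mul_self]
  exact mul_le_one₀ hc' (norm_nonneg _) hc'

/-- The supremum is itself an admissible C*-seminorm, hence dominated by the maximal one. This gives
continuity in `z`, uniformly over even contractions `c`, and so allows the first factor to be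
completed. -/
theorem sup_le_norm (z : AlgTensor A B) : Λ.sup z ≤ ‖z‖ :=
  le_maxNorm (A := A) (B := B)
    { toFun := Λ.sup
      add_le := fun x y => Λ.sup_le fun c hc hc' => by
        rw [map_add]
        exact (norm_add_le _ _).trans (add_le_add (Λ.le_sup hc hc' x) (Λ.le_sup hc hc' y))
      smul_eq := fun r x => by
        rw [sup, sup, Real.mul_iSup_of_nonneg (norm_nonneg r)]
        simp only [map_smul, norm_smul]
      mul_le := Λ.sup_mul_le
      star_mul_self := Λ.sup_star_mul_self
      tmul_le := fun a b => Λ.sup_le fun c _ hc' => (Λ.norm_le c a b).trans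
        (mul_le_of_le_one_right (by positivity) hc') } z

theorem norm_apply_le_of_even {c : C} (hc : grading c = c) (z : AlgTensor A B) :
    ‖Λ.toFun c z‖ ≤ ‖c‖ * ‖z‖ := by
  rcases eq_or_ne c 0 with rfl | h0
  · simp
  · have hn : (0 : ℝ) < ‖c‖ := norm_pos_iff.2 h0
    have h := (Λ.le_sup (c := ((‖c‖⁻¹ : ℝ) : ℂ) • c) (by rw [map_smul, hc])
      (by rw [norm_smul]; simp [hn.ne']) z).trans (Λ.sup_le_norm z)
    rw [map_smul, LinearMap.smul_apply, norm_smul] at h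
    simp only [Complex.ofReal_inv, norm_inv, Complex.norm_real, norm_norm] at h
    rwa [inv_mul_le_iff₀ hn] at h

/-- For odd `c` the element `c*c` is even. The C*-identity therefore reduces to the even case, with
`z` replaced by its image under the contractive grading. -/
theorem norm_apply_le_of_odd {c : C} (hc : grading c = -c) (z : AlgTensor A B) :
    ‖Λ.toFun c z‖ ≤ ‖c‖ * ‖z‖ := by
  have hs : grading (star c) = -star c := by rw [map_star, hc, star_neg]
  refine le_of_sq_le_sq ?_ (by positivity)
  rw [sq, ← CStarRing.norm_star_mul_self, Λ.star_odd _ _ hc, Λ.mul_odd _ _ _ _ hs]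
  refine (Λ.norm_apply_le_of_even (by rw [map_mul, hs, hc, neg_mul_neg]) _).trans ?_
  rw [CStarRing.norm_star_mul_self, PreCStarAlgebra.norm_star_mul_self', mul_pow, ← sq, ← sq]
  gcongr
  exact AlgTensor.norm_gr_le z

/-- The factor `2` comes from splitting `c` into its even and odd parts. It does no harm, since
`MaxTensor.lift` accepts any constant. -/
theorem norm_apply_le (c : C) (z : AlgTensor A B) : ‖Λ.toFun c z‖ ≤ 2 * ‖c‖ * ‖z‖ := by
  have h1 := Λ.norm_apply_le_of_even (grading_evenPart c) z
  have h2 := Λ.norm_apply_le_of_odd (grading_oddPart c) z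
  rw [← evenPart_add_oddPart c, map_add, LinearMap.add_apply]
  refine (norm_add_le _ _).trans ((add_le_add h1 h2).trans ?_)
  rw [← add_mul, evenPart_add_oddPart]
  gcongr
  linarith [norm_evenPart_le c, norm_oddPart_le c]

/-- The extension of `Λ` in the first tensor factor to the completion. -/
def ext₁ (c : C) : MaxTensor A B →L[ℂ] E :=
  (Λ.toFun c).extendOfNorm (CStarCompletion.ofₗ (AlgTensor A B))

theorem ext₁_of (c : C) (z : AlgTensor A B) :
    Λ.ext₁ c (CStarCompletion.of z) = Λ.toFun c z :=
  LinearMap.extendOfNorm_eq (e := CStarCompletion.ofₗ (AlgTensor A B))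
    CStarCompletion.denseRange_of ⟨2 * ‖c‖, fun x =>
      (Λ.norm_apply_le c x).trans_eq (by rw [← CStarCompletion.norm_of x]; rfl)⟩ z

theorem norm_ext₁_le (c : C) (x : MaxTensor A B) : ‖Λ.ext₁ c x‖ ≤ 2 * ‖x‖ * ‖c‖ := by
  rw [mul_right_comm]
  exact LinearMap.norm_extendOfNorm_apply_le (e := CStarCompletion.ofₗ (AlgTensor A B))
    CStarCompletion.denseRange_of (2 * ‖c‖) (fun x =>
      (Λ.norm_apply_le c x).trans_eq (by rw [← CStarCompletion.norm_of x]; rfl)) x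

theorem ext₁_add (c c' : C) (x : MaxTensor A B) :
    Λ.ext₁ (c + c') x = Λ.ext₁ c x + Λ.ext₁ c' x := by
  induction x using CStarCompletion.ind with
  | hp => exact isClosed_eq (by fun_prop) (by fun_prop)
  | h x => rw [ext₁_of, ext₁_of, ext₁_of, map_add, LinearMap.add_apply]

theorem ext₁_smul (r : ℂ) (c : C) (x : MaxTensor A B) :
    Λ.ext₁ (r • c) x = r • Λ.ext₁ c x := by
  induction x using CStarCompletion.ind with
  | hp => exact isClosed_eq (by fun_prop) ((Λ.ext₁ c).continuous.const_smul r)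
  | h x => rw [ext₁_of, ext₁_of, map_smul, LinearMap.smul_apply]

theorem ext₁_mul_even {c : C} (hc : grading c = c) (c' : C) (x y : MaxTensor A B) :
    Λ.ext₁ c x * Λ.ext₁ c' y = Λ.ext₁ (c * c') (x * y) := by
  induction x, y using CStarCompletion.ind₂ with
  | hp => exact isClosed_eq (by fun_prop) (by fun_prop)
  | h x y => rw [← CStarCompletion.of_mul, ext₁_of, ext₁_of, ext₁_of, Λ.mul_even _ _ _ _ hc]

theorem ext₁_mul_odd {c : C} (hc : grading c = -c) (c' : C) (x y : MaxTensor A B) :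
    Λ.ext₁ c x * Λ.ext₁ c' y = Λ.ext₁ (c * c') (x * grading y) := by
  have := continuous_grading (MaxTensor A B)
  induction x, y using CStarCompletion.ind₂ with
  | hp => exact isClosed_eq (by fun_prop) (by fun_prop)
  | h x y => rw [MaxTensor.grading_of, ← CStarCompletion.of_mul, ext₁_of, ext₁_of, ext₁_of,
      Λ.mul_odd _ _ _ _ hc]

theorem star_ext₁_even {c : C} (hc : grading c = c) (x : MaxTensor A B) :
    star (Λ.ext₁ c x) = Λ.ext₁ (star c) (star x) := by
  induction x using CStarCompletion.ind with
  | hp => exact isClosed_eq (by fun_prop) (by fun_prop)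
  | h x => rw [← CStarCompletion.of_star, ext₁_of, ext₁_of, Λ.star_even _ _ hc]

theorem star_ext₁_odd {c : C} (hc : grading c = -c) (x : MaxTensor A B) :
    star (Λ.ext₁ c x) = Λ.ext₁ (star c) (star (grading x)) := by
  have := continuous_grading (MaxTensor A B)
  induction x using CStarCompletion.ind with
  | hp => exact isClosed_eq (by fun_prop) (by fun_prop)
  | h x => rw [MaxTensor.grading_of, ← CStarCompletion.of_star, ext₁_of, ext₁_of,
      Λ.star_odd _ _ hc]

/-- The linear map on the algebraic tensor product of `A ⊗̂ B` and `C` that is induced by `Λ`. -/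
def algLinear : AlgTensor (MaxTensor A B) C →ₗ[ℂ] E :=
  AlgTensor.lift (LinearMap.mk₂ ℂ (fun x c => Λ.ext₁ c x)
    (fun _ _ _ => map_add _ _ _) (fun _ _ _ => map_smul _ _ _)
    (fun x c c' => Λ.ext₁_add c c' x) (fun r x c => Λ.ext₁_smul r c x))

theorem algLinear_tmul (x : MaxTensor A B) (c : C) :
    Λ.algLinear (AlgTensor.tmul x c) = Λ.ext₁ c x := rfl

/-- The `*`-homomorphism on the algebraic tensor product of `A ⊗̂ B` and `C` that is induced by
`Λ`. -/
def algHom : AlgTensor (MaxTensor A B) C →⋆ₙₐ[ℂ] E :=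
  { Λ.algLinear with
    map_zero' := map_zero Λ.algLinear
    map_mul' := fun x y => by
      change Λ.algLinear (x * y) = Λ.algLinear x * Λ.algLinear y
      induction x using AlgTensor.hind with
      | zero => simp only [zero_mul, map_zero]
      | add x x' hx hx' => simp only [add_mul, map_add, hx, hx']
      | tmul a b _ hb =>
        induction y using AlgTensor.ind with
        | zero => simp only [mul_zero, map_zero]
        | add x x' hx hx' => simp only [mul_add, map_add, hx, hx']
        | tmul c d =>
          rcases hb with hb | hb
          · rw [AlgTensor.tmul_mul_tmul_of_even_left _ hb, algLinear_tmul, algLinear_tmul,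
              algLinear_tmul, Λ.ext₁_mul_even hb]
          · rw [AlgTensor.tmul_mul_tmul_of_odd_left _ hb, algLinear_tmul, algLinear_tmul,
              algLinear_tmul, Λ.ext₁_mul_odd hb]
    map_star' := fun x => by
      change Λ.algLinear (star x) = star (Λ.algLinear x)
      induction x using AlgTensor.hind with
      | zero => simp only [star_zero, map_zero]
      | add x x' hx hx' => simp only [star_add, map_add, hx, hx']
      | tmul a b _ hb =>
        rcases hb with hb | hb
        · rw [AlgTensor.star_tmul_of_even_right _ hb, algLinear_tmul, algLinear_tmul,
            Λ.star_ext₁_even hb]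
        · rw [AlgTensor.star_tmul_of_odd_right _ hb, algLinear_tmul, algLinear_tmul,
            Λ.star_ext₁_odd hb] }

/-- The `*`-homomorphism on `(A ⊗̂ B) ⊗̂ C` that is induced by `Λ`. -/
def lift : MaxTensor (MaxTensor A B) C →⋆ₙₐ[ℂ] E :=
  MaxTensor.lift Λ.algHom fun x c => Λ.norm_ext₁_le c x

theorem lift_tmul (a : A) (b : B) (c : C) :
    Λ.lift (tmul (tmul a b) c) = Λ.toFun c (AlgTensor.tmul a b) :=
  (MaxTensor.lift_tmul _ _ _ _).trans (Λ.ext₁_of _ _)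

end NestedHom

end Nested

/-! ### Elementary tensors, the graded flip and the associator. -/

section Assoc

variable {A B C E : Type*} [NonUnitalCStarAlgebra A] [GradedCStarAlgebra A]
  [NonUnitalCStarAlgebra B] [GradedCStarAlgebra B] [NonUnitalCStarAlgebra C]
  [GradedCStarAlgebra C]

/-- A continuous additive identity on the maximal tensor product may be checked on elementary
tensors of homogeneous elements. -/
theorem MaxTensor.eq_of_homogeneous_tmul {M : Type*} [AddCommMonoid M] [TopologicalSpace M]
    [T2Space M] {f g : MaxTensor A B → M} (hf : Continuous f) (hg : Continuous g)
    (hf0 : f 0 = 0) (hg0 : g 0 = 0)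
    (hfa : ∀ x y, f (x + y) = f x + f y) (hga : ∀ x y, g (x + y) = g x + g y)
    (h : ∀ a b, (grading a = a ∨ grading a = -a) → (grading b = b ∨ grading b = -b) →
      f (tmul a b) = g (tmul a b)) (x : MaxTensor A B) : f x = g x := by
  induction x using CStarCompletion.ind with
  | hp => exact isClosed_eq hf hg
  | h x =>
    induction x using AlgTensor.hind with
    | zero => rw [CStarCompletion.of_zero, hf0, hg0]
    | tmul a b ha hb => exact h a b ha hb
    | add x y hx hy => rw [CStarCompletion.of_add, hfa, hga, hx, hy]

theorem tmul_add (a : A) (b b' : B) : tmul a (b + b') = tmul a b + tmul a b' := by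
  rw [tmul, AlgTensor.tmul_add, CStarCompletion.of_add, tmul, tmul]

theorem add_tmul (a a' : A) (b : B) : tmul (a + a') b = tmul a b + tmul a' b := by
  rw [tmul, AlgTensor.add_tmul, CStarCompletion.of_add, tmul, tmul]

theorem smul_tmul (r : ℂ) (a : A) (b : B) : tmul (r • a) b = r • tmul a b := by
  rw [tmul, AlgTensor.smul_tmul, CStarCompletion.of_smul, tmul]

theorem tmul_smul (r : ℂ) (a : A) (b : B) : tmul a (r • b) = r • tmul a b := by
  rw [tmul, AlgTensor.tmul_smul, CStarCompletion.of_smul, tmul]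

/-- The elementary tensor as a bilinear map. -/
def tmulₗ : A →ₗ[ℂ] B →ₗ[ℂ] MaxTensor A B :=
  LinearMap.mk₂ ℂ tmul add_tmul smul_tmul tmul_add tmul_smul

/-- The elementary tensor as a continuous bilinear map. -/
def tmulL : A →L[ℂ] B →L[ℂ] MaxTensor A B :=
  LinearMap.mkContinuous₂ tmulₗ 1 fun a b => by rw [one_mul]; exact norm_tmul_le a b

theorem continuous_tmul : Continuous fun p : A × B => tmul p.1 p.2 := by
  change Continuous fun p : A × B => tmulL p.1 p.2
  fun_prop

theorem zero_tmul (b : B) : tmul (0 : A) b = 0 := by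
  rw [tmul, AlgTensor.zero_tmul, CStarCompletion.of_zero]

theorem tmul_neg (a : A) (b : B) : tmul a (-b) = -tmul a b := map_neg (tmulL a) b
theorem neg_tmul (a : A) (b : B) : tmul (-a) b = -tmul a b := by
  rw [← neg_one_smul ℂ a, smul_tmul, neg_one_smul]

theorem tmul_mul_tmul_of_even_left (a : A) {b : B} (hb : grading b = b) (c : A) (d : B) :
    tmul a b * tmul c d = tmul (a * c) (b * d) := by
  rw [tmul, tmul, tmul, ← CStarCompletion.of_mul, AlgTensor.tmul_mul_tmul_of_even_left _ hb]

theorem tmul_mul_tmul_of_odd_left (a : A) {b : B} (hb : grading b = -b) (c : A) (d : B) :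
    tmul a b * tmul c d = tmul (a * grading c) (b * d) := by
  rw [tmul, tmul, tmul, ← CStarCompletion.of_mul, AlgTensor.tmul_mul_tmul_of_odd_left _ hb]

theorem star_tmul_of_even_right (a : A) {b : B} (hb : grading b = b) :
    star (tmul a b) = tmul (star a) (star b) := by
  rw [tmul, tmul, ← CStarCompletion.of_star, AlgTensor.star_tmul_of_even_right _ hb]

theorem star_tmul_of_odd_right (a : A) {b : B} (hb : grading b = -b) :
    star (tmul a b) = tmul (star (grading a)) (star b) := by
  rw [tmul, tmul, ← CStarCompletion.of_star, AlgTensor.star_tmul_of_odd_right _ hb]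

/-! #### The flip -/

/-- The graded flip as a linear map. -/
def AlgTensor.flipL : AlgTensor A B →ₗ[ℂ] AlgTensor B A :=
  AlgTensor.lift (LinearMap.mk₂ ℂ
    (fun a b => AlgTensor.tmul (evenPart b) a + AlgTensor.tmul (oddPart b) (grading a))
    (fun a a' b => by simp only [map_add, AlgTensor.tmul_add]; abel)
    (fun r a b => by simp only [map_smul, AlgTensor.tmul_smul, smul_add])
    (fun a b b' => by simp only [map_add, AlgTensor.add_tmul]; abel)
    (fun r a b => by simp only [map_smul, AlgTensor.smul_tmul, smul_add]))

theorem AlgTensor.flipL_tmul (a : A) (b : B) : AlgTensor.flipL (AlgTensor.tmul a b) =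
    AlgTensor.tmul (evenPart b) a + AlgTensor.tmul (oddPart b) (grading a) := rfl

theorem AlgTensor.flipL_of_even (a : A) {b : B} (hb : grading b = b) :
    AlgTensor.flipL (AlgTensor.tmul a b) = AlgTensor.tmul b a := by
  rw [flipL_tmul, evenPart_eq hb, oddPart_eq_zero hb, AlgTensor.zero_tmul, add_zero]

theorem AlgTensor.flipL_of_odd (a : A) {b : B} (hb : grading b = -b) :
    AlgTensor.flipL (AlgTensor.tmul a b) = AlgTensor.tmul b (grading a) := by
  rw [flipL_tmul, evenPart_eq_zero hb, oddPart_eq hb, AlgTensor.zero_tmul, zero_add]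

/-- The graded flip on the algebraic tensor product. -/
def AlgTensor.flip : AlgTensor A B →⋆ₙₐ[ℂ] AlgTensor B A :=
  { AlgTensor.flipL with
    map_zero' := map_zero AlgTensor.flipL
    map_mul' := fun x y => by
      change flipL (x * y) = flipL x * flipL y
      induction x using AlgTensor.hind with
      | zero => simp only [zero_mul, map_zero]
      | add x x' hx hx' => simp only [add_mul, map_add, hx, hx']
      | tmul a b ha hb =>
        induction y using AlgTensor.hind with
        | zero => simp only [mul_zero, map_zero]
        | add x x' hx hx' => simp only [mul_add, map_add, hx, hx']
        | tmul c d hc hd =>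
          rcases hb with hb | hb <;> rcases hd with hd | hd
          · rw [tmul_mul_tmul_of_even_left _ hb, flipL_of_even _ hb, flipL_of_even _ hd,
              flipL_of_even _ (grading_mul_even_even hb hd), tmul_mul_tmul_of_even_right _ _ hd]
          · rw [tmul_mul_tmul_of_even_left _ hb, flipL_of_even _ hb, flipL_of_odd _ hd,
              flipL_of_odd _ (grading_mul_even_odd hb hd), tmul_mul_tmul_of_odd_right _ _ hd,
              map_mul]
          · rw [tmul_mul_tmul_of_odd_left _ hb, flipL_of_odd _ hb, flipL_of_even _ hd,
              flipL_of_odd _ (grading_mul_odd_even hb hd), tmul_mul_tmul_of_even_right _ _ hd,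
              map_mul, grading_grading]
          · rw [tmul_mul_tmul_of_odd_left _ hb, flipL_of_odd _ hb, flipL_of_odd _ hd,
              flipL_of_even _ (grading_mul_odd_odd hb hd), tmul_mul_tmul_of_odd_right _ _ hd,
              grading_grading]
    map_star' := fun x => by
      change flipL (star x) = star (flipL x)
      induction x using AlgTensor.hind with
      | zero => simp only [star_zero, map_zero]
      | add x x' hx hx' => simp only [star_add, map_add, hx, hx']
      | tmul a b ha hb =>
        rcases hb with hb | hb
        · rw [star_tmul_of_even_right _ hb, flipL_of_even _ hb, star_tmul_of_even_left hb,
            flipL_of_even _ (grading_star_even hb)]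
        · rw [star_tmul_of_odd_right _ hb, flipL_of_odd _ hb, star_tmul_of_odd_left hb,
            flipL_of_odd _ (grading_star_odd hb), map_star] }

/-- A pre-C*-algebra maps to its completion by a `*`-homomorphism. -/
def CStarCompletion.ofHom (R : Type*) [PreCStarAlgebra R] : R →⋆ₙₐ[ℂ] CStarCompletion R where
  toFun := CStarCompletion.of
  map_smul' := CStarCompletion.of_smul
  map_zero' := CStarCompletion.of_zero
  map_add' := CStarCompletion.of_add
  map_mul' := CStarCompletion.of_mul
  map_star' := CStarCompletion.of_star

variable (A B) in
/-- The graded flip `A ⊗̂ B → B ⊗̂ A`. -/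
def MaxTensor.flip : MaxTensor A B →⋆ₙₐ[ℂ] MaxTensor B A :=
  -- The flip has one summand for the even and one for the odd part of `b`; hence the constant `2`.
  MaxTensor.lift (K := 2) ((CStarCompletion.ofHom (AlgTensor B A)).comp AlgTensor.flip)
    fun a b => by
      change ‖CStarCompletion.of (AlgTensor.flipL (AlgTensor.tmul a b))‖ ≤ _
      rw [AlgTensor.flipL_tmul, CStarCompletion.of_add]
      have h1 := norm_tmul_le (evenPart b) a
      have h2 := norm_tmul_le (oddPart b) (grading a)
      have h3 := NonUnitalStarAlgHom.norm_apply_le (grading : A →⋆ₙₐ[ℂ] A) a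
      calc _ ≤ ‖evenPart b‖ * ‖a‖ + ‖oddPart b‖ * ‖grading a‖ :=
            (norm_add_le _ _).trans (add_le_add h1 h2)
        _ ≤ ‖b‖ * ‖a‖ + ‖b‖ * ‖a‖ := by
            gcongr
            · exact norm_evenPart_le b
            · exact norm_oddPart_le b
        _ = 2 * ‖a‖ * ‖b‖ := by ring

theorem MaxTensor.flip_of_even_right (a : A) {b : B} (hb : grading b = b) :
    MaxTensor.flip A B (tmul a b) = tmul b a :=
  (MaxTensor.lift_tmul _ _ _ _).trans (congrArg CStarCompletion.of (AlgTensor.flipL_of_even a hb))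

theorem MaxTensor.flip_of_odd_right (a : A) {b : B} (hb : grading b = -b) :
    MaxTensor.flip A B (tmul a b) = tmul b (grading a) :=
  (MaxTensor.lift_tmul _ _ _ _).trans (congrArg CStarCompletion.of (AlgTensor.flipL_of_odd a hb))

/-! #### The associator -/

variable (A B C) in
/-- The bilinear map that induces the associator. -/
def assocNested : NestedHom A B C (MaxTensor A (MaxTensor B C)) :=
  let T : C →ₗ[ℂ] AlgTensor A B →ₗ[ℂ] MaxTensor A (MaxTensor B C) := LinearMap.mk₂ ℂ
    (fun c z => AlgTensor.lift (LinearMap.mk₂ ℂ (fun a b => tmul a (tmul b c))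
      (fun a a' b => add_tmul _ _ _) (fun r a b => smul_tmul _ _ _)
      (fun a b b' => by rw [add_tmul, tmul_add])
      (fun r a b => by rw [smul_tmul, tmul_smul])) z)
    (fun c c' z => by
      rw [← LinearMap.add_apply]
      congr 1
      exact AlgTensor.ext fun a b => by
        simp only [AlgTensor.lift_tmul, LinearMap.add_apply, LinearMap.mk₂_apply, tmul_add])
    (fun r c z => by
      rw [← LinearMap.smul_apply]
      congr 1
      exact AlgTensor.ext fun a b => by
        simp only [AlgTensor.lift_tmul, LinearMap.smul_apply, LinearMap.mk₂_apply, tmul_smul])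
    (fun c z z' => map_add _ _ _) (fun r c z => map_smul _ _ _)
  have hT : ∀ c a b, T c (AlgTensor.tmul a b) = tmul a (tmul b c) := fun _ _ _ => rfl
  -- The map carries no sign of its own. The case distinctions arise because `b ⊗ c` has parity `∂b
  -- + ∂c`, which decides the sign rule for the outer tensor product.
  { toFun := T
    mul_even := fun c c' z z' hc => by
      induction z using AlgTensor.hind with
      | zero => simp only [zero_mul, map_zero]
      | add x x' hx hx' => simp only [add_mul, map_add, hx, hx']
      | tmul a b _ hb =>
        induction z' using AlgTensor.ind with
        | zero => simp only [mul_zero, map_zero]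
        | add x x' hx hx' => simp only [mul_add, map_add, hx, hx']
        | tmul a' b' =>
          rcases hb with hb | hb
          · rw [hT, hT, AlgTensor.tmul_mul_tmul_of_even_left _ hb, hT,
              tmul_mul_tmul_of_even_left _ (by rw [MaxTensor.grading_tmul, hb, hc]),
              tmul_mul_tmul_of_even_left _ hc]
          · rw [hT, hT, AlgTensor.tmul_mul_tmul_of_odd_left _ hb, hT,
              tmul_mul_tmul_of_odd_left _ (by rw [MaxTensor.grading_tmul, hb, hc, neg_tmul]),
              tmul_mul_tmul_of_even_left _ hc]
    mul_odd := fun c c' z z' hc => by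
      induction z using AlgTensor.hind with
      | zero => simp only [zero_mul, map_zero]
      | add x x' hx hx' => simp only [add_mul, map_add, hx, hx']
      | tmul a b _ hb =>
        induction z' using AlgTensor.ind with
        | zero => simp only [mul_zero, map_zero]
        | add x x' hx hx' => simp only [mul_add, map_add, hx, hx']
        | tmul a' b' =>
          rw [AlgTensor.gr_tmul]
          rcases hb with hb | hb
          · rw [hT, hT, AlgTensor.tmul_mul_tmul_of_even_left _ hb, hT,
              tmul_mul_tmul_of_odd_left _ (by rw [MaxTensor.grading_tmul, hb, hc, tmul_neg]),
              tmul_mul_tmul_of_odd_left _ hc]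
          · rw [hT, hT, AlgTensor.tmul_mul_tmul_of_odd_left _ hb, hT, grading_grading,
              tmul_mul_tmul_of_even_left _
                (by rw [MaxTensor.grading_tmul, hb, hc, neg_tmul, tmul_neg, neg_neg]),
              tmul_mul_tmul_of_odd_left _ hc]
    star_even := fun c z hc => by
      induction z using AlgTensor.hind with
      | zero => simp only [star_zero, map_zero]
      | add x x' hx hx' => simp only [star_add, map_add, hx, hx']
      | tmul a b _ hb =>
        rcases hb with hb | hb
        · rw [hT, AlgTensor.star_tmul_of_even_right _ hb, hT,
            star_tmul_of_even_right _ (by rw [MaxTensor.grading_tmul, hb, hc]),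
            star_tmul_of_even_right _ hc]
        · rw [hT, AlgTensor.star_tmul_of_odd_right _ hb, hT,
            star_tmul_of_odd_right _ (by rw [MaxTensor.grading_tmul, hb, hc, neg_tmul]),
            star_tmul_of_even_right _ hc]
    star_odd := fun c z hc => by
      induction z using AlgTensor.hind with
      | zero => simp only [star_zero, map_zero]
      | add x x' hx hx' => simp only [star_add, map_add, hx, hx']
      | tmul a b _ hb =>
        rw [AlgTensor.gr_tmul]
        rcases hb with hb | hb
        · rw [hT, AlgTensor.star_tmul_of_even_right _ (by rw [hb, hb]), hT,
            star_tmul_of_odd_right _ (by rw [MaxTensor.grading_tmul, hb, hc, tmul_neg]),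
            star_tmul_of_odd_right _ hc]
        · rw [hT, AlgTensor.star_tmul_of_odd_right _ (by rw [hb, map_neg, hb]), hT,
            star_tmul_of_even_right _
              (by rw [MaxTensor.grading_tmul, hb, hc, neg_tmul, tmul_neg, neg_neg]),
            star_tmul_of_odd_right _ hc, grading_grading]
    norm_le := fun c a b => by
      rw [hT, mul_assoc]
      exact (norm_tmul_le _ _).trans
        (mul_le_mul_of_nonneg_left (norm_tmul_le b c) (norm_nonneg a)) }

variable (A B C) in
/-- The associator `(A ⊗̂ B) ⊗̂ C → A ⊗̂ (B ⊗̂ C)`. -/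
def MaxTensor.assoc : MaxTensor (MaxTensor A B) C →⋆ₙₐ[ℂ] MaxTensor A (MaxTensor B C) :=
  (assocNested A B C).lift

theorem MaxTensor.assoc_tmul (a : A) (b : B) (c : C) :
    MaxTensor.assoc A B C (tmul (tmul a b) c) = tmul a (tmul b c) :=
  NestedHom.lift_tmul _ a b c

end Assoc

/-! ### Graded and Real versions of the flip and the associator, and the inverse associator. -/

section Graded

variable {t : Flavor} {A B C D : Type*}
  [NonUnitalCStarAlgebra A] [GradedCStarAlgebra A] [RealStructure t A]
  [NonUnitalCStarAlgebra B] [GradedCStarAlgebra B] [RealStructure t B]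
  [NonUnitalCStarAlgebra C] [GradedCStarAlgebra C] [RealStructure t C]
  [NonUnitalCStarAlgebra D] [GradedCStarAlgebra D] [RealStructure t D]

theorem continuous_bar (ht : t = .real) : Continuous (bar ht : A → A) :=
  (AddMonoidHomClass.isometry_of_norm (barAddHom ht A) (norm_bar ht)).continuous

theorem bar_tmul (ht : t = .real) (a : A) (b : B) :
    bar ht (tmul a b) = tmul (bar ht a) (bar ht b) := MaxTensor.bar_tmul ht a b

theorem continuous_starHom {A B : Type*} [NonUnitalCStarAlgebra A] [NonUnitalCStarAlgebra B]
    (F : A →⋆ₙₐ[ℂ] B) : Continuous F :=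
  (AddMonoidHomClass.lipschitz_of_bound F 1
    (by simpa using NonUnitalStarAlgHom.norm_apply_le F)).continuous

theorem bar_neg (ht : t = .real) (a : A) : bar ht (-a) = -bar ht a := (barAddHom ht A).map_neg a

theorem GradedHom.ext {φ ψ : GradedHom t A B} (h : ∀ a, φ a = ψ a) : φ = ψ := DFunLike.ext _ _ h

/-- Homomorphisms on a maximal tensor product agree if they agree on elementary tensors. -/
theorem GradedHom.ext_tmul {φ ψ : GradedHom t (MaxTensor A B) D}
    (h : ∀ a b, φ (tmul a b) = ψ (tmul a b)) : φ = ψ :=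
  GradedHom.ext fun x => MaxTensor.eq_of_tmul φ.continuous ψ.continuous (map_zero φ) (map_zero ψ)
    (map_add φ) (map_add ψ) h x

/-- A `*`-homomorphism on a maximal tensor product is graded (and Real) if it is so on elementary
tensors of homogeneous elements. -/
def GradedHom.ofTmul (F : MaxTensor A B →⋆ₙₐ[ℂ] D)
    (hg : ∀ a b, (grading a = a ∨ grading a = -a) → (grading b = b ∨ grading b = -b) →
      F (tmul (grading a) (grading b)) = grading (F (tmul a b)))
    (hb : ∀ (h : t = .real) a b, (grading a = a ∨ grading a = -a) →
      (grading b = b ∨ grading b = -b) → F (tmul (bar h a) (bar h b)) = bar h (F (tmul a b))) :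
    GradedHom t (MaxTensor A B) D where
  toNonUnitalStarAlgHom := F
  map_grading x := by
    have h1 := continuous_grading (MaxTensor A B)
    have h2 := continuous_grading D
    have hF := continuous_starHom F
    refine MaxTensor.eq_of_homogeneous_tmul (f := fun x => F (grading x))
      (g := fun x => grading (F x)) (hF.comp h1) (h2.comp hF) (by simp) (by simp) (by simp)
      (by simp) (fun a b ha hb => ?_) x
    rw [MaxTensor.grading_tmul]
    exact hg a b ha hb
  map_bar h x := by
    have h1 : Continuous (bar h : MaxTensor A B → MaxTensor A B) := continuous_bar h
    have h2 : Continuous (bar h : D → D) := continuous_bar h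
    have hF := continuous_starHom F
    refine MaxTensor.eq_of_homogeneous_tmul (f := fun x => F (bar h x))
      (g := fun x => bar h (F x)) (hF.comp h1) (h2.comp hF) (by simp [bar_zero])
      (by simp [bar_zero]) (by simp [bar_add]) (by simp [bar_add]) (fun a b ha hb' => ?_) x
    rw [bar_tmul]
    exact hb h a b ha hb'

variable (t A B) in
/-- The graded flip. -/
def GradedHom.flip : GradedHom t (MaxTensor A B) (MaxTensor B A) :=
  GradedHom.ofTmul (MaxTensor.flip A B)
    (fun a b _ hb => by
      rcases hb with hb | hb
      · rw [MaxTensor.flip_of_even_right _ (by rw [hb, hb]), MaxTensor.flip_of_even_right _ hb,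
          MaxTensor.grading_tmul]
      · rw [MaxTensor.flip_of_odd_right _ (by rw [hb, map_neg, hb]),
          MaxTensor.flip_of_odd_right _ hb, MaxTensor.grading_tmul])
    (fun h a b _ hb => by
      rcases hb with hb | hb
      · rw [MaxTensor.flip_of_even_right _ (by rw [← bar_grading, hb]),
          MaxTensor.flip_of_even_right _ hb, bar_tmul]
      · rw [MaxTensor.flip_of_odd_right _ (by rw [← bar_grading, hb, bar_neg]),
          MaxTensor.flip_of_odd_right _ hb, bar_tmul, bar_grading])

theorem GradedHom.flip_of_even_right (a : A) {b : B} (hb : grading b = b) :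
    GradedHom.flip t A B (tmul a b) = tmul b a := MaxTensor.flip_of_even_right a hb

theorem GradedHom.flip_of_odd_right (a : A) {b : B} (hb : grading b = -b) :
    GradedHom.flip t A B (tmul a b) = tmul b (grading a) := MaxTensor.flip_of_odd_right a hb

variable (t A B C) in
/-- The associator. -/
def GradedHom.assoc :
    GradedHom t (MaxTensor (MaxTensor A B) C) (MaxTensor A (MaxTensor B C)) :=
  have hc : ∀ c : C, Continuous fun x : MaxTensor A B => tmul x c := fun c =>
    continuous_tmul.comp (continuous_id.prodMk continuous_const)
  have hF := continuous_starHom (MaxTensor.assoc A B C)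
  GradedHom.ofTmul (MaxTensor.assoc A B C)
    (fun x c _ _ => by
      have h1 := continuous_grading (MaxTensor A B)
      have h2 := continuous_grading (MaxTensor A (MaxTensor B C))
      refine MaxTensor.eq_of_tmul
        (f := fun x => MaxTensor.assoc A B C (tmul (grading x) (grading c)))
        (g := fun x => grading (MaxTensor.assoc A B C (tmul x c)))
        (hF.comp ((hc _).comp h1)) (h2.comp (hF.comp (hc c))) (by simp [zero_tmul])
        (by simp [zero_tmul]) (by simp [add_tmul]) (by simp [add_tmul]) (fun a b => ?_) x
      rw [MaxTensor.grading_tmul, MaxTensor.assoc_tmul, MaxTensor.assoc_tmul,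
        MaxTensor.grading_tmul, MaxTensor.grading_tmul])
    (fun h x c _ _ => by
      have h1 : Continuous (bar h : MaxTensor A B → MaxTensor A B) := continuous_bar h
      have h2 : Continuous (bar h : MaxTensor A (MaxTensor B C) → MaxTensor A (MaxTensor B C)) :=
        continuous_bar h
      refine MaxTensor.eq_of_tmul
        (f := fun x => MaxTensor.assoc A B C (tmul (bar h x) (bar h c)))
        (g := fun x => bar h (MaxTensor.assoc A B C (tmul x c)))
        (hF.comp ((hc _).comp h1)) (h2.comp (hF.comp (hc c))) (by simp [zero_tmul, bar_zero])
        (by simp [zero_tmul, bar_zero]) (by simp [add_tmul, bar_add])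
        (by simp [add_tmul, bar_add]) (fun a b => ?_) x
      rw [bar_tmul, MaxTensor.assoc_tmul, MaxTensor.assoc_tmul,
        bar_tmul, bar_tmul])

theorem GradedHom.assoc_tmul (a : A) (b : B) (c : C) :
    GradedHom.assoc t A B C (tmul (tmul a b) c) = tmul a (tmul b c) :=
  MaxTensor.assoc_tmul a b c

variable (t A B C) in
/-- The inverse of the associator. -/
def GradedHom.assocSymm :
    GradedHom t (MaxTensor A (MaxTensor B C)) (MaxTensor (MaxTensor A B) C) :=
  -- Up to signs: `a ⊗ (b ⊗ c) ↦ (b ⊗ c) ⊗ a ↦ (c ⊗ b) ⊗ a ↦ c ⊗ (b ⊗ a) ↦ c ⊗ (a ⊗ b) ↦ (a ⊗ b) ⊗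
  -- c`. Flips reduce the inverse to the associator in the order `C, B, A`, so the norm estimates
  -- need not be repeated.
  (GradedHom.flip t C (MaxTensor A B)).comp <|
    ((GradedHom.id C t).tensor (GradedHom.flip t B A)).comp <|
      (GradedHom.assoc t C B A).comp <|
        ((GradedHom.flip t B C).tensor (GradedHom.id A t)).comp <|
          GradedHom.flip t A (MaxTensor B C)

theorem GradedHom.id_apply (a : A) : GradedHom.id A t a = a := rfl

/-- Each of the three pairs of factors is interchanged exactly twice, so all Koszul signs cancel;
the proof runs through the eight parity patterns. -/
theorem GradedHom.assocSymm_of_homogeneous {a : A} {b : B} {c : C}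
    (ha : grading a = a ∨ grading a = -a) (hb : grading b = b ∨ grading b = -b)
    (hc : grading c = c ∨ grading c = -c) :
    GradedHom.assocSymm t A B C (tmul a (tmul b c)) = tmul (tmul a b) c := by
  simp only [assocSymm, comp_apply]
  rcases ha with ha | ha <;> rcases hb with hb | hb <;> rcases hc with hc | hc <;>
  [rw [flip_of_even_right a (b := tmul b c) (by rw [MaxTensor.grading_tmul, hb, hc])];
   rw [flip_of_odd_right a (b := tmul b c) (by rw [MaxTensor.grading_tmul, hb, hc, tmul_neg])];
   rw [flip_of_odd_right a (b := tmul b c) (by rw [MaxTensor.grading_tmul, hb, hc, neg_tmul])];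
   rw [flip_of_even_right a (b := tmul b c)
    (by rw [MaxTensor.grading_tmul, hb, hc, neg_tmul, tmul_neg, neg_neg])];
   rw [flip_of_even_right a (b := tmul b c) (by rw [MaxTensor.grading_tmul, hb, hc])];
   rw [flip_of_odd_right a (b := tmul b c) (by rw [MaxTensor.grading_tmul, hb, hc, tmul_neg])];
   rw [flip_of_odd_right a (b := tmul b c) (by rw [MaxTensor.grading_tmul, hb, hc, neg_tmul])];
   rw [flip_of_even_right a (b := tmul b c)
    (by rw [MaxTensor.grading_tmul, hb, hc, neg_tmul, tmul_neg, neg_neg])]] <;>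
  rw [tensor_tmul] <;>
  (first | rw [flip_of_even_right _ hc] | rw [flip_of_odd_right _ hc]) <;>
  rw [id_apply, assoc_tmul, tensor_tmul, id_apply] <;>
  try simp only [ha, hb, tmul_neg, neg_tmul, map_neg]
  all_goals first | rw [flip_of_even_right _ ha] | rw [flip_of_odd_right _ ha]
  all_goals try simp only [ha, hb, tmul_neg, neg_tmul, map_neg, neg_neg]
  all_goals first
    | (rw [flip_of_even_right c (b := tmul a b)] <;>
        simp only [MaxTensor.grading_tmul, ha, hb, hc, tmul_neg, neg_tmul, neg_neg]; done)
    | (rw [flip_of_odd_right c (b := tmul a b)] <;>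
        simp only [MaxTensor.grading_tmul, ha, hb, hc, tmul_neg, neg_tmul, neg_neg]; done)

/-- Only this order of composition is needed: the homotopy argument uses a left inverse of
`TensorIso.absorb`. -/
theorem GradedHom.assocSymm_assoc (x : MaxTensor (MaxTensor A B) C) :
    GradedHom.assocSymm t A B C (GradedHom.assoc t A B C x) = x := by
  have hs := (GradedHom.assocSymm t A B C).continuous
  have ha := (GradedHom.assoc t A B C).continuous
  refine MaxTensor.eq_of_homogeneous_tmul
    (f := fun x => GradedHom.assocSymm t A B C (GradedHom.assoc t A B C x)) (g := fun x => x)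
    (hs.comp ha) continuous_id (by simp) rfl (by simp) (fun _ _ => rfl) (fun y c _ hc => ?_) x
  have hm : Continuous fun y : MaxTensor A B => tmul y c :=
    continuous_tmul.comp (continuous_id.prodMk continuous_const)
  refine MaxTensor.eq_of_homogeneous_tmul
    (f := fun y => GradedHom.assocSymm t A B C (GradedHom.assoc t A B C (tmul y c)))
    (g := fun y => tmul y c)
    (hs.comp (ha.comp hm)) hm (by simp [zero_tmul]) (zero_tmul c) (by simp [add_tmul])
    (fun _ _ => add_tmul _ _ _) (fun a b h1 h2 => ?_) y
  rw [GradedHom.assoc_tmul, GradedHom.assocSymm_of_homogeneous h1 h2 hc]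

end Graded

open GradedHilbertSpace RealHilbertStructure

/-! ### Rank one operators -/

section RankOne

open ContinuousLinearMap

variable {H H' : Type*} [NormedAddCommGroup H] [InnerProductSpace ℂ H] [CompleteSpace H]
  [NormedAddCommGroup H'] [InnerProductSpace ℂ H'] [CompleteSpace H']

/-- The rank one operator `z ↦ ⟨y, z⟩ x` as a compact operator. -/
def ro (x y : H) : CompactOp H :=
  ⟨InnerProductSpace.rankOne ℂ x y,
    (isCompactOperator_of_locallyCompactSpace_rng (ContinuousLinearMap.toSpanSingleton ℂ x)).comp_clm
      (innerSL ℂ y)⟩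

theorem ro_apply (x y z : H) : (ro x y).1 z = ⟪y, z⟫_ℂ • x := rfl

theorem ro_add_left (x x' y : H) : ro (x + x') y = ro x y + ro x' y := by
  ext z; simp [ro_apply]

theorem ro_add_right (x y y' : H) : ro x (y + y') = ro x y + ro x y' := by
  ext z; simp [ro_apply, inner_add_left, add_smul]

theorem ro_smul_left (c : ℂ) (x y : H) : ro (c • x) y = c • ro x y := by
  ext z; simp [ro_apply, smul_smul, mul_comm]

theorem ro_smul_right (c : ℂ) (x y : H) : ro x (c • y) = star c • ro x y := by
  ext z; simp [ro_apply, inner_smul_left, smul_smul, mul_comm]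

theorem ro_neg_left (x y : H) : ro (-x) y = -ro x y := by
  ext z; simp [ro_apply]

theorem ro_neg_right (x y : H) : ro x (-y) = -ro x y := by
  ext z; simp [ro_apply]

theorem mul_ro (T : CompactOp H) (x y : H) : T * ro x y = ro (T.1 x) y := by
  ext z
  change T.1 (⟪y, z⟫_ℂ • x) = ⟪y, z⟫_ℂ • T.1 x
  rw [map_smul]

theorem ro_mul_ro (x y z w : H) : ro x y * ro z w = ⟪y, z⟫_ℂ • ro x w := by
  rw [mul_ro, ro_apply, ro_smul_left]

theorem norm_ro (x y : H) : ‖ro x y‖ = ‖x‖ * ‖y‖ := InnerProductSpace.norm_rankOne x y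

theorem continuous_ro : Continuous fun p : H × H => ro p.1 p.2 := by
  refine continuous_iff_continuousAt.2 fun ⟨x, y⟩ => tendsto_iff_norm_sub_tendsto_zero.2 ?_
  refine squeeze_zero (g := fun p : H × H => ‖p.1 - x‖ * ‖p.2‖ + ‖x‖ * ‖p.2 - y‖)
    (fun _ => norm_nonneg _) (fun p => ?_) ?_
  · have h : ro p.1 p.2 - ro x y = ro (p.1 - x) p.2 + ro x (p.2 - y) := by
      rw [sub_eq_add_neg p.1, sub_eq_add_neg p.2, ro_add_left, ro_add_right, ro_neg_left,
        ro_neg_right]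
      abel
    rw [h]
    refine (norm_add_le _ _).trans_eq ?_
    rw [norm_ro, norm_ro]
  · have h : Continuous fun p : H × H => ‖p.1 - x‖ * ‖p.2‖ + ‖x‖ * ‖p.2 - y‖ := by fun_prop
    simpa using h.tendsto (x, y)

theorem Ad_ro (V : H →L[ℂ] H') (hV : adjoint V ∘L V = 1) (x y : H) :
    Ad V hV (ro x y) = ro (V x) (V y) := by
  ext z
  rw [Ad_apply, ro_apply, ro_apply, map_smul, adjoint_inner_right]

/-- Sesquilinearity extends membership from `S` to its span, one variable at a time, and joint
continuity extends it to the closure. -/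
theorem ro_mem_of_dense (M : Submodule ℂ (CompactOp H)) (hM : IsClosed (M : Set (CompactOp H)))
    {S : Set H} (hS : Dense (Submodule.span ℂ S : Set H)) (h : ∀ x ∈ S, ∀ y ∈ S, ro x y ∈ M)
    (x y : H) : ro x y ∈ M := by
  have h1 : ∀ x ∈ Submodule.span ℂ S, ∀ y ∈ S, ro x y ∈ M := fun x hx y hy => by
    induction hx using Submodule.span_induction with
    | mem x hx => exact h x hx y hy
    | zero =>
      have : ro 0 y = 0 := by ext z; simp [ro_apply]
      rw [this]; exact M.zero_mem
    | add x x' _ _ hx hx' => rw [ro_add_left]; exact M.add_mem hx hx'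
    | smul c x _ hx => rw [ro_smul_left]; exact M.smul_mem _ hx
  have h2 : ∀ x ∈ Submodule.span ℂ S, ∀ y ∈ Submodule.span ℂ S, ro x y ∈ M := fun x hx y hy => by
    induction hy using Submodule.span_induction with
    | mem y hy => exact h1 x hx y hy
    | zero =>
      have : ro x 0 = 0 := by ext z; simp [ro_apply]
      rw [this]; exact M.zero_mem
    | add x x' _ _ hx hx' => rw [ro_add_right]; exact M.add_mem hx hx'
    | smul c x _ hx => rw [ro_smul_right]; exact M.smul_mem _ hx
  have h3 : IsClosed {p : H × H | ro p.1 p.2 ∈ M} := hM.preimage continuous_ro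
  have h4 := h3.closure_subset_iff.2 (fun p hp => h2 p.1 hp.1 p.2 hp.2 :
    (Submodule.span ℂ S : Set H) ×ˢ (Submodule.span ℂ S : Set H) ⊆ _)
  exact h4 (hS.prod hS (x, y))

/-- A closed subspace of `𝒦(H)` that contains sufficiently many operators of rank one is all of
`𝒦(H)`. -/
theorem mem_of_dense (M : Submodule ℂ (CompactOp H)) (hM : IsClosed (M : Set (CompactOp H)))
    {S : Set H} (hS : Dense (Submodule.span ℂ S : Set H)) (h : ∀ x ∈ S, ∀ y ∈ S, ro x y ∈ M)
    (T : CompactOp H) : T ∈ M := by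
  have hro := ro_mem_of_dense M hM hS h
  rw [← SetLike.mem_coe, ← hM.closure_eq, Metric.mem_closure_iff]
  intro ε hε
  have htb : TotallyBounded (T.1 '' Metric.closedBall 0 1) :=
    (IsCompactOperator.isCompact_closure_image_closedBall (𝕜₁ := ℂ)
      (f := ((T.1 : H →L[ℂ] H) : H →ₗ[ℂ] H)) T.2 1).totallyBounded.subset subset_closure
  obtain ⟨s, hs, hcov⟩ := Metric.totallyBounded_iff.1 htb (ε / 2) (by positivity)
  -- The finitely many points of `s` form an `ε/2`-net of the image of the unit ball, so the
  -- projection onto their span moves each `T x` with `‖x‖ = 1` by at most `ε/2`. That projection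
  -- composed with `T` is a finite sum of rank one operators.
  let F := Submodule.span ℂ s
  have : FiniteDimensional ℂ F := FiniteDimensional.span_of_finite ℂ hs
  let b := stdOrthonormalBasis ℂ F
  have hP : F.starProjection ∘L T.1 = ∑ i, (ro (b i : H) (adjoint T.1 (b i))).1 := by
    rw [b.starProjection_eq_sum_rankOne]
    ext z
    simp [ro_apply, adjoint_inner_left]
  refine ⟨∑ i, ro (b i : H) (adjoint T.1 (b i)), M.sum_mem fun i _ => hro _ _, ?_⟩
  have hP' : (∑ i, ro (b i : H) (adjoint T.1 (b i))).1 = F.starProjection ∘L T.1 := by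
    rw [hP]
    exact map_sum (compactOps H).subtype _ _
  rw [dist_eq_norm]
  refine lt_of_le_of_lt (b := ε / 2) ?_ (by linarith)
  change ‖(T - ∑ i, ro (b i : H) (adjoint T.1 (b i))).1‖ ≤ _
  change ‖T.1 - (∑ i, ro (b i : H) (adjoint T.1 (b i))).1‖ ≤ _
  rw [hP']
  refine ContinuousLinearMap.opNorm_le_of_unit_norm (by positivity) fun x hx => ?_
  obtain ⟨y, hy, hxy⟩ := Set.mem_iUnion₂.1 (hcov ⟨x, by simp [hx], rfl⟩)
  rw [mem_ball_iff_norm] at hxy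
  refine le_trans ?_ hxy.le
  change ‖T.1 x - F.starProjection (T.1 x)‖ ≤ _
  rw [Submodule.starProjection_minimal]
  exact ciInf_le ⟨0, by rintro _ ⟨_, rfl⟩; positivity⟩ (⟨y, Submodule.subset_span hy⟩ : F)

variable [GradedHilbertSpace H]

theorem grading_ro (x y : H) : grading (ro x y) = ro (parity x) (parity y) :=
  Ad_ro parity parity_isometry x y

theorem inner_parity_right (x y : H) : ⟪x, parity y⟫_ℂ = ⟪parity x, y⟫_ℂ := by
  rw [← inner_parity, parity_parity]

variable (H) in
/-- The set of homogeneous vectors. -/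
def homogeneous : Set H := {x | parity x = x ∨ parity x = -x}

theorem span_homogeneous : Submodule.span ℂ (homogeneous H) = ⊤ := by
  refine eq_top_iff.2 fun x _ => ?_
  have h : x = (1 / 2 : ℂ) • (x + parity x) + (1 / 2 : ℂ) • (x - parity x) := by
    rw [← smul_add, add_add_sub_cancel, ← two_smul ℂ x, smul_smul]
    norm_num
  rw [h]
  refine Submodule.add_mem _ (Submodule.smul_mem _ _ (Submodule.subset_span (Or.inl ?_)))
    (Submodule.smul_mem _ _ (Submodule.subset_span (Or.inr ?_)))
  · rw [map_add, parity_parity, add_comm]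
  · rw [map_sub, parity_parity, neg_sub]

theorem dense_span_homogeneous : Dense (Submodule.span ℂ (homogeneous H) : Set H) := by
  rw [span_homogeneous]
  exact dense_univ

theorem grading_ro_homogeneous {x y : H} (hx : x ∈ homogeneous H) (hy : y ∈ homogeneous H) :
    grading (ro x y) = ro x y ∨ grading (ro x y) = -ro x y := by
  rw [grading_ro]
  rcases hx with hx | hx <;> rcases hy with hy | hy <;>
    simp [hx, hy, ro_neg_left, ro_neg_right]

/-- Continuous linear maps on `𝒦(H) ⊗̂ 𝒦(H')` agree if they agree on tensor products of operators
of rank one. -/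
theorem MaxTensor.clm_ext_ro [GradedHilbertSpace H'] {M : Type*} [NormedAddCommGroup M]
    [NormedSpace ℂ M] {f g : MaxTensor (CompactOp H) (CompactOp H') →L[ℂ] M}
    (h : ∀ x ∈ homogeneous H, ∀ y ∈ homogeneous H, ∀ z ∈ homogeneous H', ∀ w ∈ homogeneous H',
      f (tmul (ro x y) (ro z w)) = g (tmul (ro x y) (ro z w))) : f = g := by
  ext x
  refine MaxTensor.eq_of_tmul f.continuous g.continuous (map_zero f) (map_zero g) (map_add f)
    (map_add g) (fun T S => ?_) x
  have h1 : ∀ S : CompactOp H', ∀ x ∈ homogeneous H, ∀ y ∈ homogeneous H,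
      f (tmul (ro x y) S) = g (tmul (ro x y) S) := fun S x hx y hy => by
    let f' : CompactOp H' →L[ℂ] M := f ∘L tmulL (ro x y)
    let g' : CompactOp H' →L[ℂ] M := g ∘L tmulL (ro x y)
    exact mem_of_dense (LinearMap.eqLocus (f' : CompactOp H' →ₗ[ℂ] M) g')
      (isClosed_eq f'.continuous g'.continuous) dense_span_homogeneous
      (fun z hz w hw => h x hx y hy z hz w hw) S
  let f' : CompactOp H →L[ℂ] M := f ∘L tmulL.flip S
  let g' : CompactOp H →L[ℂ] M := g ∘L tmulL.flip S
  exact mem_of_dense (LinearMap.eqLocus (f' : CompactOp H →ₗ[ℂ] M) g')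
    (isClosed_eq f'.continuous g'.continuous) dense_span_homogeneous
    (fun x hx y hy => h1 S x hx y hy) T

end RankOne

/-- Products of homogeneous elements are homogeneous. -/
theorem grading_mul_homogeneous {B : Type*} [NonUnitalCStarAlgebra B] [GradedCStarAlgebra B]
    {b b' : B} (h : grading b = b ∨ grading b = -b) (h' : grading b' = b' ∨ grading b' = -b') :
    grading (b * b') = b * b' ∨ grading (b * b') = -(b * b') := by
  rw [map_mul]
  rcases h with h | h <;> rcases h' with h' | h' <;> simp [h, h']

/-- Up to sign, elementary tensors of homogeneous elements are multiplied factor by factor. -/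
theorem tmul_mul_tmul_eq_or {A B : Type*} [NonUnitalCStarAlgebra A] [GradedCStarAlgebra A]
    [NonUnitalCStarAlgebra B] [GradedCStarAlgebra B] (a : A) {b : B}
    (hb : grading b = b ∨ grading b = -b) {c : A} (hc : grading c = c ∨ grading c = -c) (d : B) :
    tmul a b * tmul c d = tmul (a * c) (b * d) ∨ tmul a b * tmul c d = -tmul (a * c) (b * d) := by
  rcases hb with hb | hb
  · exact Or.inl (tmul_mul_tmul_of_even_left a hb c d)
  · rw [tmul_mul_tmul_of_odd_left a hb]
    rcases hc with hc | hc
    · rw [hc]; exact Or.inl rfl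
    · rw [hc, mul_neg, neg_tmul]; exact Or.inr rfl

/-- The inverse of a bijective homomorphism. -/
def GradedHom.inverse {t : Flavor} {A B : Type*} [NonUnitalCStarAlgebra A] [GradedCStarAlgebra A]
    [RealStructure t A] [NonUnitalCStarAlgebra B] [GradedCStarAlgebra B] [RealStructure t B]
    (φ : GradedHom t A B) (h : Function.Bijective φ) : GradedHom t B A where
  toFun := (Equiv.ofBijective φ h).symm
  map_smul' c b := h.1 (by simp [Equiv.ofBijective_apply_symm_apply φ h])
  map_zero' := h.1 (by simp [Equiv.ofBijective_apply_symm_apply φ h])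
  map_add' b b' := h.1 (by simp [Equiv.ofBijective_apply_symm_apply φ h])
  map_mul' b b' := h.1 (by simp [Equiv.ofBijective_apply_symm_apply φ h])
  map_star' b := h.1 (by simp [map_star, Equiv.ofBijective_apply_symm_apply φ h])
  map_grading b := h.1 (by
    simp [GradedHom.apply_grading, Equiv.ofBijective_apply_symm_apply φ h])
  map_bar hr b := h.1 (by
    simp [GradedHom.apply_bar, Equiv.ofBijective_apply_symm_apply φ h])

theorem GradedHom.inverse_apply {t : Flavor} {A B : Type*} [NonUnitalCStarAlgebra A]
    [GradedCStarAlgebra A] [RealStructure t A] [NonUnitalCStarAlgebra B] [GradedCStarAlgebra B]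
    [RealStructure t B] (φ : GradedHom t A B) (h : Function.Bijective φ) (a : A) :
    φ.inverse h (φ a) = a := Equiv.ofBijective_symm_apply_apply φ h a

/-! ### Compact operators on tensor products of Hilbert spaces -/

section TensorIso

open ContinuousLinearMap

variable (t : Flavor) (G H L : Type*) [NormedAddCommGroup G] [InnerProductSpace ℂ G]
  [CompleteSpace G] [GradedHilbertSpace G] [RealHilbertStructure t G]
  [NormedAddCommGroup H] [InnerProductSpace ℂ H] [CompleteSpace H] [GradedHilbertSpace H]
  [RealHilbertStructure t H]
  [NormedAddCommGroup L] [InnerProductSpace ℂ L] [CompleteSpace L] [GradedHilbertSpace L]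
  [RealHilbertStructure t L]

/-- An identification of a graded Hilbert space `L` with the Hilbert space tensor product of `G`
and `H`. -/
structure TensorIso where
  toIso : G ⊗[ℂ] H →ₗᵢ[ℂ] L
  dense : DenseRange toIso
  map_parity : ∀ x y, toIso (parity x ⊗ₜ parity y) = parity (toIso (x ⊗ₜ y))
  map_hbar : ∀ (h : t = .real) x y, toIso (hbar h x ⊗ₜ hbar h y) = hbar h (toIso (x ⊗ₜ y))

variable {t G H L}

namespace TensorIso

variable (w : TensorIso t G H L)

/-- The vector of `L` that corresponds to an elementary tensor. -/
def tm (x : G) (y : H) : L := w.toIso (x ⊗ₜ y)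

theorem inner_tm (x x' : G) (y y' : H) :
    ⟪w.tm x y, w.tm x' y'⟫_ℂ = ⟪x, x'⟫_ℂ * ⟪y, y'⟫_ℂ := by
  rw [tm, tm, LinearIsometry.inner_map_map, TensorProduct.inner_tmul]

theorem norm_tm (x : G) (y : H) : ‖w.tm x y‖ = ‖x‖ * ‖y‖ := by
  rw [tm, LinearIsometry.norm_map, TensorProduct.norm_tmul]

theorem parity_tm (x : G) (y : H) : parity (w.tm x y) = w.tm (parity x) (parity y) :=
  (w.map_parity x y).symm

theorem hbar_tm (h : t = .real) (x : G) (y : H) :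
    hbar h (w.tm x y) = w.tm (hbar h x) (hbar h y) :=
  (w.map_hbar h x y).symm

theorem dense_span : Dense (Submodule.span ℂ {z | ∃ x y, w.tm x y = z} : Set L) := by
  refine w.dense.mono ?_
  rintro _ ⟨z, rfl⟩
  induction z using TensorProduct.induction_on with
  | zero => rw [map_zero]; exact Submodule.zero_mem _
  | tmul x y => exact Submodule.subset_span ⟨x, y, rfl⟩
  | add x y hx hy => rw [map_add]; exact Submodule.add_mem _ hx hy

theorem clm_ext {M : Type*} [NormedAddCommGroup M] [NormedSpace ℂ M] {f g : L →L[ℂ] M}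
    (h : ∀ x y, f (w.tm x y) = g (w.tm x y)) : f = g :=
  ContinuousLinearMap.ext_on w.dense_span (by rintro _ ⟨x, y, rfl⟩; exact h x y)

/-- The tensor product of two operators. -/
def op (T : G →L[ℂ] G) (S : H →L[ℂ] H) : L →L[ℂ] L :=
  ((w.toIso.toContinuousLinearMap ∘L TensorProduct.mapL T S :
    G ⊗[ℂ] H →L[ℂ] L) : G ⊗[ℂ] H →ₗ[ℂ] L).extendOfNorm w.toIso.toLinearMap

theorem norm_mapL_apply_le (T : G →L[ℂ] G) (S : H →L[ℂ] H) (z : G ⊗[ℂ] H) :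
    ‖((w.toIso.toContinuousLinearMap ∘L TensorProduct.mapL T S :
      G ⊗[ℂ] H →L[ℂ] L) : G ⊗[ℂ] H →ₗ[ℂ] L) z‖ ≤ ‖T‖ * ‖S‖ * ‖w.toIso.toLinearMap z‖ := by
  change ‖w.toIso (TensorProduct.mapL T S z)‖ ≤ _ * ‖w.toIso z‖
  rw [LinearIsometry.norm_map, LinearIsometry.norm_map]
  exact le_of_opNorm_le _ (TensorProduct.norm_mapL_le T S) z

theorem op_tm (T : G →L[ℂ] G) (S : H →L[ℂ] H) (x : G) (y : H) :
    w.op T S (w.tm x y) = w.tm (T x) (S y) :=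
  LinearMap.extendOfNorm_eq (e := w.toIso.toLinearMap) w.dense
    ⟨_, w.norm_mapL_apply_le T S⟩ (x ⊗ₜ y)

theorem norm_op_le (T : G →L[ℂ] G) (S : H →L[ℂ] H) : ‖w.op T S‖ ≤ ‖T‖ * ‖S‖ :=
  LinearMap.opNorm_extendOfNorm_le w.dense (by positivity) (w.norm_mapL_apply_le T S)

theorem op_comp (T T' : G →L[ℂ] G) (S S' : H →L[ℂ] H) :
    w.op T S ∘L w.op T' S' = w.op (T ∘L T') (S ∘L S') :=
  w.clm_ext fun x y => by simp only [comp_apply, op_tm]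

/-- Both sides have the same inner products between elementary tensors, and these span a dense
subspace of `L`. -/
theorem adjoint_op (T : G →L[ℂ] G) (S : H →L[ℂ] H) :
    adjoint (w.op T S) = w.op (adjoint T) (adjoint S) := by
  refine w.clm_ext fun x y => ?_
  refine ext_inner_right ℂ fun z => ?_
  rw [adjoint_inner_left, op_tm]
  have h : innerSL ℂ (w.tm x y) ∘L w.op T S = innerSL ℂ (w.tm (adjoint T x) (adjoint S y)) :=
    w.clm_ext fun x' y' => by
      simp only [comp_apply, innerSL_apply_apply, op_tm, inner_tm, adjoint_inner_left]
  exact DFunLike.congr_fun h z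

theorem tm_add_left (x x' : G) (y : H) : w.tm (x + x') y = w.tm x y + w.tm x' y := by
  simp only [tm, TensorProduct.add_tmul, map_add]

theorem tm_add_right (x : G) (y y' : H) : w.tm x (y + y') = w.tm x y + w.tm x y' := by
  simp only [tm, TensorProduct.tmul_add, map_add]

theorem tm_smul_left (c : ℂ) (x : G) (y : H) : w.tm (c • x) y = c • w.tm x y := by
  simp only [tm, ← TensorProduct.smul_tmul', map_smul]

theorem tm_smul_right (c : ℂ) (x : G) (y : H) : w.tm x (c • y) = c • w.tm x y := by
  simp only [tm, TensorProduct.tmul_smul, map_smul]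

/-- The tensor product of operators as a continuous bilinear map. -/
def opL : (G →L[ℂ] G) →L[ℂ] (H →L[ℂ] H) →L[ℂ] L →L[ℂ] L :=
  LinearMap.mkContinuous₂
    (LinearMap.mk₂ ℂ w.op
      (fun _ _ _ => w.clm_ext fun x y => by simp only [op_tm, add_apply, tm_add_left])
      (fun _ _ _ => w.clm_ext fun x y => by
        simp only [op_tm, smul_apply, tm_smul_left])
      (fun _ _ _ => w.clm_ext fun x y => by simp only [op_tm, add_apply, tm_add_right])
      (fun _ _ _ => w.clm_ext fun x y => by
        simp only [op_tm, smul_apply, tm_smul_right])) 1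
    fun T S => by rw [one_mul]; exact w.norm_op_le T S

theorem op_ro (x x' : G) (y y' : H) :
    w.op (ro x x').1 (ro y y').1 = (ro (w.tm x y) (w.tm x' y')).1 :=
  w.clm_ext fun a b => by
    rw [op_tm, ro_apply, ro_apply, ro_apply, inner_tm, tm_smul_left, tm_smul_right, smul_smul]

/-- The tensor product of rank one operators has rank one. Continuity in each factor and closedness
of the compact operators do the rest. -/
theorem isCompactOperator_op (T : CompactOp G) (S : CompactOp H) :
    IsCompactOperator (w.op T.1 S.1) := by
  let K : Submodule ℂ (L →L[ℂ] L) := (compactOps L).toSubmodule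
  have hK : IsClosed (K : Set (L →L[ℂ] L)) := inferInstanceAs (IsClosed (compactOps L : Set (L →L[ℂ] L)))
  let ιG : CompactOp G →L[ℂ] G →L[ℂ] G := (compactOps G).toSubmodule.subtypeL
  let ιH : CompactOp H →L[ℂ] H →L[ℂ] H := (compactOps H).toSubmodule.subtypeL
  have h1 : ∀ (x x' : G) (S : CompactOp H), w.op (ro x x').1 S.1 ∈ K := fun x x' S => by
    let f : CompactOp H →L[ℂ] L →L[ℂ] L := w.opL (ro x x').1 ∘L ιH
    refine mem_of_dense (K.comap (f : CompactOp H →ₗ[ℂ] L →L[ℂ] L)) (hK.preimage f.continuous)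
      dense_span_homogeneous (fun y _ y' _ => ?_) S
    change w.op (ro x x').1 (ro y y').1 ∈ K
    rw [op_ro]
    exact (ro _ _).2
  let f : CompactOp G →L[ℂ] L →L[ℂ] L := w.opL.flip S.1 ∘L ιG
  exact mem_of_dense (K.comap (f : CompactOp G →ₗ[ℂ] L →L[ℂ] L)) (hK.preimage f.continuous)
    dense_span_homogeneous (fun x _ x' _ => h1 x x' S) T

/-- The tensor product of two compact operators. -/
def kop (T : CompactOp G) (S : CompactOp H) : CompactOp L :=
  ⟨w.op T.1 S.1, w.isCompactOperator_op T S⟩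

theorem compactOp_ext {R R' : CompactOp L} (h : ∀ x y, R.1 (w.tm x y) = R'.1 (w.tm x y)) :
    R = R' := Subtype.ext (w.clm_ext h)

theorem kop_tm (T : CompactOp G) (S : CompactOp H) (x : G) (y : H) :
    (w.kop T S).1 (w.tm x y) = w.tm (T.1 x) (S.1 y) := w.op_tm _ _ _ _

theorem kop_add_left (T T' : CompactOp G) (S : CompactOp H) :
    w.kop (T + T') S = w.kop T S + w.kop T' S :=
  Subtype.ext (DFunLike.congr_fun (map_add w.opL T.1 T'.1) S.1)

theorem kop_add_right (T : CompactOp G) (S S' : CompactOp H) :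
    w.kop T (S + S') = w.kop T S + w.kop T S' :=
  Subtype.ext (map_add (w.opL T.1) S.1 S'.1)

theorem kop_smul_left (c : ℂ) (T : CompactOp G) (S : CompactOp H) :
    w.kop (c • T) S = c • w.kop T S :=
  Subtype.ext (DFunLike.congr_fun (map_smul w.opL c T.1) S.1)

theorem kop_smul_right (c : ℂ) (T : CompactOp G) (S : CompactOp H) :
    w.kop T (c • S) = c • w.kop T S :=
  Subtype.ext (map_smul (w.opL T.1) c S.1)

theorem kop_zero_right (T : CompactOp G) : w.kop T (0 : CompactOp H) = 0 :=
  Subtype.ext (map_zero (w.opL T.1))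

theorem kop_neg_right (T : CompactOp G) (S : CompactOp H) : w.kop T (-S) = -w.kop T S :=
  Subtype.ext (map_neg (w.opL T.1) S.1)

theorem norm_kop_le (T : CompactOp G) (S : CompactOp H) : ‖w.kop T S‖ ≤ ‖T‖ * ‖S‖ :=
  w.norm_op_le _ _

theorem kop_mul_kop (T T' : CompactOp G) (S S' : CompactOp H) :
    w.kop T S * w.kop T' S' = w.kop (T * T') (S * S') := Subtype.ext (w.op_comp _ _ _ _)

theorem star_kop (T : CompactOp G) (S : CompactOp H) :
    star (w.kop T S) = w.kop (star T) (star S) := Subtype.ext (w.adjoint_op _ _)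

theorem kop_ro (x x' : G) (y y' : H) :
    w.kop (ro x x') (ro y y') = ro (w.tm x y) (w.tm x' y') := Subtype.ext (w.op_ro _ _ _ _)

theorem grading_kop (T : CompactOp G) (S : CompactOp H) :
    grading (w.kop T S) = w.kop (grading T) (grading S) :=
  w.compactOp_ext fun x y => by
    rw [CompactOp.grading_apply, parity_tm, kop_tm, kop_tm, parity_tm, CompactOp.grading_apply,
      CompactOp.grading_apply]

theorem bar_kop (h : t = .real) (T : CompactOp G) (S : CompactOp H) :
    bar h (w.kop T S) = w.kop (bar h T) (bar h S) :=
  w.compactOp_ext fun x y => by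
    rw [CompactOp.bar_apply, hbar_tm, kop_tm, kop_tm, hbar_tm, CompactOp.bar_apply,
      CompactOp.bar_apply]

end TensorIso

/-! ### Parity twists and the isomorphism of the graded tensor product of compact operators with
`𝒦(L)`. -/

variable {t : Flavor} {G H L : Type*} [NormedAddCommGroup G] [InnerProductSpace ℂ G]
  [CompleteSpace G] [GradedHilbertSpace G] [RealHilbertStructure t G]
  [NormedAddCommGroup H] [InnerProductSpace ℂ H] [CompleteSpace H] [GradedHilbertSpace H]
  [RealHilbertStructure t H]
  [NormedAddCommGroup L] [InnerProductSpace ℂ L] [CompleteSpace L] [GradedHilbertSpace L]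
  [RealHilbertStructure t L]

namespace CompactOp

/-- The operator `T` preceded by the parity operator. -/
def twist (T : CompactOp G) : CompactOp G := ⟨T.1 ∘L parity, T.2.comp_clm parity⟩

theorem twist_apply (T : CompactOp G) (x : G) : (twist T).1 x = T.1 (parity x) := rfl

theorem twist_add (T T' : CompactOp G) : twist (T + T') = twist T + twist T' := rfl

theorem twist_smul (c : ℂ) (T : CompactOp G) : twist (c • T) = c • twist T := rfl

theorem twist_twist (T : CompactOp G) : twist (twist T) = T := by
  ext x; rw [twist_apply, twist_apply, parity_parity]

theorem mul_twist (T T' : CompactOp G) : T * twist T' = twist (T * T') := rfl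

/-- Moving the parity operator past `T'` applies the grading to `T'`; this is the source of the
Koszul sign in the representation on `L`. -/
theorem twist_mul (T T' : CompactOp G) : twist T * T' = twist (T * grading T') := by
  ext x
  change T.1 (parity (T'.1 x)) = T.1 ((grading T').1 (parity x))
  rw [grading_apply, parity_parity]

theorem star_twist (T : CompactOp G) : star (twist T) = twist (star (grading T)) := by
  rw [← map_star]
  ext x
  rw [twist_apply, grading_apply, parity_parity]
  refine ext_inner_right ℂ fun y => ?_
  change ⟪adjoint (twist T).1 x, y⟫_ℂ = ⟪parity (adjoint T.1 x), y⟫_ℂ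
  rw [adjoint_inner_left, twist_apply, ← inner_parity_right, adjoint_inner_left]

theorem grading_twist (T : CompactOp G) : grading (twist T) = twist (grading T) := by
  ext x; simp only [grading_apply, twist_apply]

theorem bar_twist (h : t = .real) (T : CompactOp G) : bar h (twist T) = twist (bar h T) := by
  ext x; simp only [bar_apply, twist_apply, hbar_parity]

theorem norm_twist_le (T : CompactOp G) : ‖twist T‖ ≤ ‖T‖ := by
  refine (opNorm_comp_le T.1 parity).trans (mul_le_of_le_one_right (norm_nonneg _) ?_)
  refine opNorm_le_bound _ zero_le_one fun x => ?_
  rw [one_mul, ← sq_le_sq₀ (norm_nonneg _) (norm_nonneg _), ← inner_self_eq_norm_sq (𝕜 := ℂ),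
    ← inner_self_eq_norm_sq (𝕜 := ℂ), inner_parity]

theorem twist_ro (x y : G) : twist (ro x y) = ro x (parity y) := by
  ext z
  rw [twist_apply, ro_apply, ro_apply, inner_parity_right]

end CompactOp

namespace TensorIso

open CompactOp

variable (w : TensorIso t G H L)

/-- The representation of the algebraic graded tensor product of `𝒦(G)` and `𝒦(H)` on `L`, as a
linear map. -/
def algLinear : AlgTensor (CompactOp G) (CompactOp H) →ₗ[ℂ] CompactOp L :=
  AlgTensor.lift (LinearMap.mk₂ ℂ
    -- For homogeneous `S` the tensor `T ⊗̂ S` acts as `T ε^(∂S) ⊗ S`. The ungraded tensor product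
    -- of operators is not multiplicative for the graded product; the parity operator `ε` corrects
    -- this.
    (fun T S => w.kop T (evenPart S) + w.kop (twist T) (oddPart S))
    (fun T T' S => by simp only [twist_add, kop_add_left]; abel)
    (fun c T S => by simp only [twist_smul, kop_smul_left, smul_add])
    (fun T S S' => by simp only [map_add, kop_add_right]; abel)
    (fun c T S => by simp only [map_smul, kop_smul_right, smul_add]))

theorem algLinear_tmul (T : CompactOp G) (S : CompactOp H) :
    w.algLinear (AlgTensor.tmul T S) =
      w.kop T (evenPart S) + w.kop (twist T) (oddPart S) := rfl

theorem algLinear_of_even (T : CompactOp G) {S : CompactOp H} (hS : grading S = S) :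
    w.algLinear (AlgTensor.tmul T S) = w.kop T S := by
  rw [algLinear_tmul, evenPart_eq hS, oddPart_eq_zero hS, kop_zero_right, add_zero]

theorem algLinear_of_odd (T : CompactOp G) {S : CompactOp H} (hS : grading S = -S) :
    w.algLinear (AlgTensor.tmul T S) = w.kop (twist T) S := by
  rw [algLinear_tmul, evenPart_eq_zero hS, oddPart_eq hS, kop_zero_right, zero_add]

/-- The representation of the algebraic graded tensor product of `𝒦(G)` and `𝒦(H)` on `L`. -/
def algHom : AlgTensor (CompactOp G) (CompactOp H) →⋆ₙₐ[ℂ] CompactOp L :=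
  { w.algLinear with
    map_zero' := map_zero w.algLinear
    map_mul' := fun x y => by
      change w.algLinear (x * y) = w.algLinear x * w.algLinear y
      induction x using AlgTensor.hind with
      | zero => simp only [zero_mul, map_zero]
      | add x x' hx hx' => simp only [add_mul, map_add, hx, hx']
      | tmul a b _ hb =>
        induction y using AlgTensor.hind with
        | zero => simp only [mul_zero, map_zero]
        | add x x' hx hx' => simp only [mul_add, map_add, hx, hx']
        | tmul c d _ hd =>
          rcases hb with hb | hb <;> rcases hd with hd | hd
          · rw [AlgTensor.tmul_mul_tmul_of_even_left _ hb, w.algLinear_of_even _ hb,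
              w.algLinear_of_even _ hd, w.algLinear_of_even _ (AlgTensor.grading_mul_even_even hb hd),
              kop_mul_kop]
          · rw [AlgTensor.tmul_mul_tmul_of_even_left _ hb, w.algLinear_of_even _ hb,
              w.algLinear_of_odd _ hd, w.algLinear_of_odd _ (AlgTensor.grading_mul_even_odd hb hd),
              kop_mul_kop, mul_twist]
          · rw [AlgTensor.tmul_mul_tmul_of_odd_left _ hb, w.algLinear_of_odd _ hb,
              w.algLinear_of_even _ hd, w.algLinear_of_odd _ (AlgTensor.grading_mul_odd_even hb hd),
              kop_mul_kop, twist_mul]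
          · rw [AlgTensor.tmul_mul_tmul_of_odd_left _ hb, w.algLinear_of_odd _ hb,
              w.algLinear_of_odd _ hd, w.algLinear_of_even _ (AlgTensor.grading_mul_odd_odd hb hd),
              kop_mul_kop, mul_twist, twist_mul, twist_twist]
    map_star' := fun x => by
      change w.algLinear (star x) = star (w.algLinear x)
      induction x using AlgTensor.hind with
      | zero => simp only [star_zero, map_zero]
      | add x x' hx hx' => simp only [star_add, map_add, hx, hx']
      | tmul a b _ hb =>
        rcases hb with hb | hb
        · rw [AlgTensor.star_tmul_of_even_right _ hb, w.algLinear_of_even _ hb,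
            w.algLinear_of_even _ (AlgTensor.grading_star_even hb), star_kop]
        · rw [AlgTensor.star_tmul_of_odd_right _ hb, w.algLinear_of_odd _ hb,
            w.algLinear_of_odd _ (AlgTensor.grading_star_odd hb), star_kop, star_twist] }

theorem norm_algHom_tmul_le (T : CompactOp G) (S : CompactOp H) :
    ‖w.algHom (AlgTensor.tmul T S)‖ ≤ 2 * ‖T‖ * ‖S‖ := by
  change ‖w.kop T (evenPart S) + w.kop (twist T) (oddPart S)‖ ≤ _
  have h1 := (w.norm_kop_le T (evenPart S)).trans
    (mul_le_mul_of_nonneg_left (norm_evenPart_le S) (norm_nonneg _))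
  have h2 := (w.norm_kop_le (twist T) (oddPart S)).trans
    (mul_le_mul (norm_twist_le T) (norm_oddPart_le S) (norm_nonneg _) (norm_nonneg _))
  linarith [norm_add_le (w.kop T (evenPart S)) (w.kop (twist T) (oddPart S))]

/-- The representation of `𝒦(G) ⊗̂ 𝒦(H)` on `L`, as a `*`-homomorphism. -/
def starHom : MaxTensor (CompactOp G) (CompactOp H) →⋆ₙₐ[ℂ] CompactOp L :=
  MaxTensor.lift w.algHom w.norm_algHom_tmul_le

theorem starHom_of_even (T : CompactOp G) {S : CompactOp H} (hS : grading S = S) :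
    w.starHom (tmul T S) = w.kop T S :=
  (MaxTensor.lift_tmul _ _ _ _).trans (w.algLinear_of_even T hS)

theorem starHom_of_odd (T : CompactOp G) {S : CompactOp H} (hS : grading S = -S) :
    w.starHom (tmul T S) = w.kop (twist T) S :=
  (MaxTensor.lift_tmul _ _ _ _).trans (w.algLinear_of_odd T hS)

/-- The representation of `𝒦(G) ⊗̂ 𝒦(H)` on `L`. -/
def hom : GradedHom t (MaxTensor (CompactOp G) (CompactOp H)) (CompactOp L) :=
  GradedHom.ofTmul w.starHom
    (fun T S _ hS => by
      rcases hS with hS | hS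
      · rw [hS, w.starHom_of_even _ hS, w.starHom_of_even _ hS, grading_kop, hS]
      · rw [hS, tmul_neg, map_neg, w.starHom_of_odd _ hS, w.starHom_of_odd _ hS, grading_kop, hS,
          kop_neg_right, grading_twist])
    (fun h T S _ hS => by
      rcases hS with hS | hS
      · rw [w.starHom_of_even _ hS, w.starHom_of_even _ (by rw [← bar_grading, hS]), bar_kop]
      · rw [w.starHom_of_odd _ hS, w.starHom_of_odd _ (by rw [← bar_grading, hS, bar_neg]),
          bar_kop, bar_twist])

theorem hom_of_even (T : CompactOp G) {S : CompactOp H} (hS : grading S = S) :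
    w.hom (tmul T S) = w.kop T S := w.starHom_of_even T hS

theorem hom_of_odd (T : CompactOp G) {S : CompactOp H} (hS : grading S = -S) :
    w.hom (tmul T S) = w.kop (twist T) S := w.starHom_of_odd T hS

/-- The maximal norm of this tensor is at most the product on the right, so the representation loses
no norm on tensors of rank one operators. Injectivity rests on this. -/
theorem norm_hom_ro (x x' : G) {y y' : H} (hy : y ∈ homogeneous H) (hy' : y' ∈ homogeneous H) :
    ‖w.hom (tmul (ro x x') (ro y y'))‖ = ‖x‖ * ‖x'‖ * (‖y‖ * ‖y'‖) := by
  have hp : ∀ x : G, ‖parity x‖ = ‖x‖ := fun x => by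
    rw [← sq_eq_sq₀ (norm_nonneg _) (norm_nonneg _), ← inner_self_eq_norm_sq (𝕜 := ℂ),
      ← inner_self_eq_norm_sq (𝕜 := ℂ), inner_parity]
  rcases grading_ro_homogeneous hy hy' with h | h
  · rw [w.hom_of_even _ h, kop_ro, norm_ro, norm_tm, norm_tm]; ring
  · rw [w.hom_of_odd _ h, twist_ro, kop_ro, norm_ro, norm_tm, norm_tm, hp]; ring

/-- The product of an element of `𝒦(G) ⊗̂ 𝒦(H)` with tensor products of operators of rank one on
both sides is a multiple of a fixed tensor product of operators of rank one. -/
theorem ro_mul_mul_ro_mem (x x' : G) {z z' : G} {y y' u u' : H} (hy : y ∈ homogeneous H)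
    (hy' : y' ∈ homogeneous H) (hz : z ∈ homogeneous G) (hz' : z' ∈ homogeneous G)
    (a : MaxTensor (CompactOp G) (CompactOp H)) :
    tmul (ro x x') (ro y y') * a * tmul (ro z z') (ro u u') ∈
      Submodule.span ℂ {(tmul (ro x z') (ro y u') : MaxTensor (CompactOp G) (CompactOp H))} := by
  set M := Submodule.span ℂ {(tmul (ro x z') (ro y u') : MaxTensor (CompactOp G) (CompactOp H))}
  have hM : IsClosed (M : Set (MaxTensor (CompactOp G) (CompactOp H))) :=
    Submodule.closed_of_finiteDimensional M
  induction a using CStarCompletion.ind with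
  | hp => exact hM.preimage (by fun_prop)
  | h a =>
    induction a using AlgTensor.hind with
    | zero => rw [CStarCompletion.of_zero, mul_zero, zero_mul]; exact M.zero_mem
    | add a b ha hb =>
      rw [CStarCompletion.of_add, mul_add, add_mul]; exact M.add_mem ha hb
    | tmul T S hT hS =>
      change tmul (ro x x') (ro y y') * tmul T S * tmul (ro z z') (ro u u') ∈ M
      -- In each factor an operator between two rank one operators yields a scalar times a fixed
      -- rank one operator. The signs in the graded product are irrelevant for membership in a
      -- subspace.
      have h1 : tmul (ro x x' * T * ro z z') (ro y y' * S * ro u u') ∈ M := by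
        rw [mul_assoc, mul_ro, ro_mul_ro, mul_assoc, mul_ro, ro_mul_ro, smul_tmul, tmul_smul]
        exact M.smul_mem _ (M.smul_mem _ (Submodule.mem_span_singleton_self _))
      have hr := grading_ro_homogeneous hy hy'
      have h2 : tmul (ro x x' * T) (ro y y' * S) * tmul (ro z z') (ro u u') ∈ M := by
        rcases tmul_mul_tmul_eq_or (ro x x' * T) (grading_mul_homogeneous hr hS)
          (grading_ro_homogeneous hz hz') (ro u u') with h | h
        · rw [h]; exact h1
        · rw [h]; exact M.neg_mem h1
      rcases tmul_mul_tmul_eq_or (ro x x') hr hT S with h | h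
      · rw [h]; exact h2
      · rw [h, neg_mul]; exact M.neg_mem h2

/-- An element `a` of the kernel, multiplied on both sides by rank one tensors, becomes a scalar
multiple of one rank one tensor that is still in the kernel. There `norm_hom_ro` makes it vanish,
and density gives `b a b' = 0` for all `b` and `b'`. -/
theorem hom_injective : Function.Injective w.hom := by
  refine (injective_iff_map_eq_zero w.hom).2 fun a ha => ?_
  have h1 : ∀ x ∈ homogeneous G, ∀ x' ∈ homogeneous G, ∀ y ∈ homogeneous H, ∀ y' ∈ homogeneous H,
      ∀ z ∈ homogeneous G, ∀ z' ∈ homogeneous G, ∀ u ∈ homogeneous H, ∀ u' ∈ homogeneous H,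
      tmul (ro x x') (ro y y') * a * tmul (ro z z') (ro u u') = 0 :=
    fun x _ x' _ y hy y' hy' z hz z' hz' u _ u' hu' => by
      obtain ⟨c, hc⟩ := Submodule.mem_span_singleton.1
        (ro_mul_mul_ro_mem x x' (u := u) (u' := u') hy hy' hz hz' a)
      have h := congrArg w.hom hc
      rw [map_mul, map_mul, ha, mul_zero, zero_mul, map_smul] at h
      have h2 := congrArg norm h
      rw [norm_smul, norm_hom_ro w x z' hy hu', norm_zero] at h2
      rw [← hc, ← norm_le_zero_iff, norm_smul]
      refine (mul_le_mul_of_nonneg_left (norm_tmul_le _ _) (norm_nonneg _)).trans_eq ?_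
      rw [norm_ro, norm_ro, h2]
  have h2 : ∀ b, ∀ z ∈ homogeneous G, ∀ z' ∈ homogeneous G, ∀ u ∈ homogeneous H,
      ∀ u' ∈ homogeneous H, b * (a * tmul (ro z z') (ro u u')) = 0 := fun b z hz z' hz' u hu u' hu' =>
    DFunLike.congr_fun (f := (ContinuousLinearMap.mul ℂ (MaxTensor (CompactOp G) (CompactOp H))).flip (a * tmul (ro z z') (ro u u')))
      (g := 0) (MaxTensor.clm_ext_ro fun x hx x' hx' y hy y' hy' => by
        rw [flip_apply, mul_apply', ← mul_assoc]
        exact h1 x hx x' hx' y hy y' hy' z hz z' hz' u hu u' hu') b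
  have h3 : ∀ b b', b * a * b' = 0 := fun b b' =>
    DFunLike.congr_fun (f := ContinuousLinearMap.mul ℂ (MaxTensor (CompactOp G) (CompactOp H)) (b * a))
      (g := 0) (MaxTensor.clm_ext_ro fun z hz z' hz' u hu u' hu' => by
        rw [mul_apply', mul_assoc]
        exact h2 b z hz z' hz' u hu u' hu') b'
  -- The product contains `a* a a*`, which vanishes by `h3`; two applications of the C*-identity
  -- then give `a = 0`.
  have h4 : star (star a * a) * (star a * a) = 0 := by
    rw [star_mul, star_star, ← mul_assoc, h3, zero_mul]
  rwa [CStarRing.star_mul_self_eq_zero_iff, CStarRing.star_mul_self_eq_zero_iff] at h4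

/-- The parity operator is an involution, so twisting `T` beforehand cancels the twist that an odd
`S` causes. -/
theorem kop_mem_range (T : CompactOp G) (S : CompactOp H) : ∃ a, w.hom a = w.kop T S := by
  refine ⟨tmul T (evenPart S) + tmul (twist T) (oddPart S), ?_⟩
  rw [map_add, w.hom_of_even _ (grading_evenPart S), w.hom_of_odd _ (grading_oddPart S),
    twist_twist, ← kop_add_right, evenPart_add_oddPart]

/-- An injective `*`-homomorphism of C*-algebras is isometric, so the range is closed. It contains
the rank one operators built from elementary tensors. -/
theorem hom_surjective : Function.Surjective w.hom := by
  have hi : Isometry w.hom := NonUnitalStarAlgHom.isometry w.hom w.hom_injective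
  let f : MaxTensor (CompactOp G) (CompactOp H) →ₗ[ℂ] CompactOp L :=
    { toFun := w.hom, map_add' := map_add w.hom, map_smul' := map_smul w.hom }
  have hc : IsClosed (LinearMap.range f : Set (CompactOp L)) :=
    hi.isClosedEmbedding.isClosed_range
  refine fun R => mem_of_dense (LinearMap.range f) hc w.dense_span ?_ R
  rintro _ ⟨x, y, rfl⟩ _ ⟨x', y', rfl⟩
  rw [← kop_ro]
  exact w.kop_mem_range _ _

/-- The restriction of the identification of `G ⊗ H` and `L` to `v ⊗ H`. -/
def slice (v : G) : H →L[ℂ] L := w.toIso.toContinuousLinearMap ∘L TensorProduct.mkL ℂ G H v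

theorem slice_apply (v : G) (y : H) : w.slice v y = w.tm v y := rfl

end TensorIso

end TensorIso

/-! ### Homogeneous Real orthonormal bases -/

section Bases

open ContinuousLinearMap

variable {t : Flavor} {H : Type*} [NormedAddCommGroup H] [InnerProductSpace ℂ H]
  [CompleteSpace H] [GradedHilbertSpace H] [RealHilbertStructure t H]

variable (t) in
/-- Homogeneous vectors that are fixed by the conjugation, in the Real theory. -/
def IsAdapted (x : H) : Prop := x ∈ homogeneous H ∧ ∀ h : t = .real, hbar h x = x

-- From `x ≠ 0`, either `x + ε(x)` is a non-zero even vector or `x` is odd. In the Real theory, for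
-- the resulting homogeneous `y`, either `y + ȳ` is a non-zero Real vector or `ȳ = -y`, and then
-- `iy` is Real. Normalizing by a real scalar preserves these properties.
variable (t) in
theorem exists_isAdapted (K : Submodule ℂ H) (hK : K ≠ ⊥) (hp : ∀ x ∈ K, parity x ∈ K)
    (hb : ∀ (h : t = .real), ∀ x ∈ K, hbar h x ∈ K) : ∃ v ∈ K, ‖v‖ = 1 ∧ IsAdapted t v := by
  obtain ⟨x, hx, hx0⟩ := (Submodule.ne_bot_iff K).1 hK
  obtain ⟨y, hy, hy0, hyh⟩ : ∃ y ∈ K, y ≠ 0 ∧ y ∈ homogeneous H := by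
    by_cases h : x + parity x = 0
    · exact ⟨x, hx, hx0, Or.inr (by rwa [add_comm, ← eq_neg_iff_add_eq_zero] at h)⟩
    · exact ⟨x + parity x, K.add_mem hx (hp x hx), h,
        Or.inl (by rw [map_add, parity_parity, add_comm])⟩
  obtain ⟨z, hz, hz0, hza⟩ : ∃ z ∈ K, z ≠ 0 ∧ IsAdapted t z := by
    cases t with
    | complex => exact ⟨y, hy, hy0, hyh, fun h => nomatch h⟩
    | real =>
      have hbh : hbar rfl y ∈ homogeneous H := by
        rcases hyh with h | h
        · exact Or.inl (by rw [← hbar_parity, h])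
        · exact Or.inr (by rw [← hbar_parity, h, map_neg])
      have hsum : ∀ c : ℂ, c • (y + hbar rfl y) ∈ homogeneous H := fun c => by
        rcases hyh with h | h
        · exact Or.inl (by rw [map_smul, map_add, ← hbar_parity, h])
        · exact Or.inr (by rw [map_smul, map_add, ← hbar_parity, h, map_neg, ← neg_add, smul_neg])
      by_cases h : y + hbar rfl y = 0
      · have h' : hbar (t := .real) rfl y = -y := by rwa [add_comm, ← eq_neg_iff_add_eq_zero] at h
        refine ⟨Complex.I • y, K.smul_mem _ hy, smul_ne_zero Complex.I_ne_zero hy0, ?_, ?_⟩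
        · rcases hyh with h | h
          · exact Or.inl (by rw [map_smul, h])
          · exact Or.inr (by rw [map_smul, h, smul_neg])
        · intro _
          rw [map_smulₛₗ, h', Complex.conj_I, smul_neg, neg_smul, neg_neg]
      · refine ⟨y + hbar rfl y, K.add_mem hy (hb rfl y hy), h, ?_, ?_⟩
        · simpa using hsum 1
        · intro _
          rw [map_add, hbar_hbar, add_comm]
  refine ⟨((‖z‖⁻¹ : ℝ) : ℂ) • z, K.smul_mem _ hz, ?_, ?_, ?_⟩
  · rw [norm_smul, Complex.norm_real, norm_inv, norm_norm, inv_mul_cancel₀ (norm_ne_zero_iff.2 hz0)]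
  · rcases hza.1 with h | h
    · exact Or.inl (by rw [map_smul, h])
    · exact Or.inr (by rw [map_smul, h, smul_neg])
  · intro h
    rw [map_smulₛₗ, hza.2 h, Complex.conj_ofReal]

-- Zorn's lemma yields a maximal orthonormal set of adapted vectors. Its orthogonal complement is
-- invariant under parity and conjugation, so if it were non-zero it would contain another adapted
-- unit vector.
variable (t H) in
theorem exists_adapted_basis : ∃ (w : Set H) (b : HilbertBasis w ℂ H), ⇑b = ((↑) : w → H) ∧
    ∀ x ∈ w, IsAdapted t x := by
  obtain ⟨w, -, hw⟩ := zorn_subset_nonempty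
    {w : Set H | Orthonormal ℂ ((↑) : w → H) ∧ ∀ x ∈ w, IsAdapted t x}
    (fun c hc cc _ => ⟨⋃₀ c, ⟨orthonormal_sUnion_of_directed cc.directedOn fun x xc => (hc xc).1,
      fun x ⟨s, hs, hx⟩ => (hc hs).2 x hx⟩, fun _ => Set.subset_sUnion_of_mem⟩)
    ∅ ⟨orthonormal_empty ℂ H, fun x hx => hx.elim⟩
  obtain ⟨⟨hwo, hwa⟩, hmax⟩ := hw
  have hmem : ∀ z, z ∈ (Submodule.span ℂ (Set.range ((↑) : w → H)))ᗮ ↔ ∀ x ∈ w, ⟪x, z⟫_ℂ = 0 :=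
    fun z => by
      rw [Subtype.range_coe, Submodule.mem_orthogonal]
      refine ⟨fun h x hx => h x (Submodule.subset_span hx), fun h u hu => ?_⟩
      induction hu using Submodule.span_induction with
      | mem x hx => exact h x hx
      | zero => exact inner_zero_left _
      | add x y _ _ hx hy => rw [inner_add_left, hx, hy, add_zero]
      | smul c x _ hx => rw [inner_smul_left, hx, mul_zero]
  refine ⟨w, HilbertBasis.mkOfOrthogonalEqBot hwo ?_, HilbertBasis.coe_mkOfOrthogonalEqBot _ _,
    hwa⟩
  by_contra hne
  obtain ⟨v, hv, hv1, hva⟩ := exists_isAdapted t _ hne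
    (fun z hz => (hmem _).2 fun x hx => by
      rw [inner_parity_right]
      rcases (hwa x hx).1 with h | h
      · rw [h, (hmem z).1 hz x hx]
      · rw [h, inner_neg_left, (hmem z).1 hz x hx, neg_zero])
    (fun h z hz => (hmem _).2 fun x hx => by
      rw [← (hwa x hx).2 h, inner_hbar, (hmem z).1 hz x hx, star_zero])
  have hvw := (hmem v).1 hv
  have hins : insert v w ∈ {w : Set H | Orthonormal ℂ ((↑) : w → H) ∧ ∀ x ∈ w, IsAdapted t x} := by
    refine ⟨⟨?_, ?_⟩, ?_⟩
    · rintro ⟨x, rfl | hx⟩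
      · exact hv1
      · exact hwo.1 ⟨x, hx⟩
    · rintro ⟨x, rfl | hx⟩ ⟨y, rfl | hy⟩ hxy
      · exact (hxy rfl).elim
      · exact inner_eq_zero_symm.1 (hvw y hy)
      · exact hvw x hx
      · exact hwo.2 (i := ⟨x, hx⟩) (j := ⟨y, hy⟩) fun h => hxy (Subtype.ext (congrArg (·.1) h))
    · rintro x (rfl | hx)
      · exact hva
      · exact hwa x hx
  have hvmem : v ∈ w := hmax hins (Set.subset_insert v w) (Set.mem_insert v w)
  have := hvw v hvmem
  rw [inner_self_eq_zero] at this
  rw [this, norm_zero] at hv1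
  exact zero_ne_one hv1

/-- Distinct orthonormal vectors have distance `√2 ≥ 1`, so the balls of radius `1/2` around them
are disjoint. -/
theorem countable_of_orthonormal [TopologicalSpace.SeparableSpace H] {ι : Type*} {v : ι → H}
    (hv : Orthonormal ℂ v) : Countable ι := by
  refine Pairwise.countable_of_isOpen_disjoint (s := fun i => Metric.ball (v i) (1 / 2))
    (fun i j hij => Metric.ball_disjoint_ball ?_) (fun _ => Metric.isOpen_ball)
    (fun i => ⟨v i, Metric.mem_ball_self (by norm_num)⟩)
  have h : ‖v i - v j‖ ^ 2 = 2 := by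
    rw [@norm_sub_sq ℂ, hv.1, hv.1, hv.2 hij]
    norm_num
  rw [dist_eq_norm]
  nlinarith [norm_nonneg (v i - v j)]

/-- The Hilbert basis indexed by an equivalent type. -/
theorem exists_reindex {ι κ : Type*} (b : HilbertBasis ι ℂ H) (e : κ ≃ ι) :
    ∃ b' : HilbertBasis κ ℂ H, ∀ k, b' k = b (e k) := by
  refine ⟨HilbertBasis.mk (v := b ∘ e) (b.orthonormal.comp e e.injective) ?_, fun k => ?_⟩
  · rw [e.surjective.range_comp, b.dense_span]
  · rw [HilbertBasis.coe_mk]; rfl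

/-- The sign of a parity: `false` is even and `true` is odd. -/
def sgn (q : Bool) : ℂ := if q then -1 else 1

theorem sgn_xor (p q : Bool) : sgn (xor p q) = sgn p * sgn q := by
  cases p <;> cases q <;> simp [sgn]

variable (t) in
/-- An adapted orthonormal basis whose vector of index `i` has parity `p i`. -/
structure AdaptedBasis (ι : Type*) (p : ι → Bool) (H : Type*) [NormedAddCommGroup H]
    [InnerProductSpace ℂ H] [CompleteSpace H] [GradedHilbertSpace H] [RealHilbertStructure t H] where
  basis : HilbertBasis ι ℂ H
  parity_basis : ∀ i, parity (basis i) = sgn (p i) • basis i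
  hbar_basis : ∀ (h : t = .real) i, hbar h (basis i) = basis i

variable (t H) in
theorem exists_adaptedBasis : ∃ (w : Set H) (p : w → Bool), Nonempty (AdaptedBasis t w p H) := by
  obtain ⟨w, b, hb, hw⟩ := exists_adapted_basis t H
  classical
  refine ⟨w, fun x => decide (parity (x : H) ≠ x), ⟨b, fun i => ?_, fun h i => ?_⟩⟩
  · rw [hb]
    by_cases h : parity (i : H) = i
    · simp [h, sgn]
    · simp [h, sgn, ((hw i i.2).1.resolve_left h)]
  · rw [hb, (hw i i.2).2 h]

/-- The subspace of vectors of a given parity. -/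
def paritySubspace (H : Type*) [NormedAddCommGroup H] [InnerProductSpace ℂ H] [CompleteSpace H]
    [GradedHilbertSpace H] (q : Bool) : Submodule ℂ H :=
  if q then oddSubspace H else evenSubspace H

theorem mem_paritySubspace {q : Bool} {x : H} : x ∈ paritySubspace H q ↔ parity x = sgn q • x := by
  cases q
  · rw [sgn]; simp only [Bool.false_eq_true, if_false, one_smul]; rfl
  · rw [sgn]; simp only [if_true, neg_one_smul]; rfl

/-- Vectors of opposite parity are orthogonal. If only finitely many basis vectors had parity `q`,
their span would therefore contain every vector of parity `q`: the difference from its projection is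
orthogonal to the whole basis. -/
theorem AdaptedBasis.infinite {ι : Type*} {p : ι → Bool} (B : AdaptedBasis t ι p H) {q : Bool}
    (hq : ¬ FiniteDimensional ℂ (paritySubspace H q)) : Infinite {i // p i = q} := by
  by_contra hfin
  rw [not_infinite_iff_finite] at hfin
  have := hfin
  let F := Submodule.span ℂ (Set.range fun i : {i // p i = q} => B.basis i)
  have hF : FiniteDimensional ℂ F := FiniteDimensional.span_of_finite ℂ (Set.finite_range _)
  refine hq (Submodule.finiteDimensional_of_le (S₂ := F) fun x hx => ?_)
  rw [mem_paritySubspace] at hx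
  have h0 : ∀ i, p i ≠ q → ⟪B.basis i, x⟫_ℂ = 0 := fun i hi => by
    have h := inner_parity (B.basis i) x
    rw [B.parity_basis, hx, inner_smul_left, inner_smul_right, ← mul_assoc] at h
    have h2 : (starRingEnd ℂ) (sgn (p i)) * sgn q = -1 := by
      cases hp : p i <;> cases q <;> simp_all [sgn]
    rw [h2] at h
    linear_combination (-1 / 2 : ℂ) * h
  have hz : ∀ i, ⟪B.basis i, x - F.starProjection x⟫_ℂ = 0 := fun i => by
    by_cases hi : p i = q
    · have hm := Submodule.sub_starProjection_mem_orthogonal (K := F) x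
      exact hm _ (Submodule.subset_span ⟨⟨i, hi⟩, rfl⟩)
    · have hm : ∀ y ∈ F, ⟪B.basis i, y⟫_ℂ = 0 := fun y hy => by
        induction hy using Submodule.span_induction with
        | mem y hy =>
          obtain ⟨j, rfl⟩ := hy
          exact B.basis.orthonormal.2 fun hij => hi (hij ▸ j.2)
        | zero => exact inner_zero_right _
        | add x y _ _ hx hy => rw [inner_add_right, hx, hy, add_zero]
        | smul c x _ hx => rw [inner_smul_right, hx, mul_zero]
      rw [inner_sub_right, h0 i hi, hm _ (Submodule.starProjection_apply_mem F x), sub_zero]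
  have hz0 : x - F.starProjection x = 0 := by
    refine B.basis.repr.injective (lp.ext (funext fun i => ?_))
    rw [HilbertBasis.repr_apply_apply, hz, map_zero]
    rfl
  rw [sub_eq_zero.1 hz0]
  exact Submodule.starProjection_apply_mem F x

variable (t H) in
/-- A graded Hilbert space whose even and odd parts are separable and infinite-dimensional has an
adapted basis indexed by `ℕ × Bool`. -/
theorem exists_adaptedBasis_nat [TopologicalSpace.SeparableSpace H]
    (h0 : ¬ FiniteDimensional ℂ (evenSubspace H)) (h1 : ¬ FiniteDimensional ℂ (oddSubspace H)) :
    Nonempty (AdaptedBasis t (ℕ × Bool) Prod.snd H) := by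
  obtain ⟨w, p, ⟨B⟩⟩ := exists_adaptedBasis t H
  have := countable_of_orthonormal B.basis.orthonormal
  have hq : ∀ q, Nonempty (ℕ ≃ {i // p i = q}) := fun q => by
    have : Infinite {i // p i = q} := B.infinite (by cases q; exacts [h0, h1])
    exact nonempty_equiv_of_countable
  -- The index set splits into its two parity fibres, each countably infinite, and each fibre is
  -- enumerated by `ℕ`.
  let e : ℕ × Bool ≃ w := (Equiv.prodComm ℕ Bool).trans
    ((Equiv.sigmaEquivProd Bool ℕ).symm.trans
      ((Equiv.sigmaCongrRight fun q => (hq q).some).trans (Equiv.sigmaFiberEquiv p)))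
  have he : ∀ k, p (e k) = k.2 := fun k => ((hq k.2).some k.1).2
  obtain ⟨b, hb⟩ := exists_reindex B.basis e
  exact ⟨b, fun k => by rw [hb, B.parity_basis, he], fun h k => by rw [hb, B.hbar_basis]⟩

end Bases

/-! ### Identification of `G ⊗ H` with `H` -/

section Absorb

open ContinuousLinearMap UniformSpace

variable {t : Flavor} {G H : Type*} [NormedAddCommGroup G] [InnerProductSpace ℂ G]
  [CompleteSpace G] [GradedHilbertSpace G] [RealHilbertStructure t G]
  [NormedAddCommGroup H] [InnerProductSpace ℂ H] [CompleteSpace H] [GradedHilbertSpace H]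
  [RealHilbertStructure t H]

theorem HilbertBasis.clm_ext {ι M : Type*} {σ : ℂ →+* ℂ} [AddCommGroup M] [Module ℂ M]
    [TopologicalSpace M] [T2Space M] (b : HilbertBasis ι ℂ H) {f g : H →SL[σ] M}
    (h : ∀ i, f (b i) = g (b i)) : f = g :=
  ContinuousLinearMap.ext_on (Submodule.dense_iff_topologicalClosure_eq_top.2 b.dense_span)
    (by rintro _ ⟨i, rfl⟩; exact h i)

/-- The product of two Hilbert bases is a Hilbert basis of the tensor product. -/
theorem exists_tensorBasis {ι κ : Type*} (b : HilbertBasis ι ℂ G) (c : HilbertBasis κ ℂ H) :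
    ∃ d : HilbertBasis (ι × κ) ℂ (Completion (G ⊗[ℂ] H)),
      ∀ i, d i = ((b i.1 ⊗ₜ[ℂ] c i.2 : G ⊗[ℂ] H) : Completion (G ⊗[ℂ] H)) := by
  have ho : Orthonormal ℂ fun i : ι × κ =>
      ((b i.1 ⊗ₜ[ℂ] c i.2 : G ⊗[ℂ] H) : Completion (G ⊗[ℂ] H)) := by
    refine ⟨fun i => ?_, fun i j hij => ?_⟩
    · rw [Completion.norm_coe, TensorProduct.norm_tmul, b.orthonormal.1, c.orthonormal.1, one_mul]
    · change ⟪((b i.1 ⊗ₜ[ℂ] c i.2 : G ⊗[ℂ] H) : Completion (G ⊗[ℂ] H)),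
        ((b j.1 ⊗ₜ[ℂ] c j.2 : G ⊗[ℂ] H) : Completion (G ⊗[ℂ] H))⟫_ℂ = 0
      rw [Completion.inner_coe, TensorProduct.inner_tmul]
      by_cases h : i.1 = j.1
      · rw [c.orthonormal.2 fun h' => hij (Prod.ext h h'), mul_zero]
      · rw [b.orthonormal.2 h, zero_mul]
  refine ⟨HilbertBasis.mkOfOrthogonalEqBot ho ?_, fun i => ?_⟩
  · refine (Submodule.eq_bot_iff _).2 fun z hz => ?_
    -- The functional of a vector `z` orthogonal to the product family vanishes on products of basis
    -- vectors. Extending in the second variable, then in the first, shows that it vanishes on all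
    -- elementary tensors, hence on a dense subspace.
    let f : G ⊗[ℂ] H →L[ℂ] ℂ := innerSL ℂ z ∘L Completion.toComplL
    have h1 : ∀ i, f ∘L TensorProduct.mkL ℂ G H (b i) = 0 := fun i =>
      HilbertBasis.clm_ext c fun j => by
        have := (Submodule.mem_orthogonal' _ z).1 hz _ (Submodule.subset_span ⟨(i, j), rfl⟩)
        exact this
    have h2 : ∀ y, f ∘L (TensorProduct.mkL ℂ G H).flip y = 0 := fun y =>
      HilbertBasis.clm_ext b fun i => DFunLike.congr_fun (h1 i) y
    have h3 : ∀ u, f u = 0 := fun u => by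
      induction u using TensorProduct.induction_on with
      | zero => exact map_zero f
      | tmul x y => exact DFunLike.congr_fun (h2 y) x
      | add x y hx hy => rw [map_add, hx, hy, add_zero]
    have h4 : ∀ u, ⟪z, u⟫_ℂ = 0 := fun u => by
      induction u using Completion.induction_on with
      | hp => exact isClosed_eq (by fun_prop) continuous_const
      | ih u => exact h3 u
    exact inner_self_eq_zero.1 (h4 z)
  · rw [HilbertBasis.coe_mkOfOrthogonalEqBot]

/-- A bijection between index sets that is compatible with parities identifies the tensor product
of two graded Hilbert spaces with a third one. -/
theorem exists_tensorIso {L : Type*} [NormedAddCommGroup L] [InnerProductSpace ℂ L]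
    [CompleteSpace L] [GradedHilbertSpace L] [RealHilbertStructure t L] {ι κ μ : Type*}
    {p : ι → Bool} {q : κ → Bool} {r : μ → Bool} (B : AdaptedBasis t ι p G)
    (C : AdaptedBasis t κ q H) (D : AdaptedBasis t μ r L) (e : ι × κ ≃ μ)
    (he : ∀ i j, r (e (i, j)) = xor (p i) (q j)) : Nonempty (TensorIso t G H L) := by
  obtain ⟨d, hd⟩ := exists_tensorBasis B.basis C.basis
  obtain ⟨b, hb⟩ := exists_reindex D.basis e
  -- This unitary matches the product basis with the reindexed basis of `L`. Parity and conjugation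
  -- are then compared on basis vectors, where `he` and the Reality of the bases apply.
  let U : Completion (G ⊗[ℂ] H) ≃ₗᵢ[ℂ] L := d.repr.trans b.repr.symm
  classical
  have hU : ∀ i, U (d i) = b i := fun i => by
    change b.repr.symm (d.repr (d i)) = b i
    rw [HilbertBasis.repr_self, HilbertBasis.repr_symm_single]
  let J : G ⊗[ℂ] H →ₗᵢ[ℂ] L := U.toLinearIsometry.comp Completion.toComplₗᵢ
  have hJ : ∀ i j, J (B.basis i ⊗ₜ C.basis j) = D.basis (e (i, j)) := fun i j => by
    change U ((B.basis i ⊗ₜ[ℂ] C.basis j : G ⊗[ℂ] H) : Completion (G ⊗[ℂ] H)) = _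
    rw [← hd (i, j), hU, hb]
  obtain ⟨J', hJ'⟩ : ∃ J' : G →L[ℂ] H →L[ℂ] L, ∀ x y, J' x y = J (x ⊗ₜ y) :=
    ⟨(compL ℂ H (G ⊗[ℂ] H) L J.toContinuousLinearMap) ∘L TensorProduct.mkL ℂ G H,
      fun _ _ => rfl⟩
  refine ⟨⟨J, ?_, fun x y => ?_, fun h x y => ?_⟩⟩
  · exact (U.surjective.denseRange).comp Completion.denseRange_coe U.continuous
  · have h1 : ∀ i, J' (parity (B.basis i)) ∘L parity = parity ∘L J' (B.basis i) := fun i =>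
      HilbertBasis.clm_ext C.basis fun j => by
        change J' (parity (B.basis i)) (parity (C.basis j)) = parity (J' (B.basis i) (C.basis j))
        rw [hJ', hJ', B.parity_basis, C.parity_basis, ← TensorProduct.smul_tmul',
          TensorProduct.tmul_smul, J.map_smul, J.map_smul, hJ, D.parity_basis, he, sgn_xor, smul_smul]
    have h2 : J'.flip (parity y) ∘L parity = parity ∘L J'.flip y :=
      HilbertBasis.clm_ext B.basis fun i => DFunLike.congr_fun (h1 i) y
    rw [← hJ', ← hJ']
    exact DFunLike.congr_fun h2 x
  · have h1 : ∀ i, (J' (hbar h (B.basis i))).comp (hbar h) =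
        (hbar h : L →L⋆[ℂ] L).comp (J' (B.basis i)) := fun i =>
      HilbertBasis.clm_ext C.basis fun j => by
        change J' _ (hbar h (C.basis j)) = hbar h (J' _ (C.basis j))
        rw [hJ', hJ', B.hbar_basis, C.hbar_basis, hJ, D.hbar_basis]
    have h2 : (J'.flip (hbar h y)).comp (hbar h) = (hbar h : L →L⋆[ℂ] L).comp (J'.flip y) :=
      HilbertBasis.clm_ext B.basis fun i => DFunLike.congr_fun (h1 i) y
    rw [← hJ', ← hJ']
    exact DFunLike.congr_fun h2 x

/-- The bijection `ι × (ℕ × Bool) ≃ ℕ × Bool` that adds parities. -/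
theorem exists_index_equiv {ι : Type*} [Countable ι] [Nonempty ι] (p : ι → Bool) :
    ∃ e : ι × (ℕ × Bool) ≃ ℕ × Bool, ∀ i j, (e (i, j)).2 = xor (p i) j.2 := by
  obtain ⟨f⟩ : Nonempty (ι × ℕ ≃ ℕ) := nonempty_equiv_of_countable
  refine ⟨
    -- For fixed `i` adding `p i` permutes `Bool`, so the parities that occur in the first factor do
    -- not matter.
    { toFun := fun x => (f (x.1, x.2.1), xor (p x.1) x.2.2)
      invFun := fun y => ((f.symm y.1).1, ((f.symm y.1).2, xor (p (f.symm y.1).1) y.2))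
      left_inv := fun x => by simp
      right_inv := fun y => by simp }, fun i j => rfl⟩

-- Both parities occur infinitely often in `H`, so `H` absorbs every non-zero separable graded
-- Hilbert space. Separability of `G` makes its basis countable, and `G ≠ 0` makes it non-empty.
variable (t G H) in
theorem exists_tensorIso_absorb [TopologicalSpace.SeparableSpace G]
    [TopologicalSpace.SeparableSpace H] [Nontrivial G]
    (h0 : ¬ FiniteDimensional ℂ (evenSubspace H)) (h1 : ¬ FiniteDimensional ℂ (oddSubspace H)) :
    Nonempty (TensorIso t G H H) := by
  obtain ⟨w, p, ⟨B⟩⟩ := exists_adaptedBasis t G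
  obtain ⟨C⟩ := exists_adaptedBasis_nat t H h0 h1
  have := countable_of_orthonormal B.basis.orthonormal
  have : Nonempty w := by
    by_contra hw
    rw [not_nonempty_iff] at hw
    obtain ⟨x, hx⟩ := exists_ne (0 : G)
    refine hx (B.basis.repr.injective (lp.ext (funext fun i => (hw.false i).elim)))
  obtain ⟨e, he⟩ := exists_index_equiv p
  exact exists_tensorIso B C C e he

end Absorb

/-! ### Paths of isometries -/

section Paths

/-- For an equicontinuous family of contractions, continuity in the parameter is a closed
condition. -/
theorem isClosed_setOf_continuous {X E E' : Type*} [TopologicalSpace X] [PseudoMetricSpace E]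
    [PseudoMetricSpace E'] {F : X → E → E'} (hF : ∀ x, LipschitzWith 1 (F x)) :
    IsClosed {a | Continuous fun x => F x a} := by
  refine isClosed_of_closure_subset fun a ha =>
    continuous_of_uniform_approx_of_continuous fun u hu => ?_
  obtain ⟨ε, hε, hεu⟩ := Metric.mem_uniformity_dist.1 hu
  obtain ⟨b, hb, hab⟩ := Metric.mem_closure_iff.1 ha ε hε
  exact ⟨fun x => F x b, hb, fun x => hεu ((hF x).dist_le_mul a b |>.trans_lt (by simpa using hab))⟩

variable {t : Flavor} {A B C : Type*}
  [NonUnitalCStarAlgebra A] [GradedCStarAlgebra A] [RealStructure t A]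
  [NonUnitalCStarAlgebra B] [GradedCStarAlgebra B] [RealStructure t B]
  [NonUnitalCStarAlgebra C] [GradedCStarAlgebra C] [RealStructure t C]

theorem GradedHom.lipschitzWith (φ : GradedHom t A B) : LipschitzWith 1 φ :=
  AddMonoidHomClass.lipschitz_of_bound φ 1 (by simpa using NonUnitalStarAlgHom.norm_apply_le φ)
    |>.weaken (by simp)

theorem GradedHom.joined_comp_right {ψ ψ' : GradedHom t B C} (h : Joined ψ ψ')
    (φ : GradedHom t A B) : Joined (ψ.comp φ) (ψ'.comp φ) :=
  h.map (f := fun ψ : GradedHom t B C => ψ.comp φ)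
    (GradedHom.continuous_iff.2 fun a => GradedHom.continuous_eval (φ a))

/-- A path of homomorphisms `B → C` induces a continuous family of homomorphisms
`A ⊗̂ B → A ⊗̂ C`. -/
theorem GradedHom.continuous_tensor_id {X : Type*} [TopologicalSpace X] {φ : X → GradedHom t B C}
    (hφ : Continuous φ) :
    Continuous fun p : MaxTensor A B × X => (GradedHom.id A t).tensor (φ p.2) p.1 := by
  -- All homomorphisms are contractions, so joint continuity follows from continuity in the
  -- parameter for each fixed `z`. That is a closed condition on `z`, to be checked on elementary
  -- tensors.
  refine continuous_prod_of_continuous_lipschitzWith _ 1 (fun z => ?_)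
    (fun x => ((GradedHom.id A t).tensor (φ x)).lipschitzWith)
  have hcl := isClosed_setOf_continuous fun x => ((GradedHom.id A t).tensor (φ x)).lipschitzWith
  induction z using CStarCompletion.ind with
  | hp => exact hcl
  | h z =>
    induction z using AlgTensor.ind with
    | zero => simp only [CStarCompletion.of_zero, map_zero]; exact continuous_const
    | add x y hx hy => simp only [CStarCompletion.of_add, map_add]; exact hx.add hy
    | tmul a b =>
      change Continuous fun x => (GradedHom.id A t).tensor (φ x) (tmul a b)
      simp only [GradedHom.tensor_tmul]
      exact continuous_tmul.comp
        (continuous_const.prodMk ((GradedHom.continuous_eval b).comp hφ))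

theorem GradedHom.continuous_tensor_comp (A : Type*) [NonUnitalCStarAlgebra A]
    [GradedCStarAlgebra A] [RealStructure t A] (D : Type*) [NonUnitalCStarAlgebra D]
    [GradedCStarAlgebra D] [RealStructure t D] {X : Type*} [TopologicalSpace X]
    {φ : X → GradedHom t B C} (hφ : Continuous φ) :
    Continuous fun p : X × GradedHom t D (MaxTensor A B) =>
      ((GradedHom.id A t).tensor (φ p.1)).comp p.2 := by
  refine GradedHom.continuous_iff.2 fun d => ?_
  have h1 : Continuous fun p : X × GradedHom t D (MaxTensor A B) => (p.2 d, p.1) :=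
    ((GradedHom.continuous_eval d).comp continuous_snd).prodMk continuous_fst
  have h2 := (GradedHom.continuous_tensor_id (A := A) hφ).comp h1
  refine h2.congr fun p => ?_
  rw [Function.comp_apply, GradedHom.comp_apply]

theorem GradedHom.homotopicRel_of_path {Y Z : Type*} [TopologicalSpace Y] [TopologicalSpace Z]
    {f g : C(Y, Z)} {y : Y} (F : unitInterval × Y → Z) (hF : Continuous F)
    (h0 : ∀ x, F (0, x) = f x) (h1 : ∀ x, F (1, x) = g x) (h : ∀ s, F (s, y) = f y) :
    f.HomotopicRel g {y} :=
  ⟨⟨⟨⟨F, hF⟩, h0, h1⟩, fun s x hx => by rw [Set.mem_singleton_iff.1 hx]; exact h s⟩⟩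

/-- Joined homomorphisms `B → C` induce homotopic maps `Hom(D, A ⊗̂ B) → Hom(D, A ⊗̂ C)`. -/
theorem GradedHom.homotopicRel_postcomp (A : Type*) [NonUnitalCStarAlgebra A]
    [GradedCStarAlgebra A] [RealStructure t A] (D : Type*) [NonUnitalCStarAlgebra D]
    [GradedCStarAlgebra D] [RealStructure t D] {φ ψ : GradedHom t B C} (h : Joined φ ψ) :
    (GradedHom.postcomp (C := D) ((GradedHom.id A t).tensor φ)).HomotopicRel
      (GradedHom.postcomp ((GradedHom.id A t).tensor ψ)) {0} := by
  obtain ⟨γ⟩ := h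
  refine GradedHom.homotopicRel_of_path _ (GradedHom.continuous_tensor_comp A D γ.continuous)
    (fun χ => ?_) (fun χ => ?_) (fun s => ?_)
  · dsimp only; rw [γ.source]; rfl
  · dsimp only; rw [γ.target]; rfl
  · exact (GradedHom.postcomp_zero ((GradedHom.id A t).tensor (γ s))).trans
      (GradedHom.postcomp_zero ((GradedHom.id A t).tensor φ)).symm

/-! ### Even isometries and conjugation by them. -/

open ContinuousLinearMap

variable (t) (H : Type*) [NormedAddCommGroup H] [InnerProductSpace ℂ H] [CompleteSpace H]
  [GradedHilbertSpace H] [RealHilbertStructure t H]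

/-- An even (and Real, in the Real theory) isometry. -/
structure EvenIsometry where
  toLI : H →ₗᵢ[ℂ] H
  map_parity : ∀ x, toLI (parity x) = parity (toLI x)
  map_hbar : ∀ (h : t = .real) x, toLI (hbar h x) = hbar h (toLI x)

variable {t H}

namespace EvenIsometry

/-- Conjugation by an even isometry. -/
def ad (V : EvenIsometry t H) : GradedHom t (CompactOp H) (CompactOp H) :=
  gradedAd V.toLI.toContinuousLinearMap (fun x y => V.toLI.inner_map_map x y) V.map_parity
    V.map_hbar

theorem ad_ro (V : EvenIsometry t H) (x y : H) : V.ad (ro x y) = ro (V.toLI x) (V.toLI y) := by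
  ext z
  change V.toLI ((ro x y).1 (adjoint V.toLI.toContinuousLinearMap z)) = _
  rw [ro_apply, ro_apply, map_smul, adjoint_inner_right]
  rfl

theorem ext_ro {φ ψ : GradedHom t (CompactOp H) (CompactOp H)}
    (h : ∀ x y, φ (ro x y) = ψ (ro x y)) : φ = ψ := by
  let f : CompactOp H →ₗ[ℂ] CompactOp H :=
    { toFun := φ, map_add' := map_add φ, map_smul' := map_smul φ }
  let g : CompactOp H →ₗ[ℂ] CompactOp H :=
    { toFun := ψ, map_add' := map_add ψ, map_smul' := map_smul ψ }
  exact GradedHom.ext fun T => mem_of_dense (LinearMap.eqLocus f g)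
    (isClosed_eq φ.continuous ψ.continuous) dense_span_homogeneous (fun x _ y _ => h x y) T

/-- The composition. -/
def comp (V W : EvenIsometry t H) : EvenIsometry t H :=
  ⟨V.toLI.comp W.toLI, fun x => by
    change V.toLI (W.toLI (parity x)) = _; rw [W.map_parity, V.map_parity]; rfl, fun h x => by
    change V.toLI (W.toLI (hbar h x)) = _; rw [W.map_hbar, V.map_hbar]; rfl⟩

theorem ad_comp (V W : EvenIsometry t H) : (V.comp W).ad = V.ad.comp W.ad :=
  ext_ro fun x y => by rw [GradedHom.comp_apply, ad_ro, ad_ro, ad_ro]; rfl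

/-- A strongly continuous path of isometries induces a path of homomorphisms. -/
theorem joined_ad (V : unitInterval → EvenIsometry t H)
    (hV : ∀ x, Continuous fun s => (V s).toLI x) : Joined (V 0).ad (V 1).ad := by
  refine ⟨⟨⟨fun s => (V s).ad, GradedHom.continuous_iff.2 fun T => ?_⟩, rfl, rfl⟩⟩
  -- The operators `T` along which the path is norm continuous form a closed subspace. It contains
  -- the rank one operators, since conjugation sends `ro x y` to `ro (V x) (V y)`; strong continuity
  -- of `V` is therefore enough.
  let M : Submodule ℂ (CompactOp H) :=
    { carrier := {T | Continuous fun s => (V s).ad T}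
      zero_mem' := by simp only [Set.mem_ofPred_eq, map_zero]; exact continuous_const
      add_mem' := fun hS hT => by
        simp only [Set.mem_ofPred_eq, map_add] at *
        exact hS.add hT
      smul_mem' := fun c T hT => by
        simp only [Set.mem_ofPred_eq, map_smul] at *
        exact hT.const_smul c }
  refine mem_of_dense M (isClosed_setOf_continuous fun s => (V s).ad.lipschitzWith)
    dense_span_homogeneous (fun x _ y _ => ?_) T
  change Continuous fun s => (V s).ad (ro x y)
  simp only [ad_ro]
  exact continuous_ro.comp ((hV x).prodMk (hV y))

/-- A path of isometries is strongly continuous if it is continuous on a basis. -/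
theorem continuous_apply_of_basis {X ι : Type*} [TopologicalSpace X] (b : HilbertBasis ι ℂ H)
    {V : X → EvenIsometry t H} (hV : ∀ i, Continuous fun s => (V s).toLI (b i)) (x : H) :
    Continuous fun s => (V s).toLI x := by
  let M : Submodule ℂ H :=
    { carrier := {x | Continuous fun s => (V s).toLI x}
      zero_mem' := by simp only [Set.mem_ofPred_eq, map_zero]; exact continuous_const
      add_mem' := fun hS hT => by
        simp only [Set.mem_ofPred_eq, map_add] at *
        exact hS.add hT
      smul_mem' := fun c T hT => by
        simp only [Set.mem_ofPred_eq, map_smul] at *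
        exact hT.const_smul c }
  have hM : IsClosed (M : Set H) :=
    isClosed_setOf_continuous fun s => (V s).toLI.lipschitz
  have h : Submodule.span ℂ (Set.range b) ≤ M := Submodule.span_le.2 (by
    rintro _ ⟨i, rfl⟩; exact hV i)
  have h2 := Submodule.topologicalClosure_minimal _ h hM
  rw [b.dense_span] at h2
  exact h2 (Submodule.mem_top (x := x))

end EvenIsometry

/-- The family `v` need not span a dense subspace, so shifts and other non-surjective isometries are
covered. -/
theorem exists_evenIsometry {ι : Type*} {p : ι → Bool} (B : AdaptedBasis t ι p H) {v : ι → H}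
    (hv : Orthonormal ℂ v) (hp : ∀ i, parity (v i) = sgn (p i) • v i)
    (hb : ∀ (h : t = .real) i, hbar h (v i) = v i) :
    ∃ V : EvenIsometry t H, ∀ i, V.toLI (B.basis i) = v i := by
  classical
  let V : H →ₗᵢ[ℂ] H := hv.orthogonalFamily.linearIsometry.comp B.basis.repr.toLinearIsometry
  have hV : ∀ i, V (B.basis i) = v i := fun i => by
    change hv.orthogonalFamily.linearIsometry (B.basis.repr (B.basis i)) = v i
    rw [HilbertBasis.repr_self, OrthogonalFamily.linearIsometry_apply_single,
      LinearIsometry.toSpanSingleton_apply, one_smul]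
  refine ⟨⟨V, fun x => ?_, fun h x => ?_⟩, hV⟩
  · have h1 : V.toContinuousLinearMap ∘L parity = parity ∘L V.toContinuousLinearMap :=
      HilbertBasis.clm_ext B.basis fun i => by
        change V (parity (B.basis i)) = parity (V (B.basis i))
        rw [B.parity_basis, V.map_smul, hV, hp]
    exact DFunLike.congr_fun h1 x
  · have h1 : V.toContinuousLinearMap.comp (hbar h) =
        (hbar h : H →L⋆[ℂ] H).comp V.toContinuousLinearMap :=
      HilbertBasis.clm_ext B.basis fun i => by
        change V (hbar h (B.basis i)) = hbar h (V (B.basis i))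
        rw [B.hbar_basis, hV, hb]
    exact DFunLike.congr_fun h1 x

open Real in
/-- The rotation of an isometry to an isometry with orthogonal range. -/
theorem EvenIsometry.joined_ad_of_orthogonal (V W : EvenIsometry t H)
    (h : ∀ x y, ⟪V.toLI x, W.toLI y⟫_ℂ = 0) : Joined V.ad W.ad := by
  have h' : ∀ x y, ⟪W.toLI x, V.toLI y⟫_ℂ = 0 := fun x y => inner_eq_zero_symm.1 (h y x)
  -- Orthogonality of the ranges makes every `cos r V + sin r W` an isometry, and real coefficients
  -- keep it compatible with the conjugation.
  let L : ℝ → H →ₗ[ℂ] H := fun r =>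
    (cos r : ℂ) • V.toLI.toLinearMap + (sin r : ℂ) • W.toLI.toLinearMap
  have hL : ∀ r x, L r x = (cos r : ℂ) • V.toLI x + (sin r : ℂ) • W.toLI x := fun _ _ => rfl
  have hn : ∀ r x, ‖L r x‖ = ‖x‖ := fun r x => by
    rw [← sq_eq_sq₀ (norm_nonneg _) (norm_nonneg _), hL, @norm_add_sq ℂ, inner_smul_left,
      inner_smul_right, h, norm_smul, norm_smul, V.toLI.norm_map, W.toLI.norm_map,
      Complex.norm_real, Complex.norm_real, mul_pow, mul_pow, norm_eq_abs, norm_eq_abs, sq_abs,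
      sq_abs]
    simp only [mul_zero, map_zero, add_zero]
    rw [← add_mul, cos_sq_add_sin_sq, one_mul]
  let F : ℝ → EvenIsometry t H := fun r =>
    ⟨⟨L r, hn r⟩, fun x => by
      change L r _ = parity (L r x)
      rw [hL, hL, map_add, map_smul, map_smul, V.map_parity, W.map_parity], fun hr x => by
      change L r _ = hbar hr (L r x)
      rw [hL, hL, map_add, map_smulₛₗ, map_smulₛₗ, V.map_hbar, W.map_hbar, Complex.conj_ofReal,
        Complex.conj_ofReal]⟩
  have hF : ∀ r x, (F r).toLI x = (cos r : ℂ) • V.toLI x + (sin r : ℂ) • W.toLI x :=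
    fun _ _ => rfl
  have hj := EvenIsometry.joined_ad (fun s => F (π / 2 * s)) fun x => by
    simp only [hF]
    exact (Continuous.smul (by fun_prop) continuous_const).add
      (Continuous.smul (by fun_prop) continuous_const)
  have h0 : (F (π / 2 * (0 : unitInterval))).ad = V.ad := EvenIsometry.ext_ro fun x y => by
    simp [EvenIsometry.ad_ro, hF]
  have h1 : (F (π / 2 * (1 : unitInterval))).ad = W.ad := EvenIsometry.ext_ro fun x y => by
    simp [EvenIsometry.ad_ro, hF]
  rwa [h0, h1] at hj

open Real in
/-- Functions that rotate the natural numbers one after the other. -/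
theorem exists_stages : ∃ c d : ℕ → ℝ → ℝ, (∀ n, Continuous (c n)) ∧ (∀ n, Continuous (d n)) ∧
    (∀ n s, c n s ^ 2 + d n s ^ 2 = 1) ∧ (∀ m n s, m < n → c m s * d n s = 0) ∧
    (∀ n, c n 0 = 1) ∧ (∀ n, d n 0 = 0) ∧ (∀ n, c n 1 = 0) ∧ ∀ n, d n 1 = 1 := by
  -- Stage `n` occupies the interval from `n/(n+1)` to `(n+1)/(n+2)`, on which the angle grows
  -- linearly from `0` to `π/2`. Successive intervals share only an end point and accumulate at `1`.
  let θ : ℕ → ℝ → ℝ := fun n s => π / 2 * max 0 (min 1 ((s * (n + 1) - n) * (n + 2)))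
  have hθ : ∀ n, Continuous (θ n) := fun n => by fun_prop
  have h0 : ∀ (n : ℕ) (s : ℝ), s * (n + 1) ≤ n → θ n s = 0 := fun n s hs => by
    have h : (s * (n + 1) - n) * (n + 2) ≤ 0 :=
      mul_nonpos_of_nonpos_of_nonneg (by linarith) (by positivity)
    simp only [θ, max_eq_left (min_le_of_right_le h), mul_zero]
  have h1 : ∀ (n : ℕ) (s : ℝ), (n : ℝ) + 1 ≤ s * (n + 2) → θ n s = π / 2 := fun n s hs => by
    have h : 1 ≤ (s * (n + 1) - n) * (n + 2) := by
      have hn : (0 : ℝ) ≤ n := by positivity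
      nlinarith
    simp only [θ, min_eq_left h, max_eq_right zero_le_one, mul_one]
  refine ⟨fun n s => cos (θ n s), fun n s => sin (θ n s), fun n => by fun_prop, fun n => by fun_prop,
    fun n s => cos_sq_add_sin_sq _, fun m n s hmn => ?_, fun n => ?_, fun n => ?_, fun n => ?_,
    fun n => ?_⟩
  · dsimp only
    have hmn' : (m : ℝ) + 1 ≤ n := by exact_mod_cast hmn
    -- Either stage `n` has not begun and its sine is `0`, or it has begun, and then the earlier
    -- stage `m` is over and its cosine is `0`.
    rcases le_total (s * (n + 1)) n with hs | hs
    · rw [h0 n s hs, sin_zero, mul_zero]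
    · have hm : (0 : ℝ) ≤ m := by positivity
      have hs1 : (m : ℝ) + 1 ≤ s * (m + 2) := by
        have hn1 : (0 : ℝ) < n + 1 := by positivity
        have h3 : (n : ℝ) / (n + 1) ≤ s := by rw [div_le_iff₀ hn1]; exact hs
        have h4 : ((m : ℝ) + 1) / (m + 2) ≤ n / (n + 1) := by
          rw [div_le_div_iff₀ (by positivity) hn1]; nlinarith
        have h5 := h4.trans h3
        rwa [div_le_iff₀ (by positivity)] at h5
      rw [h1 m s hs1, cos_pi_div_two, zero_mul]
  · dsimp only; rw [h0 n 0 (by rw [zero_mul]; positivity), cos_zero]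
  · dsimp only; rw [h0 n 0 (by rw [zero_mul]; positivity), sin_zero]
  · dsimp only; rw [h1 n 1 (by linarith), cos_pi_div_two]
  · dsimp only; rw [h1 n 1 (by linarith), sin_pi_div_two]

/-- A shift of an adapted basis is connected to the identity by a strongly continuous path of
isometries. -/
theorem exists_shift (B : AdaptedBasis t (ℕ × Bool) Prod.snd H) {f : ℕ → ℕ}
    (hf : Function.Injective f) (hlt : ∀ n, n < f n) :
    ∃ V : EvenIsometry t H, (∀ n q, V.toLI (B.basis (n, q)) = B.basis (f n, q)) ∧
      Joined V.ad (GradedHom.id (CompactOp H) t) := by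
  obtain ⟨c, d, hc, hd, hcd, hz, hc0, hd0, hc1, hd1⟩ := exists_stages
  -- The vector of index `k` turns from its shifted place at `s = 0` to its own place at `s = 1`.
  -- Two such vectors can overlap only if one index is the shift of the other. The overlap then
  -- contains a cosine of the smaller index times a sine of the larger one, which vanishes by `hz`.
  let v : ℝ → ℕ × Bool → H := fun s k =>
    (c k.1 s : ℂ) • B.basis (f k.1, k.2) + (d k.1 s : ℂ) • B.basis k
  have hi : ∀ i j, ⟪B.basis i, B.basis j⟫_ℂ = if i = j then 1 else 0 := by
    classical exact orthonormal_iff_ite.1 B.basis.orthonormal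
  have hv : ∀ s, Orthonormal ℂ (v s) := fun s => by
    refine ⟨fun k => ?_, fun k l hkl => ?_⟩
    · have hk : (f k.1, k.2) ≠ k := fun h => (hlt k.1).ne' (congrArg Prod.fst h)
      rw [← sq_eq_sq₀ (norm_nonneg _) zero_le_one, @norm_add_sq ℂ, inner_smul_left,
        inner_smul_right, hi, if_neg hk, norm_smul, norm_smul, B.basis.orthonormal.1,
        B.basis.orthonormal.1, Complex.norm_real, Complex.norm_real, mul_one, mul_one,
        Real.norm_eq_abs, Real.norm_eq_abs, sq_abs, sq_abs]
      simp only [mul_zero, map_zero, add_zero]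
      rw [hcd, one_pow]
    · simp only [v, inner_add_left, inner_add_right, inner_smul_left, inner_smul_right, hi,
        Complex.conj_ofReal]
      have e1 : (f k.1, k.2) ≠ (f l.1, l.2) := fun h =>
        hkl (Prod.ext (hf (Prod.ext_iff.1 h).1) (Prod.ext_iff.1 h).2)
      have e2 : (if (f k.1, k.2) = l then (1 : ℂ) else 0) * (c k.1 s * d l.1 s) = 0 := by
        split_ifs with h
        · have := hz k.1 l.1 s (by rw [← h]; exact hlt _)
          rw [one_mul]; exact_mod_cast this
        · rw [zero_mul]
      have e3 : (if k = (f l.1, l.2) then (1 : ℂ) else 0) * (c l.1 s * d k.1 s) = 0 := by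
        split_ifs with h
        · have := hz l.1 k.1 s (by rw [h]; exact hlt _)
          rw [one_mul]; exact_mod_cast this
        · rw [zero_mul]
      rw [if_neg e1, if_neg hkl]
      linear_combination e2 + e3
  have hp : ∀ s k, parity (v s k) = sgn k.2 • v s k := fun s k => by
    simp only [v, map_add, map_smul, B.parity_basis, smul_add, smul_comm (sgn k.2)]
  have hb : ∀ s (h : t = .real) k, hbar h (v s k) = v s k := fun s h k => by
    simp only [v, map_add, map_smulₛₗ, B.hbar_basis, Complex.conj_ofReal]
  choose V hV using fun s => exists_evenIsometry B (hv s) (hp s) (hb s)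
  -- Strong continuity needs checking on one basis vector at a time, so the accumulation of stages
  -- at `s = 1` does no harm; the path need not be norm continuous.
  have hj := EvenIsometry.joined_ad (fun s => V (s : unitInterval)) fun x =>
    EvenIsometry.continuous_apply_of_basis B.basis (fun k => by
      simp only [hV, v]
      exact (Continuous.smul (Complex.continuous_ofReal.comp
          ((hc k.1).comp continuous_subtype_val)) continuous_const).add
        (Continuous.smul (Complex.continuous_ofReal.comp
          ((hd k.1).comp continuous_subtype_val)) continuous_const)) x
  have h1 : (V (1 : unitInterval)).ad = GradedHom.id (CompactOp H) t := by
    have : (V (1 : unitInterval)).toLI.toContinuousLinearMap = ContinuousLinearMap.id ℂ H :=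
      HilbertBasis.clm_ext B.basis fun k => by
        change (V (1 : unitInterval)).toLI (B.basis k) = B.basis k
        rw [hV]
        simp [v, hc1, hd1]
    have h : ∀ x, (V (1 : unitInterval)).toLI x = x := fun x => DFunLike.congr_fun this x
    exact EvenIsometry.ext_ro fun x y => by
      rw [EvenIsometry.ad_ro, h, h]; rfl
  rw [h1] at hj
  refine ⟨V (0 : unitInterval), fun n q => ?_, hj⟩
  rw [hV]
  simp [v, hc0, hd0]

/-- Conjugation by an even isometry is connected to the identity. -/
theorem EvenIsometry.joined_ad_id (B : AdaptedBasis t (ℕ × Bool) Prod.snd H)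
    (V : EvenIsometry t H) : Joined V.ad (GradedHom.id (CompactOp H) t) := by
  -- The index maps `2n + 1` and `2n + 2` have disjoint images, so the two shifts have orthogonal
  -- ranges. The plain doubling `2n` would not do, since it fixes `0` and a shift must move every
  -- index up.
  obtain ⟨S, hS, hS1⟩ := exists_shift B (f := fun n => 2 * n + 1) (fun a b h => by
    dsimp only at h; omega) (fun n => by omega)
  obtain ⟨S', hS', hS1'⟩ := exists_shift B (f := fun n => 2 * n + 2) (fun a b h => by
    dsimp only at h; omega) (fun n => by omega)
  have ho : ∀ x y, ⟪S.toLI x, S'.toLI y⟫_ℂ = 0 := fun x y => by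
    have h1 : ∀ k, innerSL ℂ (S.toLI (B.basis k)) ∘L S'.toLI.toContinuousLinearMap = 0 := fun k =>
      HilbertBasis.clm_ext B.basis fun l => by
        change ⟪S.toLI (B.basis k), S'.toLI (B.basis l)⟫_ℂ = 0
        rw [hS k.1 k.2, hS' l.1 l.2]
        exact B.basis.orthonormal.2 fun h => by
          have := congrArg Prod.fst h
          dsimp only at this
          omega
    have h2 : innerSL ℂ (S'.toLI y) ∘L S.toLI.toContinuousLinearMap = 0 :=
      HilbertBasis.clm_ext B.basis fun k =>
        inner_eq_zero_symm.1 (DFunLike.congr_fun (h1 k) y)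
    exact inner_eq_zero_symm.1 (DFunLike.congr_fun h2 x)
  -- The chain is `V ∼ S V ∼ S' ∼ 1`: the path for `S` composed with `V`, a rotation between
  -- orthogonal ranges, and the path for `S'`. Surjectivity of `V` plays no role.
  have e1 : Joined (S.comp V).ad V.ad := by
    rw [EvenIsometry.ad_comp]
    exact GradedHom.joined_comp_right hS1 V.ad
  exact (e1.symm.trans (EvenIsometry.joined_ad_of_orthogonal (S.comp V) S'
    fun x y => ho (V.toLI x) y)).trans hS1'

end Paths

/-! ### Pointed homotopy equivalences and homotopy groups -/

section HomotopyGroups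

variable {X Y Z : Type*} [TopologicalSpace X] [TopologicalSpace Y] [TopologicalSpace Z]

theorem HomotopicRel.precomp {W : Type*} [TopologicalSpace W] {f g : C(X, Y)} {S : Set X}
    (h : f.HomotopicRel g S) (k : C(W, X)) {T : Set W} (hk : ∀ w ∈ T, k w ∈ S) :
    (f.comp k).HomotopicRel (g.comp k) T := by
  obtain ⟨F⟩ := h
  exact ⟨⟨F.toHomotopy.compContinuousMap k, fun s w hw => F.prop s (k w) (hk w hw)⟩⟩

/-- A map that becomes homotopic to the identity after composition with a homeomorphism is a
homotopy equivalence. -/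
theorem IsPointedHomotopyEquiv.of_comp {f : C(X, Y)} {g : C(Y, X)} {g' : C(X, Y)} {x : X} {y : Y}
    (hf : f x = y) (hg : g y = x)
    (h : (g.comp f).HomotopicRel (ContinuousMap.id X) {x}) (h₁ : ∀ y, g' (g y) = y) :
    IsPointedHomotopyEquiv f x y := by
  refine ⟨hf, g, hg, h, ?_⟩
  -- The other homotopy is `f g = g' (g f) g ∼ g' g = 1`, which uses only that `g'` is a left
  -- inverse of `g`.
  have h2 := (HomotopicRel.precomp h g (T := {y}) (by
    rintro _ rfl; exact hg)).comp_continuousMap g'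
  have e1 : g'.comp ((g.comp f).comp g) = f.comp g := ContinuousMap.ext fun z => h₁ _
  have e2 : g'.comp ((ContinuousMap.id X).comp g) = ContinuousMap.id Y :=
    ContinuousMap.ext fun z => h₁ z
  rwa [e1, e2] at h2

variable (N : Type*)

theorem homotopyGroupMap_leftInverse {f : C(X, Y)} {g : C(Y, X)} {x : X} {y : Y} (hf : f x = y)
    (hg : g y = x) (h : (g.comp f).HomotopicRel (ContinuousMap.id X) {x}) :
    Function.LeftInverse (homotopyGroupMap N g hg) (homotopyGroupMap N f hf) := by
  intro a
  induction a using Quotient.inductionOn with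
  | h p =>
    refine Quotient.sound ?_
    exact HomotopicRel.precomp h p.1 fun s hs => p.2 s hs

/-- Pointed homotopy equivalences induce bijections of homotopy groups. -/
theorem IsPointedHomotopyEquiv.bijective {f : C(X, Y)} {x : X} {y : Y}
    (h : IsPointedHomotopyEquiv f x y) (hf : f x = y) :
    Function.Bijective (homotopyGroupMap N f hf) := by
  obtain ⟨-, g, hg, h1, h2⟩ := h
  exact ⟨(homotopyGroupMap_leftInverse N hf hg h1).injective,
    (homotopyGroupMap_leftInverse N hg hf h2).surjective⟩

/-- The product is represented by concatenating cubes along one coordinate `i`, and composition with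
`f` commutes with concatenation. -/
theorem homotopyGroupMap_mul [DecidableEq N] [Nonempty N] (f : C(X, Y)) {x : X} {y : Y}
    (hf : f x = y) (a b : HomotopyGroup N X x) :
    homotopyGroupMap N f hf (a * b) = homotopyGroupMap N f hf a * homotopyGroupMap N f hf b := by
  induction a using Quotient.inductionOn with
  | h p =>
  induction b using Quotient.inductionOn with
  | h q =>
  have hp : ∀ (p : GenLoop N X x), ∀ s ∈ Cube.boundary N, f.comp p.1 s = y := fun p s hs => by
    rw [ContinuousMap.comp_apply, p.2 s hs, hf]
  let i : N := Classical.arbitrary N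
  have h1 := HomotopyGroup.mul_spec (i := i) (p := p) (q := q)
  have h2 := HomotopyGroup.mul_spec (i := i) (p := (⟨f.comp p.1, hp p⟩ : GenLoop N Y y))
    (q := ⟨f.comp q.1, hp q⟩)
  refine (congrArg (homotopyGroupMap N f hf) h1).trans (Eq.trans ?_ h2.symm)
  refine congrArg (Quotient.mk (GenLoop.Homotopic.setoid N y)) (GenLoop.ext _ _ fun s => ?_)
  change f (if _ then _ else _) = if _ then _ else _
  split_ifs <;> rfl

/-- This is used with all three vertical maps equal to `𝕂(Φ)` and both pairings equal to the H-space
sum; the identity already holds for representatives. -/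
theorem homotopyGroupMap_map₂ {X' Y' Z' : Type*} [TopologicalSpace X'] [TopologicalSpace Y']
    [TopologicalSpace Z'] {m : C(X × Y, Z)} {m' : C(X' × Y', Z')} {f : C(X, X')} {g : C(Y, Y')}
    {k : C(Z, Z')} {x : X} {y : Y} {z : Z} {x' : X'} {y' : Y'} {z' : Z'} (hm : m (x, y) = z)
    (hm' : m' (x', y') = z') (hf : f x = x') (hg : g y = y') (hk : k z = z')
    (h : ∀ a b, k (m (a, b)) = m' (f a, g b)) (a : HomotopyGroup N X x)
    (b : HomotopyGroup N Y y) :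
    homotopyGroupMap N k hk (homotopyGroupMap₂ N m hm a b) =
      homotopyGroupMap₂ N m' hm' (homotopyGroupMap N f hf a) (homotopyGroupMap N g hg b) := by
  induction a using Quotient.inductionOn with
  | h p =>
  induction b using Quotient.inductionOn with
  | h q =>
  exact congrArg (Quotient.mk (GenLoop.Homotopic.setoid N z')) (GenLoop.ext _ _ fun s => h _ _)

end HomotopyGroups

/-! ### The Hilbert space `ℓ² ⊕ ℓ²` -/

section HatL2

open scoped lp

theorem separableSpace_lp : TopologicalSpace.SeparableSpace (ℓ²(ℕ, ℂ)) := by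
  let b : HilbertBasis ℕ ℂ (ℓ²(ℕ, ℂ)) := default
  have h1 : TopologicalSpace.IsSeparable (Set.range b) :=
    (Set.countable_range b).isSeparable
  have h2 := (h1.span (R := ℂ)).closure
  have h3 : closure (Submodule.span ℂ (Set.range b) : Set (ℓ²(ℕ, ℂ))) = Set.univ := by
    rw [← Submodule.topologicalClosure_coe, b.dense_span]
    rfl
  rw [h3] at h2
  exact TopologicalSpace.isSeparable_univ_iff.1 h2

instance : TopologicalSpace.SeparableSpace HatL2 := by
  have := separableSpace_lp
  have h : Continuous fun p : ℓ²(ℕ, ℂ) × ℓ²(ℕ, ℂ) => HatL2.mk p.1 p.2 :=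
    WithLp.prod_continuous_toLp 2 (ℓ²(ℕ, ℂ)) (ℓ²(ℕ, ℂ))
  exact DenseRange.separableSpace (Function.Surjective.denseRange fun z => ⟨(z.fst, z.snd), rfl⟩) h

/-- The image of a Hilbert basis of `ℓ²` is an infinite linearly independent family in `V`. -/
theorem not_finiteDimensional_of_linearMap {V : Submodule ℂ HatL2} (f : ℓ²(ℕ, ℂ) →ₗ[ℂ] HatL2)
    (hf : Function.Injective f) (hV : ∀ x, f x ∈ V) : ¬ FiniteDimensional ℂ V := fun h => by
  let b : HilbertBasis ℕ ℂ (ℓ²(ℕ, ℂ)) := default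
  have hb : LinearIndependent ℂ b := b.orthonormal.linearIndependent
  let g : ℓ²(ℕ, ℂ) →ₗ[ℂ] V := f.codRestrict V hV
  have hg : Function.Injective g := fun x y hxy => hf (congrArg Subtype.val hxy)
  have := (hb.map' g (LinearMap.ker_eq_bot.2 hg)).finite_of_isNoetherian
  exact not_finite ℕ

theorem HatL2.not_finiteDimensional_even : ¬ FiniteDimensional ℂ (evenSubspace HatL2) :=
  not_finiteDimensional_of_linearMap
    { toFun := fun x => HatL2.mk x 0
      map_add' := fun x y => by
        change HatL2.mk (x + y) 0 = HatL2.mk (x + y) (0 + 0); rw [add_zero]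
      map_smul' := fun c x => by
        change HatL2.mk (c • x) 0 = HatL2.mk (c • x) (c • 0); rw [smul_zero] }
    (fun x y h => congrArg HatL2.fst h) (fun x => by
      change HatL2.mk x (-0) = HatL2.mk x 0; rw [neg_zero])

theorem HatL2.not_finiteDimensional_odd : ¬ FiniteDimensional ℂ (oddSubspace HatL2) :=
  not_finiteDimensional_of_linearMap
    { toFun := fun x => HatL2.mk 0 x
      map_add' := fun x y => by
        change HatL2.mk 0 (x + y) = HatL2.mk (0 + 0) (x + y); rw [add_zero]
      map_smul' := fun c x => by
        change HatL2.mk 0 (c • x) = HatL2.mk (c • 0) (c • x); rw [smul_zero] }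
    (fun x y h => congrArg HatL2.snd h) (fun x => by
      change HatL2.mk 0 (-x) = HatL2.mk (-0) (-x); rw [neg_zero])

end HatL2

/-! ### Stability -/

section Stability

open ContinuousLinearMap

variable {t : Flavor} {A : Type*} [NonUnitalCStarAlgebra A] [GradedCStarAlgebra A]
  [RealStructure t A]
  {G : Type*} [NormedAddCommGroup G] [InnerProductSpace ℂ G] [CompleteSpace G]
  [GradedHilbertSpace G] [RealHilbertStructure t G]
  {H : Type*} [NormedAddCommGroup H] [InnerProductSpace ℂ H] [CompleteSpace H]
  [GradedHilbertSpace H] [RealHilbertStructure t H]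

/-- A projection of rank one onto an even (and Real) subspace is given by an even (and Real) unit
vector. -/
theorem IsEvenRankOneProjection.exists_eq_ro {e : CompactOp G}
    (he : IsEvenRankOneProjection t e) : ∃ v : G, ‖v‖ = 1 ∧ parity v = v ∧
      (∀ h : t = .real, hbar h v = v) ∧ e = ro v v := by
  set K := (e.1 : G →ₗ[ℂ] G).range with hK
  have hne : K ≠ ⊥ := fun h => by
    have := he.finrank_range
    rw [← hK, h, finrank_bot] at this
    exact zero_ne_one this
  -- The range is invariant under parity because it consists of even vectors, and under conjugation
  -- because `e` is Real.
  obtain ⟨v, hv, hv1, -, hvb⟩ := exists_isAdapted t K hne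
    (fun x hx => by rw [show parity x = x from he.range_le hx]; exact hx)
    (fun h x hx => by
      obtain ⟨y, rfl⟩ := hx
      have h1 : (bar h e).1 (hbar h y) = e.1 (hbar h y) := by rw [he.real h]
      rw [CompactOp.bar_apply, hbar_hbar] at h1
      exact ⟨hbar h y, h1.symm⟩)
  refine ⟨v, hv1, he.range_le hv, hvb, ?_⟩
  have hev : e.1 v = v := by
    obtain ⟨y, rfl⟩ := hv
    have h1 : (e * e).1 y = e.1 y := by rw [he.isStarProjection.isIdempotentElem]
    exact h1
  have hadj : adjoint e.1 = e.1 := congrArg Subtype.val he.isStarProjection.isSelfAdjoint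
  have hv0' : v ≠ 0 := fun h => by simp [h] at hv1
  have hv0 : (⟨v, hv⟩ : K) ≠ 0 := fun h => hv0' (congrArg Subtype.val h)
  ext x
  -- In a one-dimensional range `e x = c v`, and self-adjointness together with `e v = v` gives `c =
  -- ⟨v, e x⟩ = ⟨v, x⟩`.
  obtain ⟨c, hc⟩ := (finrank_eq_one_iff_of_nonzero' _ hv0).1 he.finrank_range ⟨e.1 x, x, rfl⟩
  have hc' : c • v = e.1 x := congrArg Subtype.val hc
  have h1 : ⟪v, e.1 x⟫_ℂ = ⟪v, x⟫_ℂ := by rw [← adjoint_inner_left, hadj, hev]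
  rw [← hc', inner_smul_right, inner_self_eq_norm_sq_to_K, hv1] at h1
  rw [ro_apply, ← h1, ← hc']
  simp

namespace TensorIso

variable (w : TensorIso t G H H)

/-- The isometry `y ↦ v ⊗ y` for an even (and Real) unit vector `v`. -/
def sliceIsometry (v : G) (h1 : ‖v‖ = 1) (hp : parity v = v)
    (hb : ∀ h : t = .real, hbar h v = v) : EvenIsometry t H where
  toLI :=
    { toLinearMap := w.slice v
      norm_map' := fun y => by
        change ‖w.tm v y‖ = _
        rw [norm_tm, h1, one_mul] }
  map_parity y := by
    change w.tm v (parity y) = parity (w.tm v y)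
    rw [parity_tm, hp]
  map_hbar h y := by
    change w.tm v (hbar h y) = hbar h (w.tm v y)
    rw [hbar_tm, hb]

/-- Because `v` is even, the parity twist caused by an odd `S` has no effect. What remains is the
formula `V*(x ⊗ y) = ⟨v, x⟩ y` for `V y = v ⊗ y`. -/
theorem hom_ro_tmul (v : G) (h1 : ‖v‖ = 1) (hp : parity v = v)
    (hb : ∀ h : t = .real, hbar h v = v) (S : CompactOp H) :
    w.hom (tmul (ro v v) S) = (w.sliceIsometry v h1 hp hb).ad S := by
  have h2 : w.hom (tmul (ro v v) S) = w.kop (ro v v) S := by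
    rw [← evenPart_add_oddPart S, tmul_add, map_add, w.hom_of_even _ (grading_evenPart S),
      w.hom_of_odd _ (grading_oddPart S), CompactOp.twist_ro, hp, kop_add_right]
  rw [h2]
  refine w.compactOp_ext fun x y => ?_
  have h3 : adjoint (w.slice v) (w.tm x y) = ⟪v, x⟫_ℂ • y := ext_inner_right ℂ fun z => by
    rw [adjoint_inner_left, slice_apply, inner_tm, inner_smul_left, inner_conj_symm]
  rw [kop_tm, ro_apply, tm_smul_left]
  change _ = w.slice v (S.1 (adjoint (w.slice v) (w.tm x y)))
  rw [h3, map_smul, map_smul, slice_apply]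

theorem hom_bijective : Function.Bijective w.hom := ⟨w.hom_injective, w.hom_surjective⟩

variable (A) in
/-- The isomorphism `(A ⊗̂ 𝒦(G)) ⊗̂ 𝒦(H) → A ⊗̂ 𝒦(H)` given by an identification of `G ⊗ H`
with `H`. -/
def absorb : GradedHom t (MaxTensor (MaxTensor A (CompactOp G)) (CompactOp H))
    (MaxTensor A (CompactOp H)) :=
  ((GradedHom.id A t).tensor w.hom).comp (GradedHom.assoc t A (CompactOp G) (CompactOp H))

variable (A) in
/-- The inverse of `absorb`. -/
def absorbSymm : GradedHom t (MaxTensor A (CompactOp H))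
    (MaxTensor (MaxTensor A (CompactOp G)) (CompactOp H)) :=
  (GradedHom.assocSymm t A (CompactOp G) (CompactOp H)).comp
    ((GradedHom.id A t).tensor (w.hom.inverse w.hom_bijective))

theorem absorbSymm_absorb (x : MaxTensor (MaxTensor A (CompactOp G)) (CompactOp H)) :
    w.absorbSymm A (w.absorb A x) = x := by
  have h : ((GradedHom.id A t).tensor (w.hom.inverse w.hom_bijective)).comp
      ((GradedHom.id A t).tensor w.hom) = GradedHom.id _ t :=
    GradedHom.ext_tmul fun a b => by
      rw [GradedHom.comp_apply, GradedHom.tensor_tmul, GradedHom.tensor_tmul,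
        GradedHom.inverse_apply]
      rfl
  have h2 := DFunLike.congr_fun h (GradedHom.assoc t A (CompactOp G) (CompactOp H) x)
  rw [GradedHom.comp_apply] at h2
  rw [absorbSymm, absorb, GradedHom.comp_apply, GradedHom.comp_apply, h2]
  exact GradedHom.assocSymm_assoc x

end TensorIso

theorem isPointedHomotopyEquiv_map_corner [TopologicalSpace.SeparableSpace G]
    [TopologicalSpace.SeparableSpace H] (e : CompactOp G) (he : IsEvenRankOneProjection t e)
    (h0 : ¬ FiniteDimensional ℂ (evenSubspace H)) (h1 : ¬ FiniteDimensional ℂ (oddSubspace H)) :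
    IsPointedHomotopyEquiv (KSpace.map H (corner A e he)) 0 0 := by
  obtain ⟨v, hv1, hvp, hvb, rfl⟩ := he.exists_eq_ro
  have : Nontrivial G := ⟨v, 0, fun h => by simp [h] at hv1⟩
  obtain ⟨w⟩ := exists_tensorIso_absorb t G H h0 h1
  obtain ⟨B⟩ := exists_adaptedBasis_nat t H h0 h1
  -- On elementary tensors: `a ⊗ S ↦ (a ⊗ e) ⊗ S ↦ a ⊗ (e ⊗ S) ↦ a ⊗ V S V*`.
  have hc : (w.absorb A).comp ((corner A (ro v v) he).tensor (GradedHom.id (CompactOp H) t)) =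
      (GradedHom.id A t).tensor (w.sliceIsometry v hv1 hvp hvb).ad :=
    GradedHom.ext_tmul fun a S => by
      rw [GradedHom.comp_apply, GradedHom.tensor_tmul, GradedHom.tensor_tmul, corner_apply,
        TensorIso.absorb, GradedHom.comp_apply, GradedHom.id_apply, GradedHom.assoc_tmul,
        GradedHom.tensor_tmul, w.hom_ro_tmul v hv1 hvp hvb]
  have hid : (GradedHom.id A t).tensor (GradedHom.id (CompactOp H) t) =
      GradedHom.id (MaxTensor A (CompactOp H)) t :=
    GradedHom.ext_tmul fun a S => GradedHom.tensor_tmul _ _ _ _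
  refine IsPointedHomotopyEquiv.of_comp (g := GradedHom.postcomp (w.absorb A))
    (g' := GradedHom.postcomp (w.absorbSymm A)) (KSpace.map_zero H _)
    (GradedHom.postcomp_zero _) ?_
    (fun φ => GradedHom.ext fun f => w.absorbSymm_absorb (φ f))
  have h2 := GradedHom.homotopicRel_postcomp A SAlg
    (EvenIsometry.joined_ad_id B (w.sliceIsometry v hv1 hvp hvb))
  rw [hid, ← hc] at h2
  exact h2

/-- Grading-preserving homomorphisms on different tensor factors commute without signs. This makes
`𝕂(Φ)` compatible with the H-space sum, which involves only the second factor. -/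
theorem GradedHom.tensor_id_comp_id_tensor {B C D : Type*} [NonUnitalCStarAlgebra B]
    [GradedCStarAlgebra B] [RealStructure t B] [NonUnitalCStarAlgebra C] [GradedCStarAlgebra C]
    [RealStructure t C] [NonUnitalCStarAlgebra D] [GradedCStarAlgebra D] [RealStructure t D]
    (φ : GradedHom t A B) (χ : GradedHom t C D) (x : MaxTensor A C) :
    φ.tensor (GradedHom.id D t) ((GradedHom.id A t).tensor χ x) =
      (GradedHom.id B t).tensor χ (φ.tensor (GradedHom.id C t) x) := by
  have h : (φ.tensor (GradedHom.id D t)).comp ((GradedHom.id A t).tensor χ) =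
      ((GradedHom.id B t).tensor χ).comp (φ.tensor (GradedHom.id C t)) :=
    GradedHom.ext_tmul fun a c => by
      simp only [GradedHom.comp_apply, GradedHom.tensor_tmul, GradedHom.id_apply]
  exact DFunLike.congr_fun h x

/-- The map of spectral K-theory spaces induced by a homomorphism is compatible with the H-space
structure. -/
theorem KSpace.map_add {B : Type*} [NonUnitalCStarAlgebra B] [GradedCStarAlgebra B]
    [RealStructure t B] (χ : GradedHom t A B) (u : EvenUnitary t H) (φ ψ : KSpace t A H) :
    KSpace.map H χ (KSpace.add u φ ψ) = KSpace.add u (KSpace.map H χ φ) (KSpace.map H χ ψ) :=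
  GradedHom.ext fun f => by
    change χ.tensor (GradedHom.id (CompactOp H) t) (u.push₁ (φ f) + u.push₂ (ψ f)) = _
    rw [_root_.map_add, EvenUnitary.push₁, EvenUnitary.push₂, GradedHom.tensor_id_comp_id_tensor,
      GradedHom.tensor_id_comp_id_tensor]
    rfl

end Stability

end SpectralK

end

theorem mainTheorem10 (t : Flavor)
    (A : Type*) [NonUnitalCStarAlgebra A] [GradedCStarAlgebra A] [RealStructure t A]
    (𝓗 : Type*) [NormedAddCommGroup 𝓗] [InnerProductSpace ℂ 𝓗] [CompleteSpace 𝓗]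
    [TopologicalSpace.SeparableSpace 𝓗] [GradedHilbertSpace 𝓗] [RealHilbertStructure t 𝓗]
    (e : CompactOp 𝓗) (he : IsEvenRankOneProjection t e) :
    (∀ (H : Type*) [NormedAddCommGroup H] [InnerProductSpace ℂ H] [CompleteSpace H]
      [TopologicalSpace.SeparableSpace H] [GradedHilbertSpace H] [RealHilbertStructure t H],
      ¬ FiniteDimensional ℂ (evenSubspace H) → ¬ FiniteDimensional ℂ (oddSubspace H) →
      IsPointedHomotopyEquiv (KSpace.map H (corner A e he)) 0 0) ∧
    (∀ i : ℕ, Function.Bijective (SpectralKGroup.map i (corner A e he))) ∧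
    (∀ (i : ℕ) (x y : SpectralKGroup t A (i + 1)),
      SpectralKGroup.map (i + 1) (corner A e he) (x * y) =
        SpectralKGroup.map (i + 1) (corner A e he) x *
          SpectralKGroup.map (i + 1) (corner A e he) y) ∧
    (∀ (u : EvenUnitary t HatL2) (i : ℕ) (x y : SpectralKGroup t A i),
      SpectralKGroup.map i (corner A e he) (SpectralKGroup.add u i x y) =
        SpectralKGroup.add u i (SpectralKGroup.map i (corner A e he) x)
          (SpectralKGroup.map i (corner A e he) y)) := by
  -- The space `ℓ² ⊕ ℓ²` satisfies the hypotheses of the first assertion, so bijectivity follows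
  -- from this equivalence; compatibility with the operations is naturality.
  have hmap : IsPointedHomotopyEquiv (KSpace.map HatL2 (corner A e he)) 0 0 :=
    isPointedHomotopyEquiv_map_corner e he HatL2.not_finiteDimensional_even
      HatL2.not_finiteDimensional_odd
  refine ⟨fun H _ _ _ _ _ _ h0 h1 => isPointedHomotopyEquiv_map_corner e he h0 h1,
    fun i => hmap.bijective (Fin i) (KSpace.map_zero HatL2 _),
    fun i x y => homotopyGroupMap_mul (Fin (i + 1)) _ (KSpace.map_zero HatL2 _) x y,
    fun u i x y => ?_⟩
  exact homotopyGroupMap_map₂ (Fin i) (hSpaceAdd_zero u) (hSpaceAdd_zero u) _ _ _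
    (fun φ ψ => KSpace.map_add (corner A e he) u φ ψ) x y
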